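/- **Setting (basic problem of MacMahon's partition analysis).** Let $m,n,N,\bar d,U\ge 1$, and let $$Q(x;z)=\sum_{i=1}^{N}\frac{L_i(x;z)}{\prod_{j=1}^{\bar d}\bigl(1-M_{ij}z^{\beta_{ij}}\bigr)},\qquad x=(x_1,\dots,x_m),\ z=(z_1,\dots,z_n),$$ where each $L_i$ is a Laurent polynomial over $\mathbb Q$ written with at most $U$ monomials, each $M_{ij}$ is a Laurent monomial in $x$ with coefficient $1$, $\beta_{ij}\in\mathbb Z^n$, and no denominator factor is identically $0$. Assume that the limit $Q(x;\mathbf 1)\in\mathbb Q(x)$ at $z=(1,\dots,1)$ is well defined, i.e. $Q=P/D$ for polynomials $P,D$ with $D(x;\mathbf 1)\neq0$. Let $S$ be the family of the $\beta_{ij}$ with $M_{ij}=1$, counted with multiplicity. For a prime $p$, a vector $\gamma\in\mathbb Z_p^n$ is *valid* if $\langle\gamma,\beta\rangle\not\equiv0\pmod p$ for all $\beta\in S$. For such $\gamma$ the substitution $z_j=e^{\gamma_js}$ turns the $i$-th term into $$G_i(s)=\frac{L_i(e^s)}{\prod_{b\in B_0}(1-e^{bs})\prod_{l=1}^{r}\prod_{b\in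 B_l}(1-e^{bs}t_l)},$$ where the $t_l\ne1$ are distinct monomials in $x$. The prime $p$ is *suitable* for $G_i$ if $p>|B_0|$ and $0\notin B_0$ in $\mathbb Z_p$. **The process.** Step 1: draw uniformly random $\gamma\in\mathbb Z_p^n$ until a valid one is found. Step 2: for each $i$ compute $\mathrm{CT}_sG_i(s)$ over $\mathbb Z_p$ by Algorithm CTGTodd and output the sum. That is, with $d_0$ the order of $L_i(e^s)$ modulo $s^{|B_0|+1}$ (the result is $0$ if this truncation vanishes) and $d=|B_0|-d_0$, compute $E(s)=s^{-d_0}L_i(e^s)$ and $$F(s)=\prod_{b\in B_0}f(bs)\prod_{l=1}^r\prod_{b\in B_l}f(bs,y_l),\quad f(s)=\frac{s}{e^s-1},\quad f(s,y)=\frac1{1-y(e^s-1)}$$ modulo $s^{d+1}$, where $\ln F$ is found from power sums of the $B_l$ and then exponentiated, and return $A\sum_{k=0}^dE_kF_{d-k}$ with $y_l=t_l/(1-t_l)$ and $A=(-1)^{|B_0|}\prod_{b\in B_0}b^{-1}\prod_l(1-t_l)^{-|B_l|}$, as a list of simple rational functions. Series logarithms and exponentials use the usual quadratic recursions, with sparse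 schoolbook multiplication of the coefficients. Time is the number of operations in $\mathbb Z_p$ (arithmetic, zero tests, reductions modulo $p$, random elements) and comparisons of monomials. **Proposition.** For every real $c>1$ there is a constant $K$, depending only on $c$, such that the following holds for every such $Q$ and every prime $p\ge c\,|S|$ (in particular for primes of size $O(|S|)$ with $p\geq c|S|$) for which no $\beta\in S$ is $\equiv0\pmod p$ and $p$ divides no denominator of a coefficient of the $L_i$. Put $$T=N\Bigl(U\,\bar d^{\,\bar d+1}\log\bar d+(\bar d+U)\,n\Bigr).$$ 1. For every valid $\gamma$, the prime $p$ is suitable for all $G_i$. At least $(1-1/c)\,p^n$ of the vectors in $\mathbb Z_p^n$ are valid. 2. Whenever a valid $\gamma$ has been drawn, the output of the process is the reduction modulo $p$ of $Q(x;\mathbf 1)$. 3. With at most $k$ independent random draws of $\gamma$ allowed ($k\ge0$), the process fails to find a valid $\gamma$ with probability at most $c^{-k}$, its time is at most $K\,k\,T$ for all random choices, and its expected time is at most $K\,T$. In particular, for $\bar d\ge2$, bounded $U$ and $n=O(\bar d^{\,\bar d}\log\bar d)$, the basic problem modulo $p$ is solved in time $O(N\bar d^{\,\bar d+1}\log\bar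 d)$. -/

import Mathlib

noncomputable section

/-! ### Computations with an operation count -/

/-- The result of a computation together with the number of elementary operations it used. -/
structure Timed (α : Type) where
  val : α
  time : ℕ

namespace Timed

instance : Monad Timed where
  pure a := ⟨a, 0⟩
  bind x f := ⟨(f x.val).val, x.time + (f x.val).time⟩

/-- One elementary operation: an arithmetic operation or zero test in `ZMod p`, the reduction of an
integer modulo `p`, or a comparison of two monomials. -/
def op {α : Type} (a : α) : Timed α := ⟨a, 1⟩

/-- Loop over a list, updating a state. -/
def fold {α β : Type} (f : β → α → Timed β) : List α → β → Timed β
  | [], s => pure s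
  | a :: l, s => do
    let s' ← f s a
    fold f l s'

/-- Apply a computation to each entry of a list. -/
def mapL {α β : Type} (f : α → Timed β) : List α → Timed (List β)
  | [] => pure []
  | a :: l => do
    let b ← f a
    let bs ← mapL f l
    pure (b :: bs)

end Timed

open Timed (op)

/-! ### Rational functions -/

/-- The field `F(x_s : s ∈ σ)` of rational functions. -/
abbrev RatFun (σ F : Type) [Field F] : Type := FractionRing (MvPolynomial σ F)

/-- The monomial `∏ x_s ^ (e s)`, with integer exponents. -/
def RatFun.mono {σ : Type} [Fintype σ] (F : Type) [Field F] (e : σ → ℤ) : RatFun σ F :=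
  ∏ s, (algebraMap (MvPolynomial σ F) (RatFun σ F) (MvPolynomial.X s)) ^ (e s)

/-- A constant, as a rational function. -/
def RatFun.const {σ F : Type} [Field F] (a : F) : RatFun σ F :=
  algebraMap (MvPolynomial σ F) (RatFun σ F) (MvPolynomial.C a)

/-- `W ∈ 𝔽_p(x)` is the reduction modulo `p` of `V ∈ ℚ(x)`. -/
def ReducesMod (p : ℕ) [Fact p.Prime] {m : ℕ} (V : RatFun (Fin m) ℚ) (W : RatFun (Fin m) (ZMod p)) :
    Prop :=
  ∃ A B : MvPolynomial (Fin m) ℤ,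
    MvPolynomial.map (Int.castRingHom (ZMod p)) B ≠ 0 ∧
    V = algebraMap _ (RatFun (Fin m) ℚ) (MvPolynomial.map (Int.castRingHom ℚ) A) /
        algebraMap _ (RatFun (Fin m) ℚ) (MvPolynomial.map (Int.castRingHom ℚ) B) ∧
    W = algebraMap _ (RatFun (Fin m) (ZMod p)) (MvPolynomial.map (Int.castRingHom (ZMod p)) A) /
        algebraMap _ (RatFun (Fin m) (ZMod p)) (MvPolynomial.map (Int.castRingHom (ZMod p)) B)

/-! ### The basic problem -/

/-- One monomial `coeff * x ^ xexp * z ^ zexp` of a Laurent polynomial in `x` and `z`. -/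
structure LaurentTerm (m n : ℕ) where
  coeff : ℚ
  xexp : Fin m → ℤ
  zexp : Fin n → ℤ

/-- The input of the basic problem: the short sum
`∑ i, L_i(x; z) / ∏ j, (1 - M_ij z ^ β_ij)` of `N` terms with `d` denominator factors each.
`L_i` is the list `num i` of its monomials, and `M_ij` is the monomial in `x` with exponent
vector `M i j`. -/
structure ShortSum (m n N d : ℕ) where
  num : Fin N → List (LaurentTerm m n)
  M : Fin N → Fin d → Fin m → ℤ
  β : Fin N → Fin d → Fin n → ℤ
  /-- no denominator factor is identically zero -/
  factor_ne : ∀ i j, M i j ≠ 0 ∨ β i j ≠ 0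

namespace ShortSum

variable {m n N d : ℕ}

/-- The rational function `Q(x; z)` over `ℚ`. -/
def Q (I : ShortSum m n N d) : RatFun (Fin m ⊕ Fin n) ℚ :=
  ∑ i, ((I.num i).map fun τ =>
      RatFun.const τ.coeff * RatFun.mono ℚ (Sum.elim τ.xexp τ.zexp)).sum /
    ∏ j, (1 - RatFun.mono ℚ (Sum.elim (I.M i j) (I.β i j)))

/-- The substitution `z = (1, …, 1)` in a polynomial in `x` and `z`. -/
def atOne (P : MvPolynomial (Fin m ⊕ Fin n) ℚ) : MvPolynomial (Fin m) ℚ :=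
  MvPolynomial.aeval (Sum.elim MvPolynomial.X fun _ => 1) P

/-- The limit `Q(x; 1, …, 1)` is well defined and equal to `V`. -/
def HasLimitAtOne (I : ShortSum m n N d) (V : RatFun (Fin m) ℚ) : Prop :=
  ∃ P D : MvPolynomial (Fin m ⊕ Fin n) ℚ, atOne D ≠ 0 ∧
    I.Q = algebraMap _ (RatFun (Fin m ⊕ Fin n) ℚ) P / algebraMap _ (RatFun (Fin m ⊕ Fin n) ℚ) D ∧
    V = algebraMap _ (RatFun (Fin m) ℚ) (atOne P) / algebraMap _ (RatFun (Fin m) ℚ) (atOne D)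

/-- The index set of the family `S` of the vectors `β_ij` with `M_ij = 1`. -/
def S (I : ShortSum m n N d) : Finset (Fin N × Fin d) :=
  Finset.univ.filter fun ij => I.M ij.1 ij.2 = 0

/-- `γ` is valid modulo `p`: `⟨γ, β⟩ ≠ 0` in `ZMod p` for all `β` in `S`. -/
def Valid (I : ShortSum m n N d) (p : ℕ) (γ : Fin n → ZMod p) : Prop :=
  ∀ ij ∈ I.S, ∑ k, γ k * (I.β ij.1 ij.2 k : ZMod p) ≠ 0

end ShortSum

/-! ### Constant terms of generalized Todd type -/

/-- One summand `coeff * x ^ xexp * exp (a s)` of `L(e^s)`. -/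
structure ExpTerm (p m : ℕ) where
  coeff : ZMod p
  xexp : Fin m → ℤ
  a : ZMod p

/-- The series `G(s) = L(e^s) / (∏ b ∈ B_0, (1 - e^{bs}) * ∏ i, ∏ b ∈ B_i, (1 - e^{bs} t_i))`.
The list `grp` holds the pairs `(t_i, B_i)`, with `t_i` a monomial in `x`. -/
structure GTodd (p m : ℕ) where
  L : List (ExpTerm p m)
  B0 : List (ZMod p)
  grp : List ((Fin m → ℤ) × List (ZMod p))

/-- `p` is suitable for `G`: `p > d₁ = |B_0|`, and `B_0` contains no `0` in `ZMod p`. -/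
def GTodd.Suitable {p m : ℕ} (G : GTodd p m) : Prop :=
  G.B0.length < p ∧ (0 : ZMod p) ∉ G.B0

/-! Sparse schoolbook arithmetic. A product of polynomials with `u` and `v` monomials takes `u * v`
multiplications and at most `u * v` additions in `ZMod p`. -/

section Poly

variable {p : ℕ}

def polyMul (f g : Polynomial (ZMod p)) : Timed (Polynomial (ZMod p)) :=
  ⟨f * g, 2 * (f.support.card * g.support.card)⟩

def polyAdd (f g : Polynomial (ZMod p)) : Timed (Polynomial (ZMod p)) :=
  ⟨f + g, f.support.card + g.support.card⟩

def polySub (f g : Polynomial (ZMod p)) : Timed (Polynomial (ZMod p)) :=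
  ⟨f - g, f.support.card + g.support.card⟩

def polyScale (c : ZMod p) (f : Polynomial (ZMod p)) : Timed (Polynomial (ZMod p)) :=
  ⟨Polynomial.C c * f, f.support.card⟩

variable {r : ℕ}

def mvMul (f g : MvPolynomial (Fin r) (ZMod p)) : Timed (MvPolynomial (Fin r) (ZMod p)) :=
  ⟨f * g, 2 * (f.support.card * g.support.card)⟩

def mvAdd (f g : MvPolynomial (Fin r) (ZMod p)) : Timed (MvPolynomial (Fin r) (ZMod p)) :=
  ⟨f + g, f.support.card + g.support.card⟩

def mvSub (f g : MvPolynomial (Fin r) (ZMod p)) : Timed (MvPolynomial (Fin r) (ZMod p)) :=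
  ⟨f - g, f.support.card + g.support.card⟩

def mvScale (c : ZMod p) (f : MvPolynomial (Fin r) (ZMod p)) :
    Timed (MvPolynomial (Fin r) (ZMod p)) :=
  ⟨MvPolynomial.C c * f, f.support.card⟩

end Poly

section Series

variable {p : ℕ} [Fact p.Prime]

/-- The table of `1/k` for `1 ≤ k ≤ d`. -/
def invTable (d : ℕ) : Timed (ℕ → ZMod p) :=
  Timed.fold (fun T (k : ℕ) => do
    let v ← op ((k : ZMod p)⁻¹)
    pure (Function.update T k v)) (List.range' 1 d) (fun _ => 0)

/-- The table of `1/k!` for `0 ≤ k ≤ d`. -/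
def invFactTable (inv : ℕ → ZMod p) : ℕ → Timed (ℕ → ZMod p)
  | 0 => pure (fun k => if k = 0 then 1 else 0)
  | k + 1 => do
    let T ← invFactTable inv k
    let v ← op (T k * inv (k + 1))
    pure (Function.update T (k + 1) v)

/-- The power sums `p_k(B)` for `1 ≤ k ≤ d` (first component). The second component is the list of
the pairs `(b, b ^ d)` for `b ∈ B`. -/
def powerSumsAux (B : List (ZMod p)) : ℕ → Timed ((ℕ → ZMod p) × List (ZMod p × ZMod p))
  | 0 => pure (fun _ => 0, B.map fun b => (b, 1))
  | k + 1 => do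
    let T ← powerSumsAux B k
    let w ← Timed.mapL (fun bw : ZMod p × ZMod p => do
      let v ← op (bw.1 * bw.2)
      pure (bw.1, v)) T.2
    let s ← Timed.fold (fun acc (bw : ZMod p × ZMod p) => op (acc + bw.2)) w 0
    pure (Function.update T.1 (k + 1) s, w)

def powerSums (B : List (ZMod p)) (d : ℕ) : Timed (ℕ → ZMod p) := do
  let T ← powerSumsAux B d
  pure T.1

/-- The coefficients `h_1, …, h_d` of `h(s) = ln f(s)` for `f_0 = 1`, by the recursion
`h_k = f_k - (1/k) ∑_{1 ≤ i < k} i h_i f_{k-i}`. -/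
def logSeries (inv : ℕ → ZMod p) (f : ℕ → Polynomial (ZMod p)) :
    ℕ → Timed (ℕ → Polynomial (ZMod p))
  | 0 => pure (fun _ => 0)
  | k + 1 => do
    let h ← logSeries inv f k
    let s ← Timed.fold (fun acc i => do
      let u ← polyMul (h (i + 1)) (f (k - i))
      let v ← polyScale ((i + 1 : ℕ) : ZMod p) u
      polyAdd acc v) (List.range k) 0
    let s' ← polyScale (inv (k + 1)) s
    let v ← polySub (f (k + 1)) s'
    pure (Function.update h (k + 1) v)

/-- The coefficients `F_0, …, F_d` of `F(s) = exp H(s)` for `H_0 = 0`, by the recursion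
`F_k = (1/k) ∑_{1 ≤ i ≤ k} i H_i F_{k-i}`. -/
def expSeries {r : ℕ} (inv : ℕ → ZMod p) (H : ℕ → MvPolynomial (Fin r) (ZMod p)) :
    ℕ → Timed (ℕ → MvPolynomial (Fin r) (ZMod p))
  | 0 => pure (fun k => if k = 0 then 1 else 0)
  | k + 1 => do
    let F ← expSeries inv H k
    let s ← Timed.fold (fun acc i => do
      let u ← mvMul (H (i + 1)) (F (k - i))
      let v ← mvScale ((i + 1 : ℕ) : ZMod p) u
      mvAdd acc v) (List.range (k + 1)) 0
    let v ← mvScale (inv (k + 1)) s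
    pure (Function.update F (k + 1) v)

variable {m : ℕ}

/-- `∑ coeff * x ^ xexp` over a list, with like terms combined. -/
def collect (w : List (ExpTerm p m)) : Timed ((Fin m → ℤ) →₀ ZMod p) :=
  Timed.fold (fun acc τ => op (acc + Finsupp.single τ.xexp τ.coeff)) w 0

/-- The coefficients of `s ^ k` in `L(e^s)` for `0 ≤ k ≤ d` (first component). The second component
is `L` with each `coeff` replaced by `coeff * a ^ d / d!`. -/
def expSumCoeffs (inv : ℕ → ZMod p) (L : List (ExpTerm p m)) :
    ℕ → Timed ((ℕ → ((Fin m → ℤ) →₀ ZMod p)) × List (ExpTerm p m))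
  | 0 => do
    let s ← collect L
    pure (Function.update (fun _ => 0) 0 s, L)
  | k + 1 => do
    let T ← expSumCoeffs inv L k
    let w ← Timed.mapL (fun τ : ExpTerm p m => do
      let c ← op (τ.coeff * τ.a)
      let c' ← op (c * inv (k + 1))
      pure { τ with coeff := c' }) T.2
    let s ← collect w
    pure (Function.update T.1 (k + 1) s, w)

/-- The first index in a list at which the table is nonzero. -/
def firstNonzero (T : ℕ → ((Fin m → ℤ) →₀ ZMod p)) : List ℕ → Timed (Option ℕ)
  | [] => pure none
  | k :: l => do
    let z ← (⟨decide (T k = 0), 1 + (T k).support.card⟩ : Timed Bool)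
    if z then firstNonzero T l else pure (some k)

/-- A simple rational function `num(x) * x ^ mon / ∏ (1 - x ^ t) ^ e`, the product being over the
pairs `(t, e)` in `den`. -/
structure SimpleFrac (p m : ℕ) where
  num : (Fin m → ℤ) →₀ ZMod p
  mon : Fin m → ℤ
  den : List ((Fin m → ℤ) × ℕ)

def SimpleFrac.value (q : SimpleFrac p m) : RatFun (Fin m) (ZMod p) :=
  (q.num.sum fun e a => RatFun.const a * RatFun.mono (ZMod p) e) * RatFun.mono (ZMod p) q.mon /
    (q.den.map fun te => (1 - RatFun.mono (ZMod p) te.1) ^ te.2).prod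

namespace GTodd

/-- Step S3: the generalized Todd polynomials `F_0, …, F_d`, with `y_i` the `i`-th variable, where
`F(s) = ∏_{b ∈ B_0} f(bs) * ∏_i ∏_{b ∈ B_i} f(bs, y_i)`,
`f(s) = s / (e^s - 1)` and `f(s, y) = 1 / (1 - y (e^s - 1))`.
First `ln F(s) = H(s)` is found from the logarithms of `f` and the power sums of the `B_i`. -/
def toddSeries (G : GTodd p m) (d : ℕ) :
    Timed (ℕ → MvPolynomial (Fin G.grp.length) (ZMod p)) := do
  let inv ← invTable (d + 1)
  let c ← invFactTable inv (d + 1)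
  -- `ln ((e^s - 1)/s) = - ln f(s)`
  let h ← logSeries inv (fun k => Polynomial.C (c (k + 1))) d
  -- `ln (1 - y (e^s - 1)) = - ln f(s, y)`
  let hy ← logSeries inv (fun k => if k = 0 then 1 else Polynomial.monomial 1 (-(c k))) d
  let q0 ← powerSums G.B0 d
  let H0 ← Timed.fold (fun (H : ℕ → MvPolynomial (Fin G.grp.length) (ZMod p)) k => do
    let u ← op (q0 k * (h k).coeff 0)
    let v ← op (-u)
    pure (Function.update H k (MvPolynomial.C v))) (List.range' 1 d) (fun _ => 0)
  let H ← Timed.fold (fun H (i : Fin G.grp.length) => do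
    let q ← powerSums (G.grp.get i).2 d
    Timed.fold (fun (H' : ℕ → MvPolynomial (Fin G.grp.length) (ZMod p)) k => do
      let u ← polyScale (q k) (hy k)
      let v ← mvSub (H' k) (Polynomial.aeval (MvPolynomial.X i) u)
      pure (Function.update H' k v)) (List.range' 1 d) H) (List.finRange G.grp.length) H0
  expSeries inv H d

/-- Algorithm CTGTodd: the constant term in `s` of `G(s)`, as a list of simple rational functions
whose sum it is. For `d = 0` step S4 returns `G(0) = A E_0`. -/
def ctGTodd (G : GTodd p m) : Timed (List (SimpleFrac p m)) := do
  -- S1: `d₁`, `L(e^s)` modulo `s ^ (d₁ + 1)`, and its order `d₀`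
  let d₁ := G.B0.length
  let inv ← invTable d₁
  let ℓ ← expSumCoeffs inv G.L d₁
  let o ← firstNonzero ℓ.1 (List.range (d₁ + 1))
  match o with
  -- here `G(0) = 0`
  | none => pure []
  | some d₀ => do
    -- S2: `E_k` is the coefficient of `s ^ (d₀ + k)` in `L(e^s)`, for `k ≤ d`
    let d := d₁ - d₀
    -- S3
    let F ← toddSeries G d
    -- the scalar part of `A`, equal to `(-1) ^ |B_0| / ∏ b`
    let b ← Timed.fold (fun acc b => op (acc * (-b))) G.B0 1
    let A ← op b⁻¹
    -- S4: `A * ∑ E_k * F_{d-k}` with `y_i = t_i / (1 - t_i)`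
    Timed.fold (fun out k =>
      Timed.fold (fun out (e : Fin G.grp.length →₀ ℕ) => do
        let a ← op (A * (F (d - k)).coeff e)
        let num ← (⟨a • ℓ.1 (d₀ + k), (ℓ.1 (d₀ + k)).support.card⟩ :
          Timed ((Fin m → ℤ) →₀ ZMod p))
        let mon ← (⟨∑ i, (e i : ℤ) • (G.grp.get i).1, G.grp.length⟩ : Timed (Fin m → ℤ))
        pure ({ num := num
                mon := mon
                den := (List.finRange G.grp.length).map fun i =>
                  ((G.grp.get i).1, e i + (G.grp.get i).2.length) } :: out))
        (F (d - k)).support.toList out) (List.range (d + 1)) []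

end GTodd

/-! ### The process that solves the basic problem modulo `p` -/

/-- `⟨γ, v⟩` in `ZMod p`. -/
def innerMod {n : ℕ} (γ : Fin n → ZMod p) (v : Fin n → ℤ) : Timed (ZMod p) :=
  Timed.fold (fun acc k => do
    let b ← op ((v k : ℤ) : ZMod p)
    let c ← op (γ k * b)
    op (acc + c)) (List.finRange n) 0

/-- Put the factor `1 - e^{bs} t` into the group of the factors with the same `t`. -/
def insertGroup (t : Fin m → ℤ) (b : ZMod p) :
    List ((Fin m → ℤ) × List (ZMod p)) → Timed (List ((Fin m → ℤ) × List (ZMod p)))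
  | [] => pure [(t, [b])]
  | g :: l => do
    let same ← op (decide (g.1 = t))
    if same then pure ((g.1, b :: g.2) :: l)
    else do
      let l' ← insertGroup t b l
      pure (g :: l')

end Series

namespace ShortSum

variable {m n N d p : ℕ} [Fact p.Prime]

/-- Test whether `γ` is valid modulo `p`. -/
def checkValid (I : ShortSum m n N d) (γ : Fin n → ZMod p) : Timed Bool :=
  Timed.fold (fun ok (ij : Fin N × Fin d) => do
    let one ← op (decide (I.M ij.1 ij.2 = 0))
    if one then do
      let b ← innerMod γ (I.β ij.1 ij.2)
      op (ok && decide (b ≠ 0))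
    else pure ok) (List.finRange N ×ˢ List.finRange d) true

/-- Step 1: go through a list of random vectors until a valid one is found. Each new vector costs
`n` random elements of `ZMod p`. -/
def findValid (I : ShortSum m n N d) : List (Fin n → ZMod p) → Timed (Option (Fin n → ZMod p))
  | [] => pure none
  | γ₀ :: l => do
    let γ ← (⟨γ₀, n⟩ : Timed (Fin n → ZMod p))
    let ok ← checkValid I γ
    if ok then pure (some γ) else findValid I l

/-- The `i`-th term of `Q(x; e^{γ_1 s}, …, e^{γ_n s})` modulo `p`. -/
def toGTodd (I : ShortSum m n N d) (γ : Fin n → ZMod p) (i : Fin N) : Timed (GTodd p m) := do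
  let L ← Timed.mapL (fun τ : LaurentTerm m n => do
    let c ← (⟨(τ.coeff : ZMod p), 3⟩ : Timed (ZMod p))
    let a ← innerMod γ τ.zexp
    pure (⟨c, τ.xexp, a⟩ : ExpTerm p m)) (I.num i)
  Timed.fold (fun (G : GTodd p m) j => do
    let b ← innerMod γ (I.β i j)
    let one ← op (decide (I.M i j = 0))
    if one then pure { G with B0 := b :: G.B0 }
    else do
      let g ← insertGroup (I.M i j) b G.grp
      pure { G with grp := g }) (List.finRange d) ⟨L, [], []⟩

/-- The whole process, with the given vectors as the random choices of Step 1. The output is a list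
of simple rational functions, or `none` if no vector of the list is valid. -/
def process (I : ShortSum m n N d) (γs : List (Fin n → ZMod p)) :
    Timed (Option (List (SimpleFrac p m))) := do
  let o ← findValid I γs
  match o with
  | none => pure none
  | some γ => do
    let out ← Timed.mapL (fun i => do
      let G ← toGTodd I γ i
      G.ctGTodd) (List.finRange N)
    pure (some out.flatten)

end ShortSum

end

noncomputable section
open Timed (op)

/-! ### Values and running times of timed loops. -/

namespace Timed

/-! Limit. Replace each z_k by a power E(s)^(a_k) of one power series E with constant coefficient 1.
Write Q = P/D with D(x;1) ≠ 0. Then D becomes an invertible series, so Q becomes a power series with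
constant coefficient Q(x;1), although the single terms may have poles at s = 0
(`coeff_eq_of_hasLimitAtOne`). No exponential property of E enters. This is what permits reduction
modulo p: e^s itself is not p-integral, but E may be e^s cut off before s^p, and the a_k may be
integer lifts of the γ_k. Everything then lives in power series over `IntegralRing`, the rational
functions that have a reduction modulo p. With d factors per term, the coefficient of s^d in s^d * Q
is one element of that ring. Its rational component is the limit, and its reduction has to be
matched with the output.

Precision. Modulo p one has E' = E up to s^(p-1), so E^z agrees with the truncated series of e^(zs)
modulo s^p (`expUnit_zpow_congr`). A factor with t = 1 must be divided by s, which costs one order,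
and the quotient is a unit because ⟨γ, β⟩ is nonzero modulo p (`exists_unit_factor`). So numerators
are known modulo s^p and reduced denominators modulo s^(p-1). This gives the coefficient of s^|B_0|
whenever |B_0| ≤ p - 2. If |B_0| = p - 1, then |S| < p forces this term to carry all the poles of
the sum. As the sum has no pole, the numerator of the term vanishes at s = 0, and this supplies the
missing order (`ctGTodd_sum_value`, `reducesMod_sum`).

Algorithm. A logarithm h of f is described by f' = h' f modulo s^d (`IsLog`). Both quadratic
recursions solve this equation coefficient by coefficient. Products of series turn into sums of
logarithms, and replacing s by bs multiplies the k-th coefficient by b^k, which is where the power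
sums come from. Series with opposite logarithms and constant coefficient 1 are inverse modulo
s^(d+1) when 1, …, d are invertible. Hence the computed F inverts the normalized denominator
(`toddSeries_mul_sub_one`).

Probability. Each β in S excludes a hyperplane, a fraction 1/p of all vectors, so an invalid draw
has probability at most |S|/p ≤ 1/c. Failure probability and expected search time follow by
recursion on the number of draws (`sum_ofFn_succ_le`).

Time. The Todd polynomials have total degree and number of variables bounded in sum by d, hence at
most 2^(d+1) monomials. A term costs a constant times U * 16^d + (d + U) * n. For d ≥ 2 the power
16^d is absorbed by d^(d+1) log d. For d = 1 the logarithm is 0 and the summand (d + U) * n takes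
over (`mul_sixteen_pow_le`). -/

@[simp] theorem pure_val {α : Type} (a : α) : (pure a : Timed α).val = a := rfl
@[simp] theorem pure_time {α : Type} (a : α) : (pure a : Timed α).time = 0 := rfl
@[simp] theorem bind_val {α β : Type} (x : Timed α) (f : α → Timed β) :
    (x >>= f).val = (f x.val).val := rfl
@[simp] theorem bind_time {α β : Type} (x : Timed α) (f : α → Timed β) :
    (x >>= f).time = x.time + (f x.val).time := rfl
@[simp] theorem op_val {α : Type} (a : α) : (op a).val = a := rfl
@[simp] theorem op_time {α : Type} (a : α) : (op a).time = 1 := rfl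

theorem fold_val {α β : Type} (f : β → α → Timed β) (l : List α) (s : β) :
    (fold f l s).val = l.foldl (fun s a => (f s a).val) s := by
  induction l generalizing s with
  | nil => rfl
  | cons a l ih => simp [fold, ih]

/-- A property of the state that every step of a loop preserves holds at its end. -/
theorem fold_invariant {α β : Type} (P : β → Prop) (f : β → α → Timed β) (l : List α) (s : β)
    (h0 : P s) (h : ∀ a ∈ l, ∀ s, P s → P (f s a).val) : P (fold f l s).val := by
  induction l generalizing s with
  | nil => exact h0
  | cons a l ih =>
    exact ih _ (h a (by simp) s h0) fun b hb => h b (by simp [hb])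

/-- A loop whose steps take time at most `C`, as long as the invariant `P` holds. -/
theorem fold_time_le {α β : Type} (P : β → Prop) (C : ℕ) (f : β → α → Timed β) (l : List α) (s : β)
    (h0 : P s) (h : ∀ a ∈ l, ∀ s, P s → P (f s a).val) (ht : ∀ a ∈ l, ∀ s, P s → (f s a).time ≤ C) :
    (fold f l s).time ≤ l.length * C := by
  induction l generalizing s with
  | nil => exact Nat.zero_le _
  | cons a l ih =>
    have h1 := ht a (by simp) s h0
    have h2 := ih (f s a).val (h a (by simp) s h0) (fun b hb => h b (by simp [hb]))
      (fun b hb => ht b (by simp [hb]))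
    simp only [fold, bind_time, List.length_cons]
    linarith

theorem fold_time_le' {α β : Type} (C : ℕ) (f : β → α → Timed β) (l : List α) (s : β)
    (ht : ∀ a ∈ l, ∀ s, (f s a).time ≤ C) : (fold f l s).time ≤ l.length * C :=
  fold_time_le (fun _ => True) C f l s trivial (fun _ _ _ _ => trivial) fun a ha s _ => ht a ha s

theorem mapL_val {α β : Type} (f : α → Timed β) (l : List α) :
    (mapL f l).val = l.map fun a => (f a).val := by
  induction l with
  | nil => rfl
  | cons a l ih => simp [mapL, ih]

theorem mapL_time_le {α β : Type} (C : ℕ) (f : α → Timed β) (l : List α)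
    (ht : ∀ a ∈ l, (f a).time ≤ C) : (mapL f l).time ≤ l.length * C := by
  induction l with
  | nil => exact Nat.zero_le _
  | cons a l ih =>
    have h1 := ht a (by simp)
    have h2 := ih fun b hb => ht b (by simp [hb])
    simp only [mapL, bind_time, pure_time, List.length_cons]
    linarith

end Timed

/-! ### Truncated logarithmic derivatives -/

section LogDeriv

open PowerSeries

variable {R : Type*} [CommRing R]

/-- `h` is a logarithm of `f` up to `s ^ d`, in the sense that `f' = h' f` modulo `s ^ d`. -/
def IsLog (d : ℕ) (f h : R⟦X⟧) : Prop :=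
  X ^ d ∣ derivative R f - derivative R h * f

theorem coeff_eq_of_X_pow_dvd {d k : ℕ} {f g : R⟦X⟧} (h : X ^ d ∣ f - g) (hk : k < d) :
    coeff k f = coeff k g := by
  have := X_pow_dvd_iff.1 h k hk
  rwa [map_sub, sub_eq_zero] at this

theorem X_pow_dvd_sub_of_coeff_eq {d : ℕ} {f g : R⟦X⟧} (h : ∀ k < d, coeff k f = coeff k g) :
    X ^ d ∣ f - g :=
  X_pow_dvd_iff.2 fun k hk => by rw [map_sub, h k hk, sub_self]

namespace IsLog

theorem one (d : ℕ) : IsLog d (1 : R⟦X⟧) 0 := by simp [IsLog]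

theorem mul {d : ℕ} {f g h k : R⟦X⟧} (hf : IsLog d f h) (hg : IsLog d g k) :
    IsLog d (f * g) (h + k) := by
  have : derivative R (f * g) - derivative R (h + k) * (f * g) =
      (derivative R f - derivative R h * f) * g + (derivative R g - derivative R k * g) * f := by
    rw [Derivation.leibniz, map_add, smul_eq_mul, smul_eq_mul]; ring
  rw [IsLog, this]
  exact dvd_add (hf.mul_right _) (hg.mul_right _)

theorem list_prod {α : Type*} {d : ℕ} (l : List α) (f h : α → R⟦X⟧)
    (hf : ∀ a ∈ l, IsLog d (f a) (h a)) : IsLog d (l.map f).prod (l.map h).sum := by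
  induction l with
  | nil => simpa using one d
  | cons a l ih =>
    simpa using (hf a (by simp)).mul (ih fun b hb => hf b (by simp [hb]))

theorem finset_prod {α : Type*} {d : ℕ} (s : Finset α) (f h : α → R⟦X⟧)
    (hf : ∀ a ∈ s, IsLog d (f a) (h a)) : IsLog d (∏ a ∈ s, f a) (∑ a ∈ s, h a) := by
  classical
  induction s using Finset.induction_on with
  | empty => simpa using one d
  | insert a s ha ih =>
    rw [Finset.prod_insert ha, Finset.sum_insert ha]
    exact (hf a (by simp)).mul (ih fun b hb => hf b (by simp [hb]))

/-- Modulo s^d the equation sees f only up to s^d and h only in degrees 1 to d. Entries of a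
computed table outside these ranges are therefore harmless. -/
theorem congr {d : ℕ} {f g h k : R⟦X⟧} (hf : IsLog d f h)
    (hfg : ∀ j ≤ d, coeff j g = coeff j f) (hhk : ∀ j, 1 ≤ j → j ≤ d → coeff j k = coeff j h) :
    IsLog d g k := by
  have h1 : X ^ d ∣ derivative R g - derivative R f := X_pow_dvd_sub_of_coeff_eq fun j hj => by
    rw [coeff_derivative, coeff_derivative, hfg (j + 1) (by omega)]
  have h2 : X ^ d ∣ derivative R k - derivative R h := X_pow_dvd_sub_of_coeff_eq fun j hj => by
    rw [coeff_derivative, coeff_derivative, hhk (j + 1) (by omega) (by omega)]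
  have : derivative R g - derivative R k * g =
      (derivative R f - derivative R h * f) + (derivative R g - derivative R f) -
        (derivative R k - derivative R h) * g - derivative R h * (g - f) := by ring
  rw [IsLog, this]
  exact dvd_sub (dvd_sub (dvd_add hf h1) (h2.mul_right _))
    ((X_pow_dvd_sub_of_coeff_eq fun j hj => hfg j hj.le).mul_left _)

theorem derivative_rescale (b : R) (f : R⟦X⟧) :
    derivative R (rescale b f) = C b * rescale b (derivative R f) := by
  ext k
  simp only [coeff_derivative, coeff_rescale, coeff_C_mul]
  ring

theorem rescale {d : ℕ} {f h : R⟦X⟧} (hf : IsLog d f h) (b : R) :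
    IsLog d (rescale b f) (rescale b h) := by
  obtain ⟨q, hq⟩ := hf
  -- The chain rule contributes the factor b, and X^d turns into (bX)^d.
  refine ⟨C b * C (b ^ d) * PowerSeries.rescale b q, ?_⟩
  rw [derivative_rescale, derivative_rescale]
  have := congrArg (PowerSeries.rescale b) hq
  rw [map_sub, map_mul, map_mul, map_pow, rescale_X] at this
  rw [mul_assoc, ← mul_sub, this, map_pow]
  ring

theorem map {S : Type*} [CommRing S] (φ : R →+* S) {d : ℕ} {f h : R⟦X⟧} (hf : IsLog d f h) :
    IsLog d (PowerSeries.map φ f) (PowerSeries.map φ h) := by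
  have hd : ∀ g : R⟦X⟧, derivative S (PowerSeries.map φ g) =
      PowerSeries.map φ (derivative R g) := by
    intro g; ext k; simp [coeff_derivative]
  have := _root_.map_dvd (PowerSeries.map φ) hf
  rw [map_pow, map_X, map_sub, map_mul] at this
  rwa [IsLog, hd, hd]

/-- A series with logarithm `0` is constant, up to the precision at which one can integrate. -/
theorem eq_one {d : ℕ} {f : R⟦X⟧} (hf : IsLog d f 0) (h0 : constantCoeff f = 1)
    (hd : ∀ k : ℕ, 1 ≤ k → k ≤ d → IsUnit (k : R)) : X ^ (d + 1) ∣ f - 1 := by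
  refine X_pow_dvd_sub_of_coeff_eq fun k hk => ?_
  rcases k with _ | k
  · simpa using h0
  · rw [IsLog, map_zero, zero_mul, sub_zero] at hf
    have := X_pow_dvd_iff.1 hf k (by omega)
    rw [coeff_derivative] at this
    have hu := hd (k + 1) (by omega) (by omega)
    push_cast at hu
    rw [hu.mul_left_eq_zero.1 this]
    simp [coeff_one]

/-- The product has logarithm 0. The precision rises from d to d + 1 because a derivative known
modulo s^d determines the series modulo s^(d+1), up to its constant coefficient. -/
theorem mul_sub_one {d : ℕ} {f g h k : R⟦X⟧} (hf : IsLog d f h) (hg : IsLog d g k)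
    (hhk : h + k = 0) (h0 : constantCoeff f * constantCoeff g = 1)
    (hd : ∀ k : ℕ, 1 ≤ k → k ≤ d → IsUnit (k : R)) : X ^ (d + 1) ∣ f * g - 1 :=
  eq_one (hhk ▸ hf.mul hg) (by simpa using h0) hd

/-- From (1/u)' = -u'/u²: multiply the equation for u by -1/u². -/
theorem inv {d : ℕ} {h : R⟦X⟧} {u : R⟦X⟧ˣ} (hg : IsLog d (u : R⟦X⟧) h) :
    IsLog d ((u⁻¹ : R⟦X⟧ˣ) : R⟦X⟧) (-h) := by
  have hd := derivative_inv (R := R) u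
  have hu := u.inv_mul
  obtain ⟨q, hq⟩ := hg
  refine ⟨-((u⁻¹ : R⟦X⟧ˣ) : R⟦X⟧) ^ 2 * q, ?_⟩
  rw [hd, map_neg]
  linear_combination (-((u⁻¹ : R⟦X⟧ˣ) : R⟦X⟧) ^ 2) * hq -
    derivative R h * ((u⁻¹ : R⟦X⟧ˣ) : R⟦X⟧) * hu

/-- Two series with the same logarithm and constant coefficient agree. -/
theorem sub_dvd {d : ℕ} {f h : R⟦X⟧} {u : R⟦X⟧ˣ} (hf : IsLog d f h) (hg : IsLog d (u : R⟦X⟧) h)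
    (h0 : constantCoeff f = 1) (h1 : constantCoeff (u : R⟦X⟧) = 1)
    (hd : ∀ k : ℕ, 1 ≤ k → k ≤ d → IsUnit (k : R)) : X ^ (d + 1) ∣ f - (u : R⟦X⟧) := by
  have h2 : constantCoeff ((u⁻¹ : R⟦X⟧ˣ) : R⟦X⟧) = 1 := by
    have := congrArg (constantCoeff (R := R)) u.mul_inv
    rwa [map_mul, h1, one_mul, map_one] at this
  have h3 := mul_sub_one hf hg.inv (by simp) (by rw [h0, h2, one_mul]) hd
  have : f - (u : R⟦X⟧) = (f * ((u⁻¹ : R⟦X⟧ˣ) : R⟦X⟧) - 1) * u := by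
    rw [sub_mul, mul_assoc, Units.inv_mul, mul_one, one_mul]
  rw [this]
  exact h3.mul_right _

/-- Negative exponents are needed because the pairing of the lifted vector with β or with an
exponent of z may be negative. -/
theorem zpow {d : ℕ} {h : R⟦X⟧} {u : R⟦X⟧ˣ} (hg : IsLog d (u : R⟦X⟧) h) (z : ℤ) :
    IsLog d ((u ^ z : R⟦X⟧ˣ) : R⟦X⟧) (z * h) := by
  induction z using Int.induction_on with
  | zero => simpa using one d
  | succ i ih => 
    have := ih.mul hg
    rw [zpow_add_one, Units.val_mul]
    convert this using 1
    push_cast; ring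
  | pred i ih =>
    have := ih.mul hg.inv
    rw [zpow_sub_one, Units.val_mul]
    convert this using 1
    push_cast; ring

end IsLog

end LogDeriv

/-! ### What the tables of the algorithm contain. -/

section Tables

open PowerSeries

/-- Each step reads and writes only its own entry, and without repetitions every entry is written at
most once. -/
theorem List.foldl_update {β : Type*} (g : β → ℕ → β) (l : List ℕ) (hl : l.Nodup) (T : ℕ → β)
    (j : ℕ) : l.foldl (fun T k => Function.update T k (g (T k) k)) T j =
      if j ∈ l then g (T j) j else T j := by
  induction l generalizing T with
  | nil => simp
  | cons a l ih =>
    rw [List.nodup_cons] at hl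
    rw [List.foldl_cons, ih hl.2]
    by_cases h : j = a
    · subst h; simp [hl.1]
    · simp [h]

theorem List.foldl_add_eq {α M : Type*} [AddMonoid M] (t : α → M) (l : List α) (s : M) :
    l.foldl (fun acc a => acc + t a) s = s + (l.map t).sum := by
  induction l generalizing s with
  | nil => simp
  | cons a l ih => simp [ih, add_assoc]

theorem Finset.sum_range_eq_list_sum {M : Type*} [AddCommMonoid M] (t : ℕ → M) (k : ℕ) :
    ((List.range k).map t).sum = ∑ i ∈ Finset.range k, t i := by
  rw [← List.sum_toFinset _ List.nodup_range, List.toFinset_range]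

variable {p : ℕ} [Fact p.Prime]

theorem mem_range'_one {j d : ℕ} : j ∈ List.range' 1 d ↔ 1 ≤ j ∧ j ≤ d := by
  rw [List.mem_range'_1]; omega

theorem invTable_val (d j : ℕ) (h1 : 1 ≤ j) (hj : j ≤ d) :
    (invTable (p := p) d).val j = (j : ZMod p)⁻¹ := by
  have := List.foldl_update (fun (_ : ZMod p) k => ((k : ZMod p)⁻¹)) (List.range' 1 d)
    List.nodup_range' (fun _ => 0) j
  rw [if_pos (mem_range'_one.2 ⟨h1, hj⟩)] at this
  rw [← this, invTable, Timed.fold_val]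
  rfl

theorem invFactTable_val (inv : ℕ → ZMod p) (d : ℕ)
    (hinv : ∀ k, 1 ≤ k → k ≤ d → inv k = (k : ZMod p)⁻¹) (j : ℕ) (hj : j ≤ d) :
    (invFactTable inv d).val j = ((j.factorial : ℕ) : ZMod p)⁻¹ := by
  induction d generalizing j with
  | zero =>
    obtain rfl : j = 0 := by omega
    simp [invFactTable]
  | succ d ih =>
    have ih' := ih fun k h1 h2 => hinv k h1 (by omega)
    simp only [invFactTable, Timed.bind_val, Timed.op_val, Timed.pure_val]
    rcases Nat.lt_or_ge d j with h | h
    · obtain rfl : j = d + 1 := by omega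
      rw [Function.update_self, hinv (d + 1) (by omega) le_rfl, ih' d le_rfl,
        Nat.factorial_succ, Nat.cast_mul, mul_inv, mul_comm]
    · rw [Function.update_of_ne (by omega), ih' j h]

/-- Both components are treated together, since each new power sum is read off the list of current
powers. -/
theorem powerSumsAux_val (B : List (ZMod p)) (d : ℕ) :
    (powerSumsAux B d).val.2 = B.map (fun b => (b, b ^ d)) ∧
      ∀ j, 1 ≤ j → j ≤ d → (powerSumsAux B d).val.1 j = (B.map (· ^ j)).sum := by
  induction d with
  | zero => exact ⟨by simp [powerSumsAux], fun j h1 h2 => by omega⟩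
  | succ d ih =>
    obtain ⟨ih1, ih2⟩ := ih
    have h2 : (powerSumsAux B (d + 1)).val.2 = B.map (fun b => (b, b ^ (d + 1))) := by
      simp only [powerSumsAux, Timed.bind_val, Timed.op_val, Timed.pure_val, Timed.mapL_val, ih1,
        List.map_map]
      refine List.map_congr_left fun b _ => ?_
      simp [pow_succ']
    refine ⟨h2, fun j h1 hj => ?_⟩
    rcases Nat.lt_or_ge d j with h | h
    · obtain rfl : j = d + 1 := by omega
      have h3 : (powerSumsAux B (d + 1)).val.1 (d + 1) =
          (Timed.fold (fun acc (bw : ZMod p × ZMod p) => op (acc + bw.2))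
            (powerSumsAux B (d + 1)).val.2 0).val := by
        simp only [powerSumsAux, Timed.bind_val, Timed.pure_val, Function.update_self]
      rw [h3, h2, Timed.fold_val]
      simp only [Timed.op_val]
      rw [List.foldl_add_eq (fun bw : ZMod p × ZMod p => bw.2), zero_add, List.map_map]
      rfl
    · rw [← ih2 j h1 h]
      simp only [powerSumsAux, Timed.bind_val, Timed.pure_val]
      rw [Function.update_of_ne (by omega)]

theorem powerSums_val (B : List (ZMod p)) (d j : ℕ) (h1 : 1 ≤ j) (hj : j ≤ d) :
    (powerSums B d).val j = (B.map (· ^ j)).sum := (powerSumsAux_val B d).2 j h1 hj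

section Log

variable (inv : ℕ → ZMod p) (f : ℕ → Polynomial (ZMod p))

/-- Later rounds write only larger indices, so the recursion may be stated in terms of the final
table. -/
theorem logSeries_stable {j d : ℕ} (h : j ≤ d) :
    (logSeries inv f d).val j = (logSeries inv f j).val j := by
  induction d, h using Nat.le_induction with
  | base => rfl
  | succ d hd ih =>
    rw [← ih]
    simp only [logSeries, Timed.bind_val, Timed.pure_val]
    rw [Function.update_of_ne (by omega)]

theorem logSeries_succ (k : ℕ) :
    (logSeries inv f (k + 1)).val (k + 1) = f (k + 1) - Polynomial.C (inv (k + 1)) *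
      ∑ i ∈ Finset.range k, Polynomial.C ((i + 1 : ℕ) : ZMod p) *
        ((logSeries inv f k).val (i + 1) * f (k - i)) := by
  simp only [logSeries, Timed.bind_val, Timed.pure_val, Function.update_self, Timed.fold_val,
    polyMul, polyScale, polyAdd, polySub]
  rw [List.foldl_add_eq (fun i => Polynomial.C ((i + 1 : ℕ) : ZMod p) *
        ((logSeries inv f k).val (i + 1) * f (k - i))), zero_add, Finset.sum_range_eq_list_sum]

/-- The coefficient of s^k in f' = h' f, with the term containing f_0 = 1 split off, is the
recursion for h_(k+1) multiplied by k + 1. This factor is invertible because k + 1 ≤ d < p. -/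
theorem logSeries_isLog {d : ℕ} (hinv : ∀ k, 1 ≤ k → k ≤ d → inv k = (k : ZMod p)⁻¹)
    (hd : d < p) (h0 : f 0 = 1) : IsLog d (mk f) (mk (logSeries inv f d).val) := by
  refine X_pow_dvd_sub_of_coeff_eq fun k hk => ?_
  rw [coeff_derivative, coeff_mk, coeff_mul, Finset.Nat.sum_antidiagonal_eq_sum_range_succ_mk,
    Finset.sum_range_succ]
  simp only [coeff_derivative, coeff_mk, Nat.sub_self, h0, mul_one]
  have hk0 : ((k + 1 : ℕ) : ZMod p) ≠ 0 := by
    rw [Ne, ZMod.natCast_eq_zero_iff]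
    exact Nat.not_dvd_of_pos_of_lt (by omega) (by omega)
  rw [logSeries_stable inv f (show k + 1 ≤ d by omega), logSeries_succ,
    hinv (k + 1) (by omega) (by omega)]
  have hC : Polynomial.C ((k + 1 : ℕ) : ZMod p)⁻¹ * ((k : Polynomial (ZMod p)) + 1) = 1 := by
    have : ((k : Polynomial (ZMod p)) + 1) = Polynomial.C ((k + 1 : ℕ) : ZMod p) := by simp
    rw [this, ← Polynomial.C_mul, inv_mul_cancel₀ hk0, Polynomial.C_1]
  have hS : ∑ i ∈ Finset.range k, Polynomial.C ((i + 1 : ℕ) : ZMod p) *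
        ((logSeries inv f k).val (i + 1) * f (k - i)) =
      ∑ i ∈ Finset.range k, (logSeries inv f d).val (i + 1) * ((i : Polynomial (ZMod p)) + 1) *
        f (k - i) := by
    refine Finset.sum_congr rfl fun i hi => ?_
    rw [Finset.mem_range] at hi
    rw [logSeries_stable inv f (show i + 1 ≤ k by omega),
      logSeries_stable inv f (show i + 1 ≤ d by omega)]
    simp only [Nat.cast_add, Nat.cast_one, map_add, map_natCast, map_one]
    ring
  rw [hS]
  linear_combination (∑ i ∈ Finset.range k, (logSeries inv f d).val (i + 1) *
    ((i : Polynomial (ZMod p)) + 1) * f (k - i)) * hC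

end Log

section Exp

variable {r : ℕ} (inv : ℕ → ZMod p) (H : ℕ → MvPolynomial (Fin r) (ZMod p))

theorem expSeries_stable {j d : ℕ} (h : j ≤ d) :
    (expSeries inv H d).val j = (expSeries inv H j).val j := by
  induction d, h using Nat.le_induction with
  | base => rfl
  | succ d hd ih =>
    rw [← ih]
    simp only [expSeries, Timed.bind_val, Timed.pure_val]
    rw [Function.update_of_ne (by omega)]

theorem expSeries_zero (d : ℕ) : (expSeries inv H d).val 0 = 1 := by
  rw [expSeries_stable inv H (Nat.zero_le d)]
  simp [expSeries]

theorem expSeries_succ (k : ℕ) :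
    (expSeries inv H (k + 1)).val (k + 1) = MvPolynomial.C (inv (k + 1)) *
      ∑ i ∈ Finset.range (k + 1), MvPolynomial.C ((i + 1 : ℕ) : ZMod p) *
        (H (i + 1) * (expSeries inv H k).val (k - i)) := by
  simp only [expSeries, Timed.bind_val, Timed.pure_val, Function.update_self, Timed.fold_val,
    mvMul, mvScale, mvAdd]
  rw [List.foldl_add_eq (fun i => MvPolynomial.C ((i + 1 : ℕ) : ZMod p) *
        (H (i + 1) * (expSeries inv H k).val (k - i))), zero_add, Finset.sum_range_eq_list_sum]

/-- The same differential equation as for the logarithm, now solved for the series instead of its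
logarithm. -/
theorem expSeries_isLog {d : ℕ} (hinv : ∀ k, 1 ≤ k → k ≤ d → inv k = (k : ZMod p)⁻¹)
    (hd : d < p) : IsLog d (mk (expSeries inv H d).val) (mk H) := by
  refine X_pow_dvd_sub_of_coeff_eq fun k hk => ?_
  rw [coeff_derivative, coeff_mk, coeff_mul, Finset.Nat.sum_antidiagonal_eq_sum_range_succ_mk]
  simp only [coeff_derivative, coeff_mk]
  have hk0 : ((k + 1 : ℕ) : ZMod p) ≠ 0 := by
    rw [Ne, ZMod.natCast_eq_zero_iff]
    exact Nat.not_dvd_of_pos_of_lt (by omega) (by omega)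
  rw [expSeries_stable inv H (show k + 1 ≤ d by omega), expSeries_succ,
    hinv (k + 1) (by omega) (by omega)]
  have hC : MvPolynomial.C ((k + 1 : ℕ) : ZMod p)⁻¹ *
      ((k : MvPolynomial (Fin r) (ZMod p)) + 1) = 1 := by
    have : ((k : MvPolynomial (Fin r) (ZMod p)) + 1) =
      MvPolynomial.C ((k + 1 : ℕ) : ZMod p) := by simp
    rw [this, ← MvPolynomial.C_mul, inv_mul_cancel₀ hk0, MvPolynomial.C_1]
  have hS : ∑ i ∈ Finset.range (k + 1), MvPolynomial.C ((i + 1 : ℕ) : ZMod p) *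
        (H (i + 1) * (expSeries inv H k).val (k - i)) =
      ∑ i ∈ Finset.range (k + 1), H (i + 1) * ((i : MvPolynomial (Fin r) (ZMod p)) + 1) *
        (expSeries inv H d).val (k - i) := by
    refine Finset.sum_congr rfl fun i hi => ?_
    rw [expSeries_stable inv H (show k - i ≤ k by omega),
      expSeries_stable inv H (show k - i ≤ d by omega)]
    simp only [Nat.cast_add, Nat.cast_one, map_add, map_natCast, map_one]
    ring
  rw [hS]
  linear_combination (∑ i ∈ Finset.range (k + 1), H (i + 1) *
    ((i : MvPolynomial (Fin r) (ZMod p)) + 1) * (expSeries inv H d).val (k - i)) * hC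

end Exp

variable {m : ℕ}

theorem collect_val (w : List (ExpTerm p m)) :
    (collect w).val = (w.map fun τ => Finsupp.single τ.xexp τ.coeff).sum := by
  rw [collect, Timed.fold_val]
  simp only [Timed.op_val]
  rw [List.foldl_add_eq (fun τ : ExpTerm p m => Finsupp.single τ.xexp τ.coeff), zero_add]

theorem expSumCoeffs_val (inv : ℕ → ZMod p) (L : List (ExpTerm p m)) (d : ℕ)
    (hinv : ∀ k, 1 ≤ k → k ≤ d → inv k = (k : ZMod p)⁻¹) :
    (expSumCoeffs inv L d).val.2 = L.map (fun τ =>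
        { τ with coeff := τ.coeff * τ.a ^ d * ((d.factorial : ℕ) : ZMod p)⁻¹ }) ∧
      ∀ j ≤ d, (expSumCoeffs inv L d).val.1 j = (L.map fun τ =>
        Finsupp.single τ.xexp (τ.coeff * τ.a ^ j * ((j.factorial : ℕ) : ZMod p)⁻¹)).sum := by
  induction d with
  | zero =>
    refine ⟨by simp [expSumCoeffs], fun j hj => ?_⟩
    obtain rfl : j = 0 := by omega
    simp [expSumCoeffs, collect_val]
  | succ d ih =>
    obtain ⟨ih1, ih2⟩ := ih fun k h1 h2 => hinv k h1 (by omega)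
    have h2 : (expSumCoeffs inv L (d + 1)).val.2 = L.map (fun τ =>
        { τ with coeff := τ.coeff * τ.a ^ (d + 1) * (((d + 1).factorial : ℕ) : ZMod p)⁻¹ }) := by
      simp only [expSumCoeffs, Timed.bind_val, Timed.op_val, Timed.pure_val, Timed.mapL_val, ih1,
        List.map_map]
      refine List.map_congr_left fun b _ => ?_
      simp only [Function.comp, hinv (d + 1) (by omega) le_rfl, Nat.factorial_succ, Nat.cast_mul,
        mul_inv, pow_succ]
      congr 1
      ring
    refine ⟨h2, fun j hj => ?_⟩
    rcases Nat.lt_or_ge d j with h | h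
    · obtain rfl : j = d + 1 := by omega
      have h3 : (expSumCoeffs inv L (d + 1)).val.1 (d + 1) =
          (collect (expSumCoeffs inv L (d + 1)).val.2).val := by
        simp only [expSumCoeffs, Timed.bind_val, Timed.pure_val, Function.update_self]
      rw [h3, h2, collect_val, List.map_map]
      rfl
    · rw [← ih2 j h]
      simp only [expSumCoeffs, Timed.bind_val, Timed.pure_val]
      rw [Function.update_of_ne (by omega)]

/-- The start index is left free because the recursion moves it; only start 0 is used later. -/
theorem firstNonzero_val (T : ℕ → ((Fin m → ℤ) →₀ ZMod p)) (s n : ℕ) :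
    match (firstNonzero T (List.range' s n)).val with
    | none => ∀ k, s ≤ k → k < s + n → T k = 0
    | some k₀ => s ≤ k₀ ∧ k₀ < s + n ∧ T k₀ ≠ 0 ∧ ∀ k, s ≤ k → k < k₀ → T k = 0 := by
  induction n generalizing s with
  | zero => simp only [List.range'_zero, firstNonzero, Timed.pure_val]; intros; omega
  | succ n ih =>
    simp only [List.range'_succ, firstNonzero, Timed.bind_val]
    by_cases h : T s = 0
    · simp only [h, decide_true, if_true]
      have := ih (s + 1)
      revert this
      rcases (firstNonzero T (List.range' (s + 1) n)).val with _ | k₀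
      · intro this k h1 h2
        rcases h1.eq_or_lt with rfl | h1
        · exact h
        · exact this k h1 (by omega)
      · intro this
        refine ⟨by have := this.1; omega, by have := this.2.1; omega, this.2.2.1, fun k h1 h2 => ?_⟩
        rcases h1.eq_or_lt with rfl | h1
        · exact h
        · exact this.2.2.2 k h1 h2
    · simp only [h, decide_false, Bool.false_eq_true, if_false, Timed.pure_val]
      exact ⟨le_rfl, by omega, h, fun k h1 h2 => by omega⟩

end Tables

/-! ### Generalized Todd series modulo p. -/

section Todd

open PowerSeries

variable {p : ℕ} [Fact p.Prime]

/-- The exponential series, truncated where its coefficients cease to be defined modulo `p`. -/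
def truncExp (p : ℕ) [Fact p.Prime] : (ZMod p)⟦X⟧ :=
  mk fun k => ((k.factorial : ℕ) : ZMod p)⁻¹

/-- `(e^s - 1) / s` for the truncated exponential series. -/
def truncExpQuot (p : ℕ) [Fact p.Prime] : (ZMod p)⟦X⟧ :=
  mk fun k => (((k + 1).factorial : ℕ) : ZMod p)⁻¹

/-- The identity is exact in every degree: the two series use the same inverses of factorials,
including the default value 0 for the inverse of 0 when p divides the factorial. -/
theorem X_mul_truncExpQuot : X * truncExpQuot p = truncExp p - 1 := by
  ext k
  rcases k with _ | k
  · simp [truncExp]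
  · rw [coeff_succ_X_mul, truncExpQuot, truncExp, map_sub, coeff_mk, coeff_mk, coeff_one]
    simp

theorem constantCoeff_rescale {K : Type*} [CommRing K] (b : K) (f : K⟦X⟧) :
    constantCoeff (rescale b f) = constantCoeff f := by
  rw [← coeff_zero_eq_constantCoeff_apply, coeff_rescale, pow_zero, one_mul,
    coeff_zero_eq_constantCoeff_apply]

theorem constantCoeff_map_truncExp {K : Type*} [CommRing K] (φ : ZMod p →+* K) :
    constantCoeff (map φ (truncExp p)) = 1 := by
  rw [← coeff_zero_eq_constantCoeff_apply, coeff_map, truncExp, coeff_mk]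
  simp

theorem constantCoeff_map_truncExpQuot {K : Type*} [CommRing K] (φ : ZMod p →+* K) :
    constantCoeff (map φ (truncExpQuot p)) = 1 := by
  rw [← coeff_zero_eq_constantCoeff_apply, coeff_map, truncExpQuot, coeff_mk]
  simp

theorem natCast_isUnit_of_lt {K : Type*} [CommRing K] (φ : ZMod p →+* K) {d : ℕ}
    (hd : d < p) (k : ℕ) (h1 : 1 ≤ k) (hk : k ≤ d) : IsUnit (k : K) := by
  have hk0 : (k : ZMod p) ≠ 0 := by
    rw [Ne, ZMod.natCast_eq_zero_iff]
    exact Nat.not_dvd_of_pos_of_lt (by omega) (by omega)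
  simpa using (IsUnit.mk0 _ hk0).map φ

/-- This is why power sums suffice: one logarithm, rescaled by all b in B and added up, depends on B
only through them. -/
theorem coeff_list_sum_rescale {K : Type*} [CommRing K] (φ : ZMod p →+* K) (B : List (ZMod p))
    (h : K⟦X⟧) (k : ℕ) :
    coeff k (B.map fun b => rescale (φ b) h).sum = φ (B.map (· ^ k)).sum * coeff k h := by
  induction B with
  | nil => simp
  | cons b B ih => simp [ih, coeff_rescale, add_mul]

variable {m : ℕ}

theorem toddLog_groups {r : ℕ} (B : Fin r → List (ZMod p)) (hy : ℕ → Polynomial (ZMod p)) (d : ℕ)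
    (l : List (Fin r)) (H : ℕ → MvPolynomial (Fin r) (ZMod p)) (k : ℕ) (h1 : 1 ≤ k) (hk : k ≤ d) :
    (Timed.fold (fun H (i : Fin r) => do
      let q ← powerSums (B i) d
      Timed.fold (fun (H' : ℕ → MvPolynomial (Fin r) (ZMod p)) k => do
        let u ← polyScale (q k) (hy k)
        let v ← mvSub (H' k) (Polynomial.aeval (MvPolynomial.X i) u)
        pure (Function.update H' k v)) (List.range' 1 d) H) l H).val k =
      H k - (l.map fun i => Polynomial.aeval (MvPolynomial.X i : MvPolynomial (Fin r) (ZMod p))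
        (Polynomial.C ((B i).map (· ^ k)).sum * hy k)).sum := by
  induction l generalizing H with
  | nil => simp [Timed.fold]
  | cons i l ih =>
    simp only [Timed.fold, Timed.bind_val] at ih ⊢
    rw [ih, List.map_cons, List.sum_cons, ← sub_sub]
    congr 1
    rw [Timed.fold_val]
    simp only [Timed.bind_val, Timed.pure_val, mvSub, polyScale]
    rw [List.foldl_update (fun a k => a - Polynomial.aeval (MvPolynomial.X i)
      (Polynomial.C ((powerSums (B i) d).val k) * hy k)) _ List.nodup_range',
      if_pos (mem_range'_one.2 ⟨h1, hk⟩), powerSums_val _ _ _ h1 hk]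

theorem eval₂Hom_aeval_X {K : Type*} [CommRing K] {r : ℕ} (φ : ZMod p →+* K) (y : Fin r → K)
    (i : Fin r) (u : Polynomial (ZMod p)) :
    MvPolynomial.eval₂Hom φ y (Polynomial.aeval (MvPolynomial.X i) u) =
      Polynomial.eval₂ φ (y i) u := by
  rw [Polynomial.aeval_def, Polynomial.hom_eval₂]
  congr 1
  · ext a
    rw [RingHom.comp_apply, MvPolynomial.algebraMap_eq, MvPolynomial.coe_eval₂Hom,
      MvPolynomial.eval₂_C]
  · simp

/-- The generalized Todd polynomials, with the `y_i` replaced by elements of a ring of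
characteristic `p`, invert the product that defines them. -/
theorem toddSeries_mul_sub_one {K : Type*} [CommRing K] (φ : ZMod p →+* K) (G : GTodd p m)
    (y : Fin G.grp.length → K) (d : ℕ) (hd : d + 2 ≤ p) :
    X ^ (d + 1) ∣ (mk fun k => MvPolynomial.eval₂Hom φ y ((G.toddSeries d).val k)) *
      ((G.B0.map fun b => rescale (φ b) (map φ (truncExpQuot p))).prod *
        ∏ i, ((G.grp.get i).2.map fun b =>
          rescale (φ b) (1 - C (y i) * (map φ (truncExp p) - 1))).prod) - 1 := by
  set inv := (invTable (p := p) (d + 1)).val with inv_def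
  set c := (invFactTable inv (d + 1)).val with c_def
  set h := (logSeries inv (fun k => Polynomial.C (c (k + 1))) d).val with h_def
  set hy := (logSeries inv (fun k => if k = 0 then 1 else Polynomial.monomial 1 (-(c k))) d).val
    with hy_def
  have hinv : ∀ k, 1 ≤ k → k ≤ d + 1 → inv k = (k : ZMod p)⁻¹ := fun k h1 h2 =>
    invTable_val _ _ h1 h2
  have hc : ∀ k ≤ d + 1, c k = ((k.factorial : ℕ) : ZMod p)⁻¹ := fun k hk =>
    invFactTable_val inv (d + 1) hinv k hk
  have hinv' : ∀ k, 1 ≤ k → k ≤ d → inv k = (k : ZMod p)⁻¹ := fun k h1 h2 =>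
    hinv k h1 (by omega)
  -- The shift by one in `c (k + 1)` turns e^s - 1 into (e^s - 1)/s, which has constant coefficient
  -- 1.
  have hlog := logSeries_isLog inv (fun k => Polynomial.C (c (k + 1))) hinv' (by omega)
    (by simp [hc 1 (by omega)])
  have hlogy := logSeries_isLog inv
    (fun k => if k = 0 then 1 else Polynomial.monomial 1 (-(c k))) hinv' (by omega) (by simp)
  rw [← h_def] at hlog
  rw [← hy_def] at hlogy
  -- the logarithms after substitution
  have hlog0 : ∀ b : ZMod p, IsLog d (rescale (φ b) (map φ (truncExpQuot p)))
      (rescale (φ b) (map (φ.comp Polynomial.constantCoeff) (mk h))) := by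
    intro b
    refine IsLog.rescale ((hlog.map (φ.comp Polynomial.constantCoeff)).congr
      (fun k hk => ?_) fun _ _ _ => rfl) _
    simp [truncExpQuot, hc (k + 1) (by omega)]
  have hlogi : ∀ (i : Fin G.grp.length) (b : ZMod p),
      IsLog d (rescale (φ b) (1 - C (y i) * (map φ (truncExp p) - 1)))
        (rescale (φ b) (map (Polynomial.eval₂RingHom φ (y i)) (mk hy))) := by
    intro i b
    refine IsLog.rescale ((hlogy.map (Polynomial.eval₂RingHom φ (y i))).congr
      (fun k hk => ?_) fun _ _ _ => rfl) _
    rcases k with _ | k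
    · simp [constantCoeff_map_truncExp]
    · simp [truncExp, hc (k + 1) (by omega), coeff_one, mul_comm]
  have hprod := (IsLog.list_prod G.B0 _ _ fun b _ => hlog0 b).mul
    (IsLog.finset_prod Finset.univ _ _ fun i _ =>
      IsLog.list_prod (G.grp.get i).2 _ _ fun b _ => hlogi i b)
  -- the logarithm computed by the algorithm
  obtain ⟨H, hH, hF⟩ : ∃ H : ℕ → MvPolynomial (Fin G.grp.length) (ZMod p),
      (∀ k, 1 ≤ k → k ≤ d → H k = MvPolynomial.C (-((G.B0.map (· ^ k)).sum * (h k).coeff 0)) -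
        ∑ i, Polynomial.aeval (MvPolynomial.X i : MvPolynomial (Fin G.grp.length) (ZMod p))
          (Polynomial.C (((G.grp.get i).2.map (· ^ k)).sum) * hy k)) ∧
      (G.toddSeries d).val = (expSeries inv H d).val := by
    -- The table H of the algorithm is found by unification from the final `rfl`.
    refine ⟨_, fun k h1 hk => ?_, rfl⟩
    rw [toddLog_groups (fun i => (G.grp.get i).2) hy d _ _ k h1 hk, ← Fin.sum_univ_def]
    congr 1
    rw [Timed.fold_val]
    simp only [Timed.bind_val, Timed.pure_val, Timed.op_val]
    rw [List.foldl_update (fun _ k => MvPolynomial.C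
      (-((powerSums G.B0 d).val k * (h k).coeff 0))) _ List.nodup_range',
      if_pos (mem_range'_one.2 ⟨h1, hk⟩), powerSums_val _ _ _ h1 hk]
  have hexp := (expSeries_isLog inv H hinv' (by omega)).map (MvPolynomial.eval₂Hom φ y)
  rw [hF]
  -- After substitution, H agrees in degrees 1 to d with minus the logarithm of the product, so it
  -- may be replaced by the latter.
  have hexp' := hexp.congr (g := mk fun k => MvPolynomial.eval₂Hom φ y ((expSeries inv H d).val k))
    (fun k _ => by simp) (k := -((G.B0.map fun b =>
      rescale (φ b) (map (φ.comp Polynomial.constantCoeff) (mk h))).sum +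
      ∑ i, ((G.grp.get i).2.map fun b =>
        rescale (φ b) (map (Polynomial.eval₂RingHom φ (y i)) (mk hy))).sum))
    (fun k h1 hk => by
      rw [coeff_map, coeff_mk, hH k h1 hk, map_neg, map_add, map_sum, coeff_list_sum_rescale,
        map_sub, map_sum]
      simp only [coeff_list_sum_rescale, eval₂Hom_aeval_X, MvPolynomial.coe_eval₂Hom,
        MvPolynomial.eval₂_C, coeff_map, coeff_mk, Polynomial.eval₂_C,
        Polynomial.coe_eval₂RingHom, RingHom.comp_apply, Polynomial.constantCoeff_apply, map_neg,
        map_mul]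
      ring)
  refine IsLog.mul_sub_one hexp' hprod (neg_add_cancel _) ?_
    (natCast_isUnit_of_lt φ (by omega))
  have h0 : constantCoeff (mk fun k => MvPolynomial.eval₂Hom φ y ((expSeries inv H d).val k)) =
      1 := by
    rw [← coeff_zero_eq_constantCoeff_apply, coeff_mk, expSeries_zero, map_one]
  rw [h0, map_mul, map_prod, map_list_prod, List.map_map]
  simp [map_list_prod, Function.comp_def, constantCoeff_rescale,
    constantCoeff_map_truncExpQuot, constantCoeff_map_truncExp]

end Todd

/-! ### Laurent monomials and polynomials as rational functions. -/

namespace RatFun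

variable {σ F : Type} [Field F]

/-- Constants, as a ring homomorphism. -/
def constHom (σ F : Type) [Field F] : F →+* RatFun σ F :=
  (algebraMap (MvPolynomial σ F) (RatFun σ F)).comp MvPolynomial.C

theorem constHom_apply (a : F) : constHom σ F a = const a := rfl

theorem X_ne_zero (s : σ) :
    algebraMap (MvPolynomial σ F) (RatFun σ F) (MvPolynomial.X s) ≠ 0 := by
  rw [Ne, FaithfulSMul.algebraMap_eq_zero_iff]
  exact MvPolynomial.X_ne_zero s

variable [Fintype σ]

@[simp] theorem mono_zero : mono F (0 : σ → ℤ) = 1 := by simp [mono]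

theorem mono_add (e f : σ → ℤ) : mono F (e + f) = mono F e * mono F f := by
  rw [mono, mono, mono, ← Finset.prod_mul_distrib]
  exact Finset.prod_congr rfl fun s _ => zpow_add₀ (X_ne_zero s) _ _

/-- Monomials, as a homomorphism. -/
def monoHom (σ F : Type) [Field F] [Fintype σ] : Multiplicative (σ → ℤ) →* RatFun σ F where
  toFun e := mono F e.toAdd
  map_one' := mono_zero
  map_mul' e f := mono_add e.toAdd f.toAdd

theorem mono_zsmul (z : ℤ) (e : σ → ℤ) : mono F (z • e) = mono F e ^ z :=
  map_zpow' (monoHom σ F) (fun x => by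
    refine eq_inv_of_mul_eq_one_left ?_
    rw [← map_mul, inv_mul_cancel, map_one]) (Multiplicative.ofAdd e) z

theorem mono_sum {ι : Type*} (s : Finset ι) (e : ι → σ → ℤ) :
    mono F (∑ i ∈ s, e i) = ∏ i ∈ s, mono F (e i) :=
  map_prod (monoHom σ F) (fun i => Multiplicative.ofAdd (e i)) s

theorem mono_natCast (e : σ → ℕ) :
    mono F (fun s => (e s : ℤ)) = algebraMap (MvPolynomial σ F) (RatFun σ F)
      (MvPolynomial.monomial (Finsupp.equivFunOnFinite.symm e) 1) := by
  rw [MvPolynomial.monomial_eq, mono, map_mul, Finsupp.prod_fintype _ _ (by simp)]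
  simp [map_prod]

/-- The rational function given by a Laurent polynomial. -/
def laurent (σ F : Type) [Field F] [Fintype σ] : ((σ → ℤ) →₀ F) →+ RatFun σ F :=
  Finsupp.liftAddHom fun e => (AddMonoidHom.mulRight (mono F e)).comp
    (constHom σ F).toAddMonoidHom

theorem laurent_apply (f : (σ → ℤ) →₀ F) :
    laurent σ F f = f.sum fun e a => const a * mono F e := rfl

theorem laurent_single (e : σ → ℤ) (a : F) :
    laurent σ F (Finsupp.single e a) = const a * mono F e := by
  rw [laurent_apply, Finsupp.sum_single_index (by simp [const])]

theorem laurent_smul (a : F) (f : (σ → ℤ) →₀ F) :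
    laurent σ F (a • f) = const a * laurent σ F f := by
  induction f using Finsupp.induction_linear with
  | zero => simp
  | add f g hf hg => rw [smul_add, map_add, map_add, hf, hg, mul_add]
  | single e b =>
    rw [Finsupp.smul_single, laurent_single, laurent_single, smul_eq_mul, ← constHom_apply,
      map_mul, mul_assoc]
    rfl

/-- Multiplying by a large monomial reduces the claim to ordinary polynomials, where distinct
exponents give independent monomials. It is needed because the algorithm tests exponent tables for
zero, while the proof speaks of rational functions. -/
theorem laurent_injective : Function.Injective (laurent σ F) := by
  classical
  refine (injective_iff_map_eq_zero _).2 fun f hf => ?_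
  -- This exponent dominates every negative exponent that occurs in f.
  let g : σ → ℤ := fun s => ∑ e ∈ f.support, |e s|
  have hg : ∀ e ∈ f.support, ∀ s, 0 ≤ (e + g) s := by
    intro e he s
    have h1 : |e s| ≤ g s := Finset.single_le_sum (f := fun e : σ → ℤ => |e s|)
      (fun _ _ => abs_nonneg _) he
    have h2 := neg_abs_le (e s)
    rw [Pi.add_apply]; linarith
  let t : (σ → ℤ) → (σ →₀ ℕ) := fun e => Finsupp.equivFunOnFinite.symm fun s => ((e + g) s).toNat
  have ht : Set.InjOn t f.support := by
    intro e he e' he' h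
    funext s
    have h1 := DFunLike.congr_fun h s
    simp only [t, Finsupp.equivFunOnFinite_symm_apply_apply] at h1
    have h2 := hg e he s
    have h3 := hg e' he' s
    simp only [Pi.add_apply] at h1 h2 h3
    omega
  have h0 : ∑ e ∈ f.support, MvPolynomial.monomial (t e) (f e) = 0 := by
    apply FaithfulSMul.algebraMap_injective (MvPolynomial σ F) (RatFun σ F)
    rw [map_zero, ← zero_mul (mono F g), ← hf, laurent_apply, Finsupp.sum, Finset.sum_mul, map_sum]
    refine Finset.sum_congr rfl fun e he => ?_
    rw [mul_assoc, ← mono_add]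
    have : e + g = fun s => ((((e + g) s).toNat : ℕ) : ℤ) := by
      funext s; exact (Int.toNat_of_nonneg (hg e he s)).symm
    rw [this, mono_natCast, const, ← map_mul, MvPolynomial.C_mul_monomial, mul_one]
  ext e
  by_contra hne
  have he : e ∈ f.support := Finsupp.mem_support_iff.2 hne
  have := congrArg (MvPolynomial.coeff (t e)) h0
  rw [MvPolynomial.coeff_sum, Finset.sum_eq_single e] at this
  · exact hne (by simpa using this)
  · intro e' he' hne'
    rw [MvPolynomial.coeff_monomial, if_neg fun h => hne' (ht he' he h)]
  · exact fun h => absurd he h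

theorem one_sub_mono_ne_zero {e : σ → ℤ} (he : e ≠ 0) : 1 - mono F e ≠ 0 := by
  intro h
  have : laurent σ F (Finsupp.single 0 1 - Finsupp.single e 1) = 0 := by
    rw [map_sub, laurent_single, laurent_single, ← constHom_apply, map_one, mono_zero, one_mul,
      one_mul, h]
  have := DFunLike.congr_fun (laurent_injective (this.trans (map_zero _).symm)) 0
  rw [Finsupp.sub_apply, Finsupp.single_eq_same, Finsupp.single_eq_of_ne he.symm] at this
  simp at this

end RatFun

/-! ### Algorithm CTGTodd computes a coefficient of a quotient of power series. -/

section Todd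

open PowerSeries

variable {p m : ℕ} [Fact p.Prime]

theorem List.sum_map_foldl_cons {α β M : Type*} [AddCommMonoid M] (v : β → M) (g : α → β)
    (l : List α) (out : List β) :
    ((l.foldl (fun out a => g a :: out) out).map v).sum =
      (out.map v).sum + (l.map fun a => v (g a)).sum := by
  induction l generalizing out with
  | nil => simp
  | cons a l ih => 
    rw [List.foldl_cons, ih, List.map_cons, List.sum_cons, List.map_cons, List.sum_cons]
    abel

theorem List.sum_map_foldl {α β M : Type*} [AddCommMonoid M] (v : β → M)
    (s : List β → α → List β) (t : α → M)
    (hs : ∀ out a, ((s out a).map v).sum = (out.map v).sum + t a) (l : List α) (out : List β) :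
    ((l.foldl s out).map v).sum = (out.map v).sum + (l.map t).sum := by
  induction l generalizing out with
  | nil => simp
  | cons a l ih => rw [List.foldl_cons, ih, hs, List.map_cons, List.sum_cons, add_assoc]

namespace GTodd

/-- `L(e^s)`, with truncated exponential series. -/
def numSeries (G : GTodd p m) : (RatFun (Fin m) (ZMod p))⟦X⟧ :=
  (G.L.map fun τ => C (RatFun.const τ.coeff * RatFun.mono (ZMod p) τ.xexp) *
    rescale (RatFun.constHom _ _ τ.a) (map (RatFun.constHom _ _) (truncExp p))).sum

/-- The denominator of `G(s)` divided by `s ^ |B_0|`, with truncated exponential series. -/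
def denSeries (G : GTodd p m) : (RatFun (Fin m) (ZMod p))⟦X⟧ :=
  (G.B0.map fun b => C (-RatFun.constHom _ _ b) *
    rescale (RatFun.constHom _ _ b) (map (RatFun.constHom _ _) (truncExpQuot p))).prod *
  (G.grp.map fun g => (g.2.map fun b => 1 - C (RatFun.mono (ZMod p) g.1) *
    rescale (RatFun.constHom _ _ b) (map (RatFun.constHom _ _) (truncExp p))).prod).prod

theorem coeff_numSeries (G : GTodd p m) (k d : ℕ) (hk : k ≤ d) (inv : ℕ → ZMod p)
    (hinv : ∀ k, 1 ≤ k → k ≤ d → inv k = (k : ZMod p)⁻¹) :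
    coeff k G.numSeries = RatFun.laurent (Fin m) (ZMod p) ((expSumCoeffs inv G.L d).val.1 k) := by
  rw [(expSumCoeffs_val inv G.L d hinv).2 k hk, numSeries]
  induction G.L with
  | nil => simp
  | cons τ L ih =>
    rw [List.map_cons, List.sum_cons, map_add, ih, List.map_cons, List.sum_cons, map_add,
      RatFun.laurent_single]
    congr 1
    rw [coeff_C_mul, coeff_rescale, coeff_map, truncExp, coeff_mk]
    simp only [← RatFun.constHom_apply, map_mul, map_pow]
    ring

/-- The scalar factor of the denominator. -/
def scalar (G : GTodd p m) : RatFun (Fin m) (ZMod p) :=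
  RatFun.constHom _ _ (G.B0.map fun b => -b).prod *
    ∏ i : Fin G.grp.length, (1 - RatFun.mono (ZMod p) (G.grp.get i).1) ^ (G.grp.get i).2.length

/-- `y_i = t_i / (1 - t_i)`. -/
def yval (G : GTodd p m) (i : Fin G.grp.length) : RatFun (Fin m) (ZMod p) :=
  RatFun.mono (ZMod p) (G.grp.get i).1 / (1 - RatFun.mono (ZMod p) (G.grp.get i).1)

/-- The point is 1 - t e^(bs) = (1 - t)(1 - y (e^(bs) - 1)) with y = t/(1 - t). It separates a
scalar, whose inverse is the factor A, from a product of series with constant coefficient 1. -/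
theorem denSeries_eq (G : GTodd p m) (ht : ∀ g ∈ G.grp, g.1 ≠ 0) :
    G.denSeries = C G.scalar *
      ((G.B0.map fun b => rescale (RatFun.constHom _ _ b)
          (map (RatFun.constHom _ _) (truncExpQuot p))).prod *
        ∏ i, ((G.grp.get i).2.map fun b => rescale (RatFun.constHom _ _ b)
          (1 - C (G.yval i) * (map (RatFun.constHom _ _) (truncExp p) - 1))).prod) := by
  have h1 : (G.B0.map fun b => C (-RatFun.constHom (Fin m) (ZMod p) b) *
      rescale (RatFun.constHom _ _ b) (map (RatFun.constHom _ _) (truncExpQuot p))).prod =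
      C (RatFun.constHom _ _ (G.B0.map fun b => -b).prod) * (G.B0.map fun b =>
        rescale (RatFun.constHom _ _ b)
          (map (RatFun.constHom _ _) (truncExpQuot p))).prod := by
    rw [List.prod_map_mul, map_list_prod, map_list_prod, List.map_map, List.map_map]
    congr 3
    simp [Function.comp_def]
  have h2 : (G.grp.map fun g => (g.2.map fun b => 1 - C (RatFun.mono (ZMod p) g.1) *
      rescale (RatFun.constHom _ _ b) (map (RatFun.constHom _ _) (truncExp p))).prod).prod =
      ∏ i, (C ((1 - RatFun.mono (ZMod p) (G.grp.get i).1) ^ (G.grp.get i).2.length) *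
        ((G.grp.get i).2.map fun b => rescale (RatFun.constHom _ _ b)
          (1 - C (G.yval i) * (map (RatFun.constHom _ _) (truncExp p) - 1))).prod) := by
    rw [← Fin.prod_univ_fun_getElem]
    refine Finset.prod_congr rfl fun i _ => ?_
    have h3 : 1 - RatFun.mono (ZMod p) (G.grp.get i).1 ≠ 0 :=
      RatFun.one_sub_mono_ne_zero (ht _ (List.get_mem _ _))
    rw [map_pow, ← List.prod_replicate, ← List.map_const', ← List.prod_map_mul]
    congr 1
    refine List.map_congr_left fun b _ => ?_
    have h4 : RatFun.mono (ZMod p) (G.grp.get i).1 =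
        (1 - RatFun.mono (ZMod p) (G.grp.get i).1) * G.yval i := by
      rw [yval]; field_simp
    have hC : ∀ a, rescale (RatFun.constHom (Fin m) (ZMod p) b) (C a) = C a := by
      intro a; ext k; rw [coeff_rescale, coeff_C]; split_ifs with hk <;> simp [hk]
    simp only [map_sub, map_mul, map_one, hC]
    have h5 := congrArg (C (R := RatFun (Fin m) (ZMod p))) h4
    rw [map_mul, map_sub, map_one] at h5
    simp only [List.get_eq_getElem] at h5 ⊢
    linear_combination (1 - rescale (RatFun.constHom _ _ b)
      (map (RatFun.constHom _ _) (truncExp p))) * h5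
  rw [denSeries, h1, h2, Finset.prod_mul_distrib, scalar, map_mul, map_prod]
  ring

theorem scalar_ne_zero (G : GTodd p m) (hs : G.Suitable) (ht : ∀ g ∈ G.grp, g.1 ≠ 0) :
    G.scalar ≠ 0 := by
  refine mul_ne_zero ?_ (Finset.prod_ne_zero_iff.2 fun i _ => pow_ne_zero _
    (RatFun.one_sub_mono_ne_zero (ht _ (List.get_mem _ _))))
  rw [Ne, _root_.map_eq_zero, List.prod_eq_zero_iff, List.mem_map]
  rintro ⟨b, hb, h⟩
  exact hs.2 (neg_eq_zero.1 h ▸ hb)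

/-- The list has one fraction for each monomial of each F_(d-k). Its sum is the evaluation of these
polynomials at the y_i, weighted by the numerator coefficients. -/
theorem ctGTodd_some (G : GTodd p m)
    (d₀ : ℕ) (ℓ : ℕ → ((Fin m → ℤ) →₀ ZMod p))
    (hℓ : ℓ = (expSumCoeffs (invTable G.B0.length).val G.L G.B0.length).val.1)
    (h : (firstNonzero ℓ (List.range (G.B0.length + 1))).val = some d₀) :
    (G.ctGTodd.val.map SimpleFrac.value).sum =
      ∑ k ∈ Finset.range (G.B0.length - d₀ + 1), RatFun.laurent (Fin m) (ZMod p) (ℓ (d₀ + k)) *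
        (G.scalar⁻¹ * MvPolynomial.eval₂Hom (RatFun.constHom _ _) G.yval
          ((G.toddSeries (G.B0.length - d₀)).val (G.B0.length - d₀ - k))) := by
  subst hℓ
  rw [ctGTodd]
  simp only [Timed.bind_val, h]
  set ℓ := (expSumCoeffs (invTable G.B0.length).val G.L G.B0.length).val.1
  set F := (G.toddSeries (G.B0.length - d₀)).val
  have hA : (Timed.fold (fun acc b => op (acc * (-b))) G.B0 (1 : ZMod p)).val =
      (G.B0.map fun b => -b).prod := by
    rw [Timed.fold_val]
    simp only [Timed.op_val]
    have : ∀ (l : List (ZMod p)) (s : ZMod p),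
        l.foldl (fun acc b => acc * (-b)) s = s * (l.map fun b => -b).prod := by
      intro l
      induction l with
      | nil => simp
      | cons b l ih => intro s; rw [List.foldl_cons, ih, List.map_cons, List.prod_cons, mul_assoc]
    rw [this, one_mul]
  rw [hA]
  set B := (G.B0.map fun b => -b).prod with hB
  rw [Timed.fold_val]
  -- In y_i^(e_i) = t_i^(e_i) / (1 - t_i)^(e_i) the numerator goes into `mon`, and the denominator
  -- joins the factor (1 - t_i)^|B_i| of A.
  have key : ∀ (a : ZMod p) (e : Fin G.grp.length →₀ ℕ) (E : (Fin m → ℤ) →₀ ZMod p),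
      SimpleFrac.value ({ num := (B⁻¹ * a) • E
                          mon := ∑ i, (e i : ℤ) • (G.grp.get i).1
                          den := (List.finRange G.grp.length).map fun i =>
                            ((G.grp.get i).1, e i + (G.grp.get i).2.length) } : SimpleFrac p m) =
      RatFun.laurent (Fin m) (ZMod p) E * (G.scalar⁻¹ * (RatFun.constHom _ _ a *
        ∏ i, G.yval i ^ e i)) := by
    intro a e E
    rw [SimpleFrac.value, ← RatFun.laurent_apply, RatFun.laurent_smul, RatFun.mono_sum,
      List.map_map, ← Fin.prod_univ_def, scalar, ← hB]
    simp only [RatFun.mono_zsmul, zpow_natCast, Function.comp, yval, div_pow, pow_add,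
      Finset.prod_mul_distrib, Finset.prod_div_distrib, ← RatFun.constHom_apply, map_mul, map_inv₀]
    field_simp
  rw [List.sum_map_foldl SimpleFrac.value _ (fun k =>
    RatFun.laurent (Fin m) (ZMod p) (ℓ (d₀ + k)) *
        (G.scalar⁻¹ * MvPolynomial.eval₂Hom (RatFun.constHom _ _) G.yval
          (F (G.B0.length - d₀ - k)))), List.map_nil, List.sum_nil, zero_add,
    Finset.sum_range_eq_list_sum]
  intro out k
  rw [Timed.fold_val]
  simp only [Timed.bind_val, Timed.pure_val, Timed.op_val]
  rw [List.sum_map_foldl_cons SimpleFrac.value]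
  congr 1
  simp only [key]
  rw [MvPolynomial.coe_eval₂Hom, MvPolynomial.eval₂_eq', Finset.mul_sum, Finset.mul_sum,
    ← Finset.sum_map_toList]

/-- The algorithm computes the coefficient of `s ^ |B_0|` in `Lh / u`, where `Lh` and `u` agree
with the numerator and the reduced denominator of `G(s)` up to the order that is defined
modulo `p`. -/
theorem ctGTodd_sum_value (G : GTodd p m) (hs : G.Suitable) (ht : ∀ g ∈ G.grp, g.1 ≠ 0)
    (Lh u w : (RatFun (Fin m) (ZMod p))⟦X⟧) (hL : X ^ p ∣ Lh - G.numSeries)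
    (hu : X ^ (p - 1) ∣ u - G.denSeries) (huw : u * w = 1)
    (h0 : G.B0.length + 1 = p → constantCoeff Lh = 0) :
    (G.ctGTodd.val.map SimpleFrac.value).sum = coeff G.B0.length (Lh * w) := by
  have hd₁ := hs.1
  set ℓ := (expSumCoeffs (invTable G.B0.length).val G.L G.B0.length).val.1 with hℓ
  have hcoeff : ∀ k ≤ G.B0.length, coeff k Lh = RatFun.laurent (Fin m) (ZMod p) (ℓ k) := by
    intro k hk
    rw [coeff_eq_of_X_pow_dvd hL (by omega), coeff_numSeries G k _ hk _ fun k h1 h2 =>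
      invTable_val _ _ h1 h2]
  have hfirst := firstNonzero_val ℓ 0 (G.B0.length + 1)
  rw [← List.range_eq_range'] at hfirst
  rcases ho : (firstNonzero ℓ (List.range (G.B0.length + 1))).val with _ | d₀
  · rw [ho] at hfirst
    have h1 : G.ctGTodd.val = [] := by
      rw [ctGTodd]; simp only [Timed.bind_val, ← hℓ, ho, Timed.pure_val]
    -- The numerator vanishes to an order higher than the pole, so the required coefficient is 0, in
    -- accordance with the empty output.
    have h2 : X ^ (G.B0.length + 1) ∣ Lh := X_pow_dvd_iff.2 fun k hk => by
      rw [hcoeff k (by omega), hfirst k (by omega) (by omega), map_zero]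
    rw [h1, X_pow_dvd_iff.1 (h2.mul_right w) _ (Nat.lt_succ_self _)]
    simp
  · rw [ho] at hfirst
    obtain ⟨-, hd₀, hne, hlt⟩ := hfirst
    -- The denominator is known only modulo s^(p-1), while F is needed modulo s^(d+1). The bound
    -- could fail only if |B_0| = p - 1 and d₀ = 0, and `h0` excludes this combination.
    have hd : G.B0.length - d₀ + 2 ≤ p := by
      by_contra hcon
      have h1 : d₀ = 0 := by omega
      have h2 := h0 (by omega)
      rw [← coeff_zero_eq_constantCoeff_apply, hcoeff 0 (by omega)] at h2
      exact hne (h1 ▸ RatFun.laurent_injective (h2.trans (map_zero _).symm))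
    rw [ctGTodd_some G d₀ ℓ rfl ho]
    set d := G.B0.length - d₀ with hd_def
    obtain ⟨E, hE⟩ : X ^ d₀ ∣ Lh := X_pow_dvd_iff.2 fun k hk => by
      rw [hcoeff k (by omega), hlt k (by omega) hk, map_zero]
    have hEk : ∀ k ≤ d, coeff k E = RatFun.laurent (Fin m) (ZMod p) (ℓ (d₀ + k)) := by
      intro k hk
      rw [← hcoeff (d₀ + k) (by omega), hE, add_comm, coeff_X_pow_mul]
    have hsc := scalar_ne_zero G hs ht
    set Fh : (RatFun (Fin m) (ZMod p))⟦X⟧ := PowerSeries.mk fun k =>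
      MvPolynomial.eval₂Hom (RatFun.constHom _ _) G.yval ((G.toddSeries d).val k) with hFh
    have hinvs := toddSeries_mul_sub_one (RatFun.constHom (Fin m) (ZMod p)) G G.yval d hd
    rw [← hFh] at hinvs
    -- Both series invert the reduced denominator modulo s^(d+1), and inverses are unique.
    have hw : X ^ (d + 1) ∣ w - C G.scalar⁻¹ * Fh := by
      have hu' : X ^ (d + 1) ∣ u - G.denSeries := (pow_dvd_pow X (by omega)).trans hu
      rw [denSeries_eq G ht] at hu'
      obtain ⟨q, hq⟩ := hu'
      obtain ⟨q', hq'⟩ := hinvs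
      have hCC : C G.scalar⁻¹ * C G.scalar = 1 := by
        rw [← map_mul, inv_mul_cancel₀ hsc, map_one]
      set Pr := ((G.B0.map fun b => rescale (RatFun.constHom (Fin m) (ZMod p) b)
          (map (RatFun.constHom _ _) (truncExpQuot p))).prod *
        ∏ i, ((G.grp.get i).2.map fun b => rescale (RatFun.constHom _ _ b)
          (1 - C (G.yval i) * (map (RatFun.constHom _ _) (truncExp p) - 1))).prod)
      refine ⟨-(w * (q' + C G.scalar⁻¹ * Fh * q)), ?_⟩
      linear_combination (C G.scalar⁻¹ * Fh) * huw - (C G.scalar⁻¹ * Fh * w) * hq - w * hq' -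
        (w * Pr * Fh) * hCC
    have hB : G.B0.length = d + d₀ := by omega
    rw [hE, mul_assoc, hB, coeff_X_pow_mul, coeff_mul,
      Finset.Nat.sum_antidiagonal_eq_sum_range_succ_mk]
    refine Finset.sum_congr rfl fun k hk => ?_
    rw [Finset.mem_range] at hk
    rw [hEk k (by omega), coeff_eq_of_X_pow_dvd hw (by omega), coeff_C_mul, hFh, coeff_mk]

end GTodd

end Todd

/-! ### Partial specialization of fractions. -/

section Specialization

variable {A F₁ F₂ : Type*} [CommRing A] [Field F₁] [Field F₂] (φ₁ : A →+* F₁) (φ₂ : A →+* F₂)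

/-- `w` is the value of `v` under the partial map that extends `φ₁ a ↦ φ₂ a` to fractions. -/
def FracSpecializes (v : F₁) (w : F₂) : Prop :=
  ∃ a b : A, φ₂ b ≠ 0 ∧ v = φ₁ a / φ₁ b ∧ w = φ₂ a / φ₂ b

namespace FracSpecializes

variable {φ₁ φ₂} {v v' : F₁} {w w' : F₂}

theorem of_apply (a : A) : FracSpecializes φ₁ φ₂ (φ₁ a) (φ₂ a) :=
  ⟨a, 1, by simp, by simp, by simp⟩

theorem zero : FracSpecializes φ₁ φ₂ 0 0 := by simpa using of_apply (φ₁ := φ₁) (φ₂ := φ₂) 0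

theorem one : FracSpecializes φ₁ φ₂ 1 1 := by simpa using of_apply (φ₁ := φ₁) (φ₂ := φ₂) 1

theorem neg (h : FracSpecializes φ₁ φ₂ v w) : FracSpecializes φ₁ φ₂ (-v) (-w) := by
  obtain ⟨a, b, hb, rfl, rfl⟩ := h
  exact ⟨-a, b, hb, by rw [map_neg, neg_div], by rw [map_neg, neg_div]⟩

theorem mul (h : FracSpecializes φ₁ φ₂ v w) (h' : FracSpecializes φ₁ φ₂ v' w') :
    FracSpecializes φ₁ φ₂ (v * v') (w * w') := by
  obtain ⟨a, b, hb, rfl, rfl⟩ := h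
  obtain ⟨a', b', hb', rfl, rfl⟩ := h'
  exact ⟨a * a', b * b', by rw [map_mul]; exact mul_ne_zero hb hb',
    by rw [map_mul, map_mul, div_mul_div_comm], by rw [map_mul, map_mul, div_mul_div_comm]⟩

/-- The inclusion of kernels makes a denominator that survives under φ₂ nonzero under φ₁ as well, so
common denominators are legitimate on both sides. -/
theorem add (hφ : ∀ a, φ₁ a = 0 → φ₂ a = 0) (h : FracSpecializes φ₁ φ₂ v w) (h' : FracSpecializes φ₁ φ₂ v' w') :
    FracSpecializes φ₁ φ₂ (v + v') (w + w') := by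
  obtain ⟨a, b, hb, rfl, rfl⟩ := h
  obtain ⟨a', b', hb', rfl, rfl⟩ := h'
  refine ⟨a * b' + b * a', b * b', by rw [map_mul]; exact mul_ne_zero hb hb', ?_, ?_⟩
  · rw [div_add_div _ _ (mt (hφ b) hb) (mt (hφ b') hb')]; simp
  · rw [div_add_div _ _ hb hb']; simp

theorem inv (h : FracSpecializes φ₁ φ₂ v w) (hw : w ≠ 0) : FracSpecializes φ₁ φ₂ v⁻¹ w⁻¹ := by
  obtain ⟨a, b, hb, rfl, rfl⟩ := h
  exact ⟨b, a, fun h0 => hw (by rw [h0, zero_div]), by rw [inv_div], by rw [inv_div]⟩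

theorem eq_zero (hφ : ∀ a, φ₁ a = 0 → φ₂ a = 0) (h : FracSpecializes φ₁ φ₂ 0 w) : w = 0 := by
  obtain ⟨a, b, hb, h1, rfl⟩ := h
  rcases div_eq_zero_iff.1 h1.symm with h | h
  · rw [hφ a h, zero_div]
  · exact absurd (hφ b h) hb

theorem unique (hφ : ∀ a, φ₁ a = 0 → φ₂ a = 0) (h : FracSpecializes φ₁ φ₂ v w) (h' : FracSpecializes φ₁ φ₂ v w') : w = w' := by
  have := add hφ h h'.neg
  rw [add_neg_cancel] at this
  linear_combination eq_zero hφ this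

end FracSpecializes

/-- The graph of the partial map. -/
def specSubring (hφ : ∀ a, φ₁ a = 0 → φ₂ a = 0) : Subring (F₁ × F₂) where
  carrier := {x | FracSpecializes φ₁ φ₂ x.1 x.2}
  zero_mem' := .zero
  one_mem' := .one
  add_mem' h h' := FracSpecializes.add hφ h h'
  mul_mem' h h' := h.mul h'
  neg_mem' h := h.neg

/-- With inverses available, membership of a rational expression is checked factor by factor with
the subring lemmas; no common fraction has to be written down. -/
theorem inv_mem_specSubring {hφ : ∀ a, φ₁ a = 0 → φ₂ a = 0} {x : F₁ × F₂}
    (h : x ∈ specSubring φ₁ φ₂ hφ) (hx : x.2 ≠ 0) : x⁻¹ ∈ specSubring φ₁ φ₂ hφ :=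
  FracSpecializes.inv h hx

theorem zpow_mem_specSubring {hφ : ∀ a, φ₁ a = 0 → φ₂ a = 0} {x : F₁ × F₂}
    (h : x ∈ specSubring φ₁ φ₂ hφ) (hx : x.2 ≠ 0) (z : ℤ) :
    x ^ z ∈ specSubring φ₁ φ₂ hφ := by
  rcases z with z | z
  · rw [Int.ofNat_eq_natCast, zpow_natCast]; exact pow_mem h z
  · rw [zpow_negSucc]
    exact inv_mem_specSubring φ₁ φ₂ (pow_mem h (z + 1)) (pow_ne_zero _ hx)

/-- Laurent monomials specialize to the same monomials in the images. -/
theorem prod_zpow_mem_specSubring {hφ : ∀ a, φ₁ a = 0 → φ₂ a = 0} {σ : Type*} [Fintype σ]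
    (a : σ → A) (ha : ∀ s, φ₂ (a s) ≠ 0) (e : σ → ℤ) :
    (∏ s, φ₁ (a s) ^ e s, ∏ s, φ₂ (a s) ^ e s) ∈ specSubring φ₁ φ₂ hφ := by
  have := prod_mem (S := specSubring φ₁ φ₂ hφ) (t := Finset.univ)
    (f := fun s => (φ₁ (a s), φ₂ (a s)) ^ e s) fun s _ =>
    zpow_mem_specSubring φ₁ φ₂ (FracSpecializes.of_apply (a s)) (ha s) (e s)
  have h : (∏ s, φ₁ (a s) ^ e s, ∏ s, φ₂ (a s) ^ e s) =
      ∏ s, (φ₁ (a s), φ₂ (a s)) ^ e s :=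
    Prod.ext (by simp [Prod.fst_prod]) (by simp [Prod.snd_prod])
  rwa [h]

end Specialization

/-! ### Rational functions that can be reduced modulo p. -/

section Reduction

variable (p : ℕ) [Fact p.Prime] (m : ℕ)

/-- The map from integral polynomials to rational functions over `F`. -/
def intPoly (F : Type) [Field F] : MvPolynomial (Fin m) ℤ →+* RatFun (Fin m) F :=
  (algebraMap _ _).comp (MvPolynomial.map (Int.castRingHom F))

theorem intPoly_eq_zero (a : MvPolynomial (Fin m) ℤ) (h : intPoly m ℚ a = 0) :
    intPoly m (ZMod p) a = 0 := by
  have h1 : MvPolynomial.map (Int.castRingHom ℚ) a = 0 :=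
    FaithfulSMul.algebraMap_injective _ (RatFun (Fin m) ℚ) (h.trans (map_zero _).symm)
  rw [MvPolynomial.map_injective _ (RingHom.injective_int (Int.castRingHom ℚ))
    (h1.trans (map_zero _).symm), map_zero]

/-- The ring of the rational functions over `ℚ` that have a reduction modulo `p`, together with
this reduction. -/
abbrev IntegralRing : Subring (RatFun (Fin m) ℚ × RatFun (Fin m) (ZMod p)) :=
  specSubring (intPoly m ℚ) (intPoly m (ZMod p)) (intPoly_eq_zero p m)

variable {p m}

theorem mem_integralRing {x : RatFun (Fin m) ℚ × RatFun (Fin m) (ZMod p)}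
    (hx : x ∈ IntegralRing p m) : ReducesMod p x.1 x.2 := by
  obtain ⟨a, b, hb, h1, h2⟩ := hx
  exact ⟨a, b, fun h => hb (by rw [intPoly, RingHom.comp_apply, h, map_zero]), h1, h2⟩

theorem const_mem_integralRing (q : ℚ) (hq : ¬ p ∣ q.den) :
    (RatFun.constHom (Fin m) ℚ q, RatFun.constHom (Fin m) (ZMod p) (q : ZMod p)) ∈
      IntegralRing p m := by
  have hF : ∀ (F : Type) [Field F] (z : ℤ), intPoly m F (MvPolynomial.C z) =
      RatFun.constHom (Fin m) F (z : F) := by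
    intro F _ z; simp [intPoly, RatFun.constHom]
  have hden : ((q.den : ℤ) : ZMod p) ≠ 0 := by
    rw [Int.cast_natCast, Ne, ZMod.natCast_eq_zero_iff]; exact hq
  refine ⟨MvPolynomial.C q.num, MvPolynomial.C q.den, ?_, ?_, ?_⟩
  · rw [hF, Ne, map_eq_zero]; exact hden
  · rw [hF, hF, ← map_div₀, Int.cast_natCast, Rat.num_div_den]
  · rw [hF, hF, ← map_div₀, Int.cast_natCast, ← Rat.cast_def]

theorem mono_mem_integralRing (e : Fin m → ℤ) :
    (RatFun.mono ℚ e, RatFun.mono (ZMod p) e) ∈ IntegralRing p m := by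
  have hX : ∀ (F : Type) [Field F] (s : Fin m), intPoly m F (MvPolynomial.X s) =
      algebraMap (MvPolynomial (Fin m) F) (RatFun (Fin m) F) (MvPolynomial.X s) := by
    intro F _ s; simp [intPoly]
  have := prod_zpow_mem_specSubring (intPoly m ℚ) (intPoly m (ZMod p))
    (hφ := intPoly_eq_zero p m) MvPolynomial.X (fun s => by rw [hX]; exact RatFun.X_ne_zero s) e
  simp only [hX] at this
  exact this

/-- The inclusion of the ring of integral rational functions. -/
def toRat : IntegralRing p m →+* RatFun (Fin m) ℚ :=
  (RingHom.fst _ _).comp (IntegralRing p m).subtype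

/-- Reduction modulo `p`. -/
def toMod : IntegralRing p m →+* RatFun (Fin m) (ZMod p) :=
  (RingHom.snd _ _).comp (IntegralRing p m).subtype

/-- The reduction is determined by the rational component, so identities proved over ℚ lift to the
integral ring and may then be reduced modulo p. -/
theorem toRat_injective : Function.Injective (toRat (p := p) (m := m)) := by
  refine (injective_iff_map_eq_zero _).2 fun x hx => ?_
  have h1 : (x : RatFun (Fin m) ℚ × RatFun (Fin m) (ZMod p)).1 = 0 := hx
  have h2 : FracSpecializes (intPoly m ℚ) (intPoly m (ZMod p)) x.1.1 x.1.2 := x.2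
  rw [h1] at h2
  exact Subtype.ext (Prod.ext h1 (FracSpecializes.eq_zero (intPoly_eq_zero p m) h2))

/-- The ring behaves as a localization at (p): inverting both components stays inside it once the
reduction is nonzero. -/
theorem isUnit_of_toMod_ne_zero {x : IntegralRing p m} (hx : toMod x ≠ 0) : IsUnit x := by
  have h2 : (x : RatFun (Fin m) ℚ × RatFun (Fin m) (ZMod p)).2 ≠ 0 := hx
  have h1 : toRat x ≠ 0 := fun h => hx (by
    rw [toRat_injective (h.trans (map_zero _).symm), map_zero])
  refine IsUnit.of_mul_eq_one ⟨_, inv_mem_specSubring _ _ x.2 h2⟩ ?_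
  exact Subtype.ext (Prod.ext (mul_inv_cancel₀ h1) (mul_inv_cancel₀ h2))

end Reduction

/-! ### The limit at z = 1 as a coefficient of a power series. -/

section Limit

open PowerSeries

variable {m n N d : ℕ}

theorem zpow_finset_sum {G ι : Type*} [CommGroup G] (g : G) (s : Finset ι) (f : ι → ℤ) :
    g ^ (∑ i ∈ s, f i) = ∏ i ∈ s, g ^ f i := by
  classical
  induction s using Finset.induction_on with
  | empty => simp
  | insert a s ha ih => rw [Finset.sum_insert ha, Finset.prod_insert ha, zpow_add, ih]

/-- The exponent of `e^s` in `z ^ v` under the substitution `z_k = e ^ (a_k s)`. -/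
def dotInt {n : ℕ} (a v : Fin n → ℤ) : ℤ := ∑ k, a k * v k

/-- The substitution `z_k = E ^ (a_k)` in a polynomial, with `E` a power series. -/
def substSeries (E : (RatFun (Fin m) ℚ)⟦X⟧ˣ) (a : Fin n → ℤ) :
    MvPolynomial (Fin m ⊕ Fin n) ℚ →+* (RatFun (Fin m) ℚ)⟦X⟧ :=
  MvPolynomial.eval₂Hom (C.comp (RatFun.constHom (Fin m) ℚ))
    (Sum.elim (fun s => C (algebraMap (MvPolynomial (Fin m) ℚ) _ (MvPolynomial.X s))) fun k => ((E ^ a k : _ˣ) : _⟦X⟧))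

/-- At s = 0 every power of E equals 1. This is the only property of E that the limit needs. -/
theorem constantCoeff_substSeries (E : (RatFun (Fin m) ℚ)⟦X⟧ˣ)
    (hE : constantCoeff (E : (RatFun (Fin m) ℚ)⟦X⟧) = 1) (a : Fin n → ℤ)
    (P : MvPolynomial (Fin m ⊕ Fin n) ℚ) :
    constantCoeff (substSeries E a P) =
      algebraMap _ (RatFun (Fin m) ℚ) (ShortSum.atOne P) := by
  have hEu : Units.map (constantCoeff (R := RatFun (Fin m) ℚ)).toMonoidHom E = 1 :=
    Units.ext hE
  have hz : ∀ z : ℤ, constantCoeff ((E ^ z : _ˣ) : (RatFun (Fin m) ℚ)⟦X⟧) = 1 := by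
    intro z
    have := congrArg Units.val (map_zpow
      (Units.map (constantCoeff (R := RatFun (Fin m) ℚ)).toMonoidHom) E z)
    rw [hEu, one_zpow] at this
    exact this
  have : (constantCoeff (R := RatFun (Fin m) ℚ)).comp (substSeries E a) =
      (algebraMap (MvPolynomial (Fin m) ℚ) (RatFun (Fin m) ℚ)).comp
        (MvPolynomial.aeval (Sum.elim MvPolynomial.X fun _ : Fin n => 1)).toRingHom := by
    refine MvPolynomial.ringHom_ext (fun q => ?_) fun s => ?_
    · rw [RingHom.comp_apply, substSeries, MvPolynomial.coe_eval₂Hom, MvPolynomial.eval₂_C,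
        RingHom.comp_apply, constantCoeff_C, RingHom.comp_apply]
      exact congrArg (algebraMap (MvPolynomial (Fin m) ℚ) (RatFun (Fin m) ℚ))
        (MvPolynomial.aeval_C (Sum.elim MvPolynomial.X fun _ : Fin n => 1) q).symm
    · rcases s with s | k <;> simp [substSeries, hz]
  exact DFunLike.congr_fun this P

/-- The value of the limit, as a coefficient of a power series. -/
theorem coeff_eq_of_hasLimitAtOne (I : ShortSum m n N d) {V : RatFun (Fin m) ℚ}
    (hV : I.HasLimitAtOne V) (E : (RatFun (Fin m) ℚ)⟦X⟧ˣ)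
    (hE : constantCoeff (E : (RatFun (Fin m) ℚ)⟦X⟧) = 1) (a : Fin n → ℤ)
    (ε : Fin N → Fin d → ℕ) (u : Fin N → Fin d → (RatFun (Fin m) ℚ)⟦X⟧ˣ)
    (hε : ∀ i, ∑ j, ε i j ≤ d)
    (hu : ∀ i j, 1 - C (RatFun.mono ℚ (I.M i j)) * ((E ^ dotInt a (I.β i j) : _ˣ) : _⟦X⟧) =
      X ^ ε i j * (u i j : _⟦X⟧))
    (R : (RatFun (Fin m) ℚ)⟦X⟧)
    (hR : R = ∑ i, X ^ (d - ∑ j, ε i j) * (((I.num i).map fun τ =>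
      C (RatFun.constHom _ _ τ.coeff * RatFun.mono ℚ τ.xexp) *
        ((E ^ dotInt a τ.zexp : _ˣ) : (RatFun (Fin m) ℚ)⟦X⟧)).sum *
        (((∏ j, u i j)⁻¹ : _ˣ) : _⟦X⟧))) :
    (∀ k < d, coeff k R = 0) ∧ coeff d R = V := by
  obtain ⟨P, D, hD, hQ, hVeq⟩ := hV
  -- Single terms have poles at s = 0, so the substitution takes values in fractions of power
  -- series.
  let F := FractionRing (RatFun (Fin m) ℚ)⟦X⟧
  let ι : (RatFun (Fin m) ℚ)⟦X⟧ →+* F := algebraMap _ _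
  have hι : Function.Injective ι := FaithfulSMul.algebraMap_injective _ _
  have hιu : ∀ v : (RatFun (Fin m) ℚ)⟦X⟧ˣ, ι v ≠ 0 := fun v => (v.isUnit.map ι).ne_zero
  have hιX : ι X ≠ 0 := (map_ne_zero_iff ι hι).2 X_ne_zero
  have hD0 : constantCoeff (substSeries E a D) ≠ 0 := by
    rw [constantCoeff_substSeries E hE, Ne, FaithfulSMul.algebraMap_eq_zero_iff]
    exact hD
  have hD2 : substSeries E a D ≠ 0 := fun h => hD0 (by rw [h, map_zero])
  let φ₁ : MvPolynomial (Fin m ⊕ Fin n) ℚ →+* RatFun (Fin m ⊕ Fin n) ℚ := algebraMap _ _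
  let φ₂ : MvPolynomial (Fin m ⊕ Fin n) ℚ →+* F := ι.comp (substSeries E a)
  have hφ : ∀ b, φ₁ b = 0 → φ₂ b = 0 := fun b hb => by
    rw [(FaithfulSMul.algebraMap_eq_zero_iff _ _).1 hb, map_zero]
  have hφX : ∀ s, φ₂ (MvPolynomial.X s) = Sum.elim
      (fun s => ι (C (algebraMap (MvPolynomial (Fin m) ℚ) _ (MvPolynomial.X s)))) (fun k => ι ((E ^ a k : _ˣ) : _⟦X⟧))
      s := by
    intro s; rcases s with s | k <;> simp [φ₂, substSeries]
  have hX0 : ∀ s, φ₂ (MvPolynomial.X s) ≠ 0 := by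
    intro s
    rw [hφX]
    rcases s with s | k
    · exact (map_ne_zero_iff ι hι).2
        ((map_ne_zero_iff C C_injective).2 (RatFun.X_ne_zero s))
    · exact hιu _
  -- monomials
  have hmono : ∀ (e : Fin m → ℤ) (f : Fin n → ℤ),
      (RatFun.mono ℚ (Sum.elim e f), ι (C (RatFun.mono ℚ e) *
        ((E ^ dotInt a f : _ˣ) : _⟦X⟧))) ∈ specSubring φ₁ φ₂ hφ := by
    intro e f
    have := prod_zpow_mem_specSubring φ₁ φ₂ (hφ := hφ) MvPolynomial.X hX0 (Sum.elim e f)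
    have h2 : ι (C (RatFun.mono ℚ e) * ((E ^ dotInt a f : _ˣ) : _⟦X⟧)) =
        ∏ s, φ₂ (MvPolynomial.X s) ^ (Sum.elim e f s) := by
      rw [Fintype.prod_sum_type, map_mul]
      congr 1
      · rw [RatFun.mono, map_prod, map_prod]
        refine Finset.prod_congr rfl fun s _ => ?_
        rw [hφX]
        exact map_zpow₀ (ι.comp C) _ _
      · have h3 : E ^ dotInt a f = ∏ k, (E ^ a k) ^ f k := by
          rw [dotInt, zpow_finset_sum]
          exact Finset.prod_congr rfl fun k _ => zpow_mul _ _ _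
        rw [h3]
        rw [Units.coe_prod, map_prod]
        refine Finset.prod_congr rfl fun k _ => ?_
        rw [hφX]
        exact congrArg Units.val (map_zpow (Units.map ι.toMonoidHom) (E ^ a k) (f k)) |>.trans
          (Units.val_zpow_eq_zpow_val _ _)
    rw [h2]
    exact this
  -- both sides specialize
  have h1 : FracSpecializes φ₁ φ₂ I.Q (ι R / ι X ^ d) := by
    have hden : ∀ i j, (1 - RatFun.mono ℚ (Sum.elim (I.M i j) (I.β i j)),
        ι X ^ ε i j * ι (u i j)) ∈ specSubring φ₁ φ₂ hφ := by
      intro i j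
      have := sub_mem (one_mem _) (hmono (I.M i j) (I.β i j))
      rw [← map_pow, ← map_mul, ← hu, map_sub, map_one]
      exact this
    have hterm : ∀ i, (((I.num i).map fun τ => RatFun.const τ.coeff *
          RatFun.mono ℚ (Sum.elim τ.xexp τ.zexp)).sum,
        ι ((I.num i).map fun τ => C (RatFun.constHom _ _ τ.coeff * RatFun.mono ℚ τ.xexp) *
          ((E ^ dotInt a τ.zexp : _ˣ) : (RatFun (Fin m) ℚ)⟦X⟧)).sum) ∈ specSubring φ₁ φ₂ hφ := by
      intro i
      induction I.num i with
      | nil =>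
        simp only [List.map_nil, List.sum_nil, map_zero]
        exact zero_mem (specSubring φ₁ φ₂ hφ)
      | cons τ l ih =>
        have hc : (RatFun.const τ.coeff, ι (C (RatFun.constHom _ _ τ.coeff))) ∈
            specSubring φ₁ φ₂ hφ := by
          have h : φ₂ (MvPolynomial.C τ.coeff) = ι (C (RatFun.constHom _ _ τ.coeff)) := by
            rw [RingHom.comp_apply, substSeries, MvPolynomial.coe_eval₂Hom, MvPolynomial.eval₂_C]
            rfl
          rw [← h]
          exact FracSpecializes.of_apply _
        have := add_mem (mul_mem hc (hmono τ.xexp τ.zexp)) ih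
        rw [List.map_cons, List.sum_cons, List.map_cons, List.sum_cons, map_add]
        convert this using 1
        simp [mul_assoc]
    have hsum := sum_mem (S := specSubring φ₁ φ₂ hφ) (t := Finset.univ)
      fun i (_ : i ∈ Finset.univ) => mul_mem (hterm i) (inv_mem_specSubring φ₁ φ₂
        (prod_mem (t := Finset.univ) fun j _ => hden i j) (by
          rw [Prod.snd_prod]
          exact Finset.prod_ne_zero_iff.2 fun j _ =>
            mul_ne_zero (pow_ne_zero _ hιX) (hιu _)))
    change FracSpecializes φ₁ φ₂ _ _ at hsum
    convert hsum using 1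
    · rw [Prod.fst_sum, ShortSum.Q]
      refine Finset.sum_congr rfl fun i _ => ?_
      simp only [Prod.fst_mul, Prod.fst_inv, Prod.fst_prod, div_eq_mul_inv]
    · rw [Prod.snd_sum, hR, map_sum, Finset.sum_div]
      refine Finset.sum_congr rfl fun i _ => ?_
      simp only [Prod.snd_mul, Prod.snd_inv, Prod.snd_prod]
      rw [map_mul, map_mul, map_pow, Finset.prod_mul_distrib, Finset.prod_pow_eq_pow_sum,
        ← map_prod, ← Units.coe_prod]
      have h4 : ι X ^ d = ι X ^ (d - ∑ j, ε i j) * ι X ^ (∑ j, ε i j) := by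
        rw [← pow_add, Nat.sub_add_cancel (hε i)]
      have h5 : ι ((∏ j, u i j : _ˣ) : _⟦X⟧) * ι (((∏ j, u i j)⁻¹ : _ˣ) : _⟦X⟧) = 1 := by
        rw [← map_mul, Units.mul_inv, map_one]
      rw [h4, eq_inv_of_mul_eq_one_right h5]
      have hA : ι X ^ (d - ∑ j, ε i j) ≠ 0 := pow_ne_zero _ hιX
      rw [mul_div_mul_left _ _ hA, mul_inv, div_eq_mul_inv]
      ring
  have h2 : FracSpecializes φ₁ φ₂ I.Q (φ₂ P / φ₂ D) :=
    ⟨P, D, (map_ne_zero_iff ι hι).2 hD2, hQ, rfl⟩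
  have hD1 : φ₂ D ≠ 0 := (map_ne_zero_iff ι hι).2 hD2
  -- Q is substituted in two ways, term by term and as P/D; the results coincide.
  have h3 := FracSpecializes.unique hφ h1 h2
  rw [div_eq_div_iff (pow_ne_zero _ hιX) hD1] at h3
  have h4 : R * substSeries E a D = substSeries E a P * X ^ d := by
    apply hι
    rw [map_mul, map_mul, map_pow]
    exact h3
  -- This is where D(x;1) ≠ 0 cancels the poles: dividing by a unit series creates none, so s^d
  -- divides R.
  have hDu : IsUnit (substSeries E a D) := isUnit_iff_constantCoeff.2 (IsUnit.mk0 _ hD0)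
  obtain ⟨R', hR'⟩ : X ^ d ∣ R := by
    rw [← hDu.dvd_mul_right, h4]; exact dvd_mul_left _ _
  refine ⟨X_pow_dvd_iff.1 ⟨R', hR'⟩, ?_⟩
  have h5 : R' * substSeries E a D = substSeries E a P :=
    mul_left_cancel₀ (pow_ne_zero d (X_ne_zero (R := RatFun (Fin m) ℚ))) (by
      rw [← mul_assoc, ← hR', h4, mul_comm])
  have h6 := congrArg (constantCoeff (R := RatFun (Fin m) ℚ)) h5
  rw [map_mul, constantCoeff_substSeries E hE, constantCoeff_substSeries E hE] at h6
  rw [hVeq, eq_div_iff (by rwa [constantCoeff_substSeries E hE] at hD0), ← h6, hR']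
  have := coeff_X_pow_mul R' d 0
  rw [zero_add] at this
  rw [this, coeff_zero_eq_constantCoeff_apply]

end Limit

/-! ### The truncated exponential series with p-integral coefficients. -/

section IntegralSeries

open PowerSeries

variable {p m : ℕ} [Fact p.Prime]

/-- A rational number, as an element of the ring of integral rational functions. -/
def redConst (p m : ℕ) [Fact p.Prime] (q : ℚ) : IntegralRing p m :=
  if h : ¬ p ∣ q.den then ⟨_, const_mem_integralRing q h⟩ else 0

theorem toRat_redConst {q : ℚ} (h : ¬ p ∣ q.den) :
    toRat (redConst p m q) = RatFun.constHom _ _ q := by rw [redConst, dif_pos h]; rfl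

theorem toMod_redConst {q : ℚ} (h : ¬ p ∣ q.den) :
    toMod (redConst p m q) = RatFun.constHom _ _ (q : ZMod p) := by
  rw [redConst, dif_pos h]; rfl

/-- A monomial, as an element of the ring of integral rational functions. -/
def redMono (p : ℕ) [Fact p.Prime] {m : ℕ} (e : Fin m → ℤ) : IntegralRing p m :=
  ⟨_, mono_mem_integralRing e⟩

theorem toRat_redMono (e : Fin m → ℤ) : toRat (redMono p e) = RatFun.mono ℚ e := rfl

theorem toMod_redMono (e : Fin m → ℤ) : toMod (redMono p e) = RatFun.mono (ZMod p) e := rfl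

theorem redMono_zero : redMono p (0 : Fin m → ℤ) = 1 :=
  toRat_injective (by rw [toRat_redMono, RatFun.mono_zero, map_one])

/-- The exponential series up to `s ^ (p - 1)`, with integral coefficients. -/
def integralExp (p m : ℕ) [Fact p.Prime] : (IntegralRing p m)⟦X⟧ :=
  mk fun k => if k < p then redConst p m ((k.factorial : ℚ)⁻¹) else 0

/-- From degree p on both sides are 0, on the left by the cut-off and on the right because the
inverse of k! = 0 is 0 by convention. -/
theorem map_toMod_integralExp :
    map toMod (integralExp p m) = map (RatFun.constHom _ _) (truncExp p) := by
  have hp : p.Prime := Fact.out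
  ext k
  rw [coeff_map, coeff_map, integralExp, truncExp, coeff_mk, coeff_mk]
  split_ifs with hk
  · rw [toMod_redConst]
    · congr 1
      rw [Rat.cast_inv_nat]
    · rw [Rat.inv_natCast_den, if_neg (Nat.factorial_ne_zero k), hp.dvd_factorial]
      omega
  · have : ((k.factorial : ℕ) : ZMod p) = 0 := by
      rw [ZMod.natCast_eq_zero_iff, hp.dvd_factorial]; omega
    rw [this, inv_zero, map_zero, map_zero]

theorem constantCoeff_integralExp : constantCoeff (integralExp p m) = 1 := by
  rw [← coeff_zero_eq_constantCoeff_apply, integralExp, coeff_mk,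
    if_pos (Fact.out : p.Prime).pos]
  apply toRat_injective
  rw [toRat_redConst] <;> simp [(Fact.out : p.Prime).one_lt.ne']

/-- The truncated exponential series as a unit. -/
def expUnit (p m : ℕ) [Fact p.Prime] : (IntegralRing p m)⟦X⟧ˣ :=
  (isUnit_iff_constantCoeff.2 (constantCoeff_integralExp (p := p) (m := m) ▸ isUnit_one)).unit

theorem constantCoeff_expUnit_zpow (z : ℤ) :
    constantCoeff ((expUnit p m ^ z : _ˣ) : (IntegralRing p m)⟦X⟧) = 1 := by
  have hE : Units.map (constantCoeff (R := IntegralRing p m)).toMonoidHom (expUnit p m) = 1 :=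
    Units.ext constantCoeff_integralExp
  have := congrArg Units.val (map_zpow
    (Units.map (constantCoeff (R := IntegralRing p m)).toMonoidHom) (expUnit p m) z)
  rw [hE, one_zpow] at this
  exact this

/-- Below s^(p-1), E' = E is (k + 1)/(k + 1)! = 1/k!. In degree p - 1 it fails, since the truncated
series has no term s^p. -/
theorem truncExp_isLog : IsLog (p - 1) (truncExp p) X := by
  refine X_pow_dvd_sub_of_coeff_eq fun k hk => ?_
  have h0 : ((k + 1 : ℕ) : ZMod p) ≠ 0 := by
    rw [Ne, ZMod.natCast_eq_zero_iff]
    exact Nat.not_dvd_of_pos_of_lt (by omega) (by omega)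
  rw [coeff_derivative, derivative_X, one_mul, truncExp, coeff_mk, coeff_mk, Nat.factorial_succ,
    Nat.cast_mul, mul_inv]
  push_cast at h0 ⊢
  field_simp

/-- The powers of the truncated exponential series are truncated exponential series up to the
order `p`. -/
theorem expUnit_zpow_congr (z : ℤ) :
    X ^ p ∣ map toMod ((expUnit p m ^ z : _ˣ) : (IntegralRing p m)⟦X⟧) -
      rescale (RatFun.constHom _ _ (z : ZMod p)) (map (RatFun.constHom _ _) (truncExp p)) := by
  have hp : p.Prime := Fact.out
  let u : (RatFun (Fin m) (ZMod p))⟦X⟧ˣ := Units.map (map toMod).toMonoidHom (expUnit p m)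
  have hu : (u : (RatFun (Fin m) (ZMod p))⟦X⟧) = map (RatFun.constHom _ _) (truncExp p) :=
    map_toMod_integralExp
  have huz : ((u ^ z : _ˣ) : (RatFun (Fin m) (ZMod p))⟦X⟧) =
      map toMod ((expUnit p m ^ z : _ˣ) : (IntegralRing p m)⟦X⟧) :=
    (congrArg Units.val (map_zpow (Units.map (map toMod).toMonoidHom) (expUnit p m) z)).symm
  have hlog : IsLog (p - 1) (u : (RatFun (Fin m) (ZMod p))⟦X⟧) X := by
    have := (truncExp_isLog (p := p)).map (RatFun.constHom (Fin m) (ZMod p))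
    rwa [← hu, map_X] at this
  have h1 := hlog.zpow z
  have h2 := hlog.rescale (RatFun.constHom _ _ (z : ZMod p))
  have h3 : rescale (RatFun.constHom (Fin m) (ZMod p) (z : ZMod p)) X = (z : _⟦X⟧) * X := by
    rw [rescale_X, map_intCast, map_intCast]
  rw [h3, hu] at h2
  -- Both series have logarithm z s up to s^(p-1) and constant coefficient 1. Integration adds one
  -- order, which gives agreement modulo s^p.
  have h4 := h2.sub_dvd h1 (by rw [constantCoeff_rescale, constantCoeff_map_truncExp]) (by
    rw [huz, ← coeff_zero_eq_constantCoeff_apply, coeff_map, coeff_zero_eq_constantCoeff_apply,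
      constantCoeff_expUnit_zpow, map_one])
    (natCast_isUnit_of_lt (RatFun.constHom _ _) (by have := hp.pos; omega))
  rw [huz, Nat.sub_add_cancel hp.one_le] at h4
  rwa [dvd_sub_comm]

/-- A denominator factor `1 - e^{bs} t`, divided by `s` if `t = 1`. -/
def reducedFactor (p : ℕ) [Fact p.Prime] {m : ℕ} (t : Fin m → ℤ) (b : ZMod p) :
    (RatFun (Fin m) (ZMod p))⟦X⟧ :=
  if t = 0 then C (-RatFun.constHom _ _ b) *
    rescale (RatFun.constHom _ _ b) (map (RatFun.constHom _ _) (truncExpQuot p))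
  else 1 - C (RatFun.mono (ZMod p) t) *
    rescale (RatFun.constHom _ _ b) (map (RatFun.constHom _ _) (truncExp p))

theorem exists_unit_factor (t : Fin m → ℤ) (z : ℤ) (h : t = 0 → (z : ZMod p) ≠ 0) :
    ∃ u : (IntegralRing p m)⟦X⟧ˣ,
      1 - C (redMono p t) * ((expUnit p m ^ z : _ˣ) : (IntegralRing p m)⟦X⟧) =
        X ^ (if t = 0 then 1 else 0) * (u : (IntegralRing p m)⟦X⟧) ∧
      X ^ (p - 1) ∣ map toMod (u : (IntegralRing p m)⟦X⟧) - reducedFactor p t (z : ZMod p) := by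
  have hp : p.Prime := Fact.out
  set f := 1 - C (redMono p t) * ((expUnit p m ^ z : _ˣ) : (IntegralRing p m)⟦X⟧) with hf
  set φ := RatFun.constHom (Fin m) (ZMod p)
  set e := rescale (φ (z : ZMod p)) (map φ (truncExp p)) with he
  have hcongr : X ^ p ∣ map toMod f - (1 - C (RatFun.mono (ZMod p) t) * e) := by
    have h1 := (expUnit_zpow_congr (p := p) (m := m) z).mul_left (-C (RatFun.mono (ZMod p) t))
    convert h1 using 1
    rw [hf, map_sub, map_one, map_mul, map_C, toMod_redMono]
    ring
  have hunit : ∀ g : (IntegralRing p m)⟦X⟧, constantCoeff (map toMod g) ≠ 0 → IsUnit g := by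
    intro g hg
    refine isUnit_iff_constantCoeff.2 (isUnit_of_toMod_ne_zero ?_)
    rwa [← coeff_zero_eq_constantCoeff_apply, coeff_map, coeff_zero_eq_constantCoeff_apply] at hg
  by_cases ht : t = 0
  · subst ht
    have h0 : constantCoeff f = 0 := by
      rw [hf, map_sub, map_mul, map_one, constantCoeff_C, constantCoeff_expUnit_zpow,
        redMono_zero, one_mul, sub_self]
    obtain ⟨g, hg⟩ := X_dvd_iff.2 h0
    -- Cancelling the factor s lowers the precision from p to p - 1.
    have h1 : X ^ (p - 1) ∣ map toMod g - reducedFactor p (0 : Fin m → ℤ) (z : ZMod p) := by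
      have h2 : X ^ p = X ^ (p - 1) * (X : (RatFun (Fin m) (ZMod p))⟦X⟧) := by
        rw [← pow_succ, Nat.sub_add_cancel hp.one_le]
      have h3 : map toMod f - (1 - C (RatFun.mono (ZMod p) 0) * e) =
          (map toMod g - reducedFactor p (0 : Fin m → ℤ) (z : ZMod p)) * X := by
        have h4 := congrArg (rescale (φ (z : ZMod p)))
          (congrArg (map φ) (X_mul_truncExpQuot (p := p)))
        rw [map_mul, map_mul, map_X, rescale_X, map_sub, map_sub, map_one, map_one, ← he] at h4
        rw [hg, map_mul, map_X, reducedFactor, if_pos rfl, RatFun.mono_zero, map_one, map_neg]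
        linear_combination -h4
      rw [h3, h2] at hcongr
      exact (mul_dvd_mul_iff_right X_ne_zero).1 hcongr
    -- The constant coefficient of g reduces to -z, which is nonzero by validity.
    obtain ⟨u, hu⟩ := hunit g (by
      rcases Nat.eq_or_lt_of_le hp.two_le with h2 | h2
      all_goals
        rw [← coeff_zero_eq_constantCoeff_apply, coeff_eq_of_X_pow_dvd h1 (by omega),
          reducedFactor, if_pos rfl, coeff_C_mul, coeff_zero_eq_constantCoeff_apply,
          constantCoeff_rescale, constantCoeff_map_truncExpQuot, mul_one, neg_ne_zero,
          Ne, _root_.map_eq_zero]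
        exact h rfl)
    refine ⟨u, ?_, by rw [hu]; exact h1⟩
    rw [if_pos rfl, pow_one, hu, hg]
  · obtain ⟨u, hu⟩ := hunit f (by
      rw [← coeff_zero_eq_constantCoeff_apply, coeff_eq_of_X_pow_dvd hcongr hp.pos,
        coeff_zero_eq_constantCoeff_apply, map_sub, map_mul, map_one, constantCoeff_C, he,
        constantCoeff_rescale, constantCoeff_map_truncExp, mul_one]
      exact RatFun.one_sub_mono_ne_zero ht)
    refine ⟨u, by rw [if_neg ht, pow_zero, one_mul, hu], ?_⟩
    rw [hu, reducedFactor, if_neg ht]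
    exact (pow_dvd_pow X (Nat.sub_le p 1)).trans hcongr

end IntegralSeries

/-! ### From a term of the short sum to its generalized Todd form. -/

section Exponentials

variable {m n N d p : ℕ}

/-- Grouping only permutes the factors. With Φ arbitrary, the same statement later evaluates the
denominator, counts the factors and counts the poles. -/
theorem insertGroup_prod {M : Type*} [CommMonoid M] (Φ : (Fin m → ℤ) → ZMod p → M)
    (t : Fin m → ℤ) (b : ZMod p) (l : List ((Fin m → ℤ) × List (ZMod p))) :
    ((insertGroup t b l).val.map fun g => (g.2.map (Φ g.1)).prod).prod =
      Φ t b * (l.map fun g => (g.2.map (Φ g.1)).prod).prod := by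
  induction l with
  | nil => simp [insertGroup]
  | cons g l ih =>
    simp only [insertGroup, Timed.bind_val, Timed.op_val]
    by_cases h : g.1 = t
    · simp [h, mul_assoc]
    · simp [h, ih, mul_left_comm]

theorem insertGroup_forall {t : Fin m → ℤ} {b : ZMod p}
    {l : List ((Fin m → ℤ) × List (ZMod p))} (P : (Fin m → ℤ) × List (ZMod p) → Prop)
    (h : ∀ g ∈ l, P g) (h1 : P (t, [b])) (h2 : ∀ B, P (t, B) → P (t, b :: B)) :
    ∀ g ∈ (insertGroup t b l).val, P g := by
  induction l with
  | nil => simpa [insertGroup] using h1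
  | cons g l ih =>
    simp only [insertGroup, Timed.bind_val, Timed.op_val]
    have ih' := ih fun g' hg' => h g' (by simp [hg'])
    by_cases hg : g.1 = t
    · subst hg
      simp only [decide_true, if_true, Timed.pure_val, List.mem_cons]
      rintro g' (rfl | hg')
      · exact h2 _ (h _ (by simp))
      · exact h g' (by simp [hg'])
    · simp only [hg, decide_false, Bool.false_eq_true, if_false, Timed.bind_val, Timed.pure_val,
        List.mem_cons]
      rintro g' (rfl | hg')
      · exact h _ (by simp)
      · exact ih' g' hg'

variable [Fact p.Prime]

theorem innerMod_val (γ : Fin n → ZMod p) (v : Fin n → ℤ) :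
    (innerMod γ v).val = ∑ k, γ k * (v k : ZMod p) := by
  rw [innerMod, Timed.fold_val]
  simp only [Timed.bind_val, Timed.op_val]
  rw [List.foldl_add_eq (fun k => γ k * (v k : ZMod p)), zero_add, Fin.sum_univ_def]

namespace ShortSum

/-- The step of the loop in `toGTodd`. -/
def groupStep (I : ShortSum m n N d) (γ : Fin n → ZMod p) (i : Fin N) (G : GTodd p m)
    (j : Fin d) : Timed (GTodd p m) := do
  let b ← innerMod γ (I.β i j)
  let one ← op (decide (I.M i j = 0))
  if one then pure { G with B0 := b :: G.B0 }
  else do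
    let g ← insertGroup (I.M i j) b G.grp
    pure { G with grp := g }

theorem groupStep_val_of_eq (I : ShortSum m n N d) (γ : Fin n → ZMod p) (i : Fin N)
    (G : GTodd p m) (j : Fin d) (h : I.M i j = 0) :
    (I.groupStep γ i G j).val = { G with B0 := (innerMod γ (I.β i j)).val :: G.B0 } := by
  simp [groupStep, h]

theorem groupStep_val_of_ne (I : ShortSum m n N d) (γ : Fin n → ZMod p) (i : Fin N)
    (G : GTodd p m) (j : Fin d) (h : I.M i j ≠ 0) :
    (I.groupStep γ i G j).val =
      { G with grp := (insertGroup (I.M i j) (innerMod γ (I.β i j)).val G.grp).val } := by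
  simp [groupStep, h]

theorem fold_groupStep_L (I : ShortSum m n N d) (γ : Fin n → ZMod p) (i : Fin N)
    (l : List (Fin d)) (G : GTodd p m) : (Timed.fold (I.groupStep γ i) l G).val.L = G.L := by
  refine Timed.fold_invariant (fun G' : GTodd p m => G'.L = G.L) _ l G rfl fun j _ G' hG' => ?_
  by_cases h : I.M i j = 0
  · rw [groupStep_val_of_eq _ _ _ _ _ h]; exact hG'
  · rw [groupStep_val_of_ne _ _ _ _ _ h]; exact hG'

theorem fold_groupStep_prod {M : Type*} [CommMonoid M] (Φ : (Fin m → ℤ) → ZMod p → M)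
    (I : ShortSum m n N d) (γ : Fin n → ZMod p) (i : Fin N) (l : List (Fin d)) (G : GTodd p m) :
    ((Timed.fold (I.groupStep γ i) l G).val.B0.map (Φ 0)).prod *
      ((Timed.fold (I.groupStep γ i) l G).val.grp.map fun g => (g.2.map (Φ g.1)).prod).prod =
    (l.map fun j => Φ (I.M i j) (innerMod γ (I.β i j)).val).prod * ((G.B0.map (Φ 0)).prod *
      (G.grp.map fun g => (g.2.map (Φ g.1)).prod).prod) := by
  induction l generalizing G with
  | nil => simp [Timed.fold]
  | cons j l ih =>
    simp only [Timed.fold, Timed.bind_val] at ih ⊢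
    rw [ih, List.map_cons, List.prod_cons]
    by_cases h : I.M i j = 0
    · rw [groupStep_val_of_eq _ _ _ _ _ h, h]
      simp only [List.map_cons, List.prod_cons]
      ac_rfl
    · rw [groupStep_val_of_ne _ _ _ _ _ h]
      simp only [insertGroup_prod]
      ac_rfl

theorem toGTodd_val (I : ShortSum m n N d) (γ : Fin n → ZMod p) (i : Fin N) :
    (I.toGTodd γ i).val = (Timed.fold (I.groupStep γ i) (List.finRange d)
      ⟨(I.num i).map fun τ => ⟨(τ.coeff : ZMod p), τ.xexp, (innerMod γ τ.zexp).val⟩,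
        [], []⟩).val := by
  rw [toGTodd]
  simp only [Timed.bind_val, Timed.mapL_val]
  rfl

variable (I : ShortSum m n N d) (γ : Fin n → ZMod p) (i : Fin N)

theorem toGTodd_L : (I.toGTodd γ i).val.L =
    (I.num i).map fun τ => ⟨(τ.coeff : ZMod p), τ.xexp, (innerMod γ τ.zexp).val⟩ := by
  rw [toGTodd_val, fold_groupStep_L]

theorem toGTodd_prod {M : Type*} [CommMonoid M] (Φ : (Fin m → ℤ) → ZMod p → M) :
    ((I.toGTodd γ i).val.B0.map (Φ 0)).prod *
      ((I.toGTodd γ i).val.grp.map fun g => (g.2.map (Φ g.1)).prod).prod =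
    ∏ j, Φ (I.M i j) (innerMod γ (I.β i j)).val := by
  rw [toGTodd_val, fold_groupStep_prod, Fin.prod_univ_def]
  simp

theorem toGTodd_grp_ne_zero : ∀ g ∈ (I.toGTodd γ i).val.grp, g.1 ≠ 0 ∧ g.2 ≠ [] := by
  rw [toGTodd_val]
  refine Timed.fold_invariant (fun G : GTodd p m => ∀ g ∈ G.grp, g.1 ≠ 0 ∧ g.2 ≠ []) _ _ _
    (by simp) fun j _ G hG => ?_
  by_cases h : I.M i j = 0
  · rw [groupStep_val_of_eq _ _ _ _ _ h]; exact hG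
  · rw [groupStep_val_of_ne _ _ _ _ _ h]
    exact insertGroup_forall _ hG ⟨h, by simp⟩ fun B hB => ⟨h, by simp⟩

theorem toGTodd_B0_mem : ∀ b ∈ (I.toGTodd γ i).val.B0,
    ∃ j, I.M i j = 0 ∧ b = (innerMod γ (I.β i j)).val := by
  rw [toGTodd_val]
  refine Timed.fold_invariant (fun G : GTodd p m => ∀ b ∈ G.B0,
    ∃ j, I.M i j = 0 ∧ b = (innerMod γ (I.β i j)).val) _ _ _ (by simp) fun j _ G hG => ?_
  by_cases h : I.M i j = 0
  · rw [groupStep_val_of_eq _ _ _ _ _ h]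
    rintro b hb
    rcases List.mem_cons.1 hb with rfl | hb
    · exact ⟨j, h, rfl⟩
    · exact hG b hb
  · rw [groupStep_val_of_ne _ _ _ _ _ h]; exact hG

theorem toGTodd_length : (I.toGTodd γ i).val.B0.length +
    ((I.toGTodd γ i).val.grp.map fun g => g.2.length).sum = d := by
  -- A product in `Multiplicative ℕ` is a count, here of all factors.
  have := I.toGTodd_prod γ i (fun _ _ => Multiplicative.ofAdd 1)
  have h2 := congrArg Multiplicative.toAdd this
  simpa [List.map_const', toAdd_list_sum, Function.comp_def] using h2

theorem toGTodd_B0_length : (I.toGTodd γ i).val.B0.length =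
    ∑ j, if I.M i j = 0 then 1 else 0 := by
  have := I.toGTodd_prod γ i (fun t _ => Multiplicative.ofAdd (if t = 0 then 1 else 0))
  have h1 : ((I.toGTodd γ i).val.grp.map fun g => (g.2.map
      (fun _ => Multiplicative.ofAdd (if g.1 = 0 then 1 else 0))).prod).prod = 1 := by
    refine List.prod_eq_one fun x hx => ?_
    obtain ⟨g, hg, rfl⟩ := List.mem_map.1 hx
    simp [(I.toGTodd_grp_ne_zero γ i g hg).1]
  rw [h1, mul_one] at this
  have h2 := congrArg Multiplicative.toAdd this
  simpa using h2

/-- Groups are never empty, so there are at most as many variables y_i as factors with t ≠ 1. The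
time bound relies on this. -/
theorem toGTodd_grp_length_le : (I.toGTodd γ i).val.grp.length ≤
    ((I.toGTodd γ i).val.grp.map fun g => g.2.length).sum := by
  have h := I.toGTodd_grp_ne_zero γ i
  generalize (I.toGTodd γ i).val.grp = l at h
  induction l with
  | nil => simp
  | cons g l ih =>
    have h1 := ih fun g' hg' => h g' (by simp [hg'])
    have h2 := List.length_pos_iff.2 (h g (by simp)).2
    simp only [List.length_cons, List.map_cons, List.sum_cons]
    omega

end ShortSum
end Exponentials

/-! ### The output is the reduction of the limit. -/

section Correctness

open PowerSeries

variable {m n N d p : ℕ} [Fact p.Prime]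

theorem dvd_finset_prod_sub_prod {R ι : Type*} [CommRing R] (a : R) (s : Finset ι) (f g : ι → R)
    (h : ∀ i ∈ s, a ∣ f i - g i) : a ∣ ∏ i ∈ s, f i - ∏ i ∈ s, g i := by
  classical
  induction s using Finset.induction_on with
  | empty => simp
  | insert j s hj ih =>
    rw [Finset.prod_insert hj, Finset.prod_insert hj]
    have h1 := h j (by simp)
    have h2 := ih fun i hi => h i (by simp [hi])
    have : f j * ∏ i ∈ s, f i - g j * ∏ i ∈ s, g i =
        (f j - g j) * ∏ i ∈ s, f i + g j * (∏ i ∈ s, f i - ∏ i ∈ s, g i) := by ring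
    rw [this]
    exact dvd_add (h1.mul_right _) (h2.mul_left _)

theorem dvd_list_sum_sub_sum {R α : Type*} [CommRing R] (a : R) (l : List α) (f g : α → R)
    (h : ∀ i ∈ l, a ∣ f i - g i) : a ∣ (l.map f).sum - (l.map g).sum := by
  induction l with
  | nil => simp
  | cons j l ih =>
    rw [List.map_cons, List.map_cons, List.sum_cons, List.sum_cons, add_sub_add_comm]
    exact dvd_add (h j (by simp)) (ih fun i hi => h i (by simp [hi]))

namespace ShortSum

/-- The number of denominator factors of a term that vanish at `s = 0`. -/
def poleOrder (I : ShortSum m n N d) (i : Fin N) : ℕ := ∑ j, if I.M i j = 0 then 1 else 0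

theorem poleOrder_le (I : ShortSum m n N d) (i : Fin N) : I.poleOrder i ≤ d := by
  refine (Finset.sum_le_card_nsmul Finset.univ _ 1 fun j _ => ?_).trans (by simp)
  split_ifs <;> simp

theorem sum_poleOrder (I : ShortSum m n N d) : ∑ i, I.poleOrder i = I.S.card := by
  rw [S, Finset.card_filter, ← Finset.univ_product_univ, Finset.sum_product]
  rfl

/-- The pole orders of all terms add up to |S|, so each is less than p; validity keeps 0 out of B_0.
-/
theorem suitable (I : ShortSum m n N d) (γ : Fin n → ZMod p) (hS : I.S.card < p)
    (hγ : I.Valid p γ) (i : Fin N) : (I.toGTodd γ i).val.Suitable := by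
  refine ⟨?_, fun h0 => ?_⟩
  · rw [toGTodd_B0_length]
    refine lt_of_le_of_lt ?_ hS
    rw [← sum_poleOrder]
    exact Finset.single_le_sum (f := I.poleOrder) (fun _ _ => Nat.zero_le _) (Finset.mem_univ i)
  · obtain ⟨j, hj, h⟩ := I.toGTodd_B0_mem γ i 0 h0
    rw [innerMod_val] at h
    exact hγ (i, j) (by simp [S, hj]) h.symm

variable (I : ShortSum m n N d) (γ : Fin n → ZMod p)

/-- The numerator of a term after the substitution. -/
def integralNum (i : Fin N) : (IntegralRing p m)⟦X⟧ :=
  ((I.num i).map fun τ => C (redConst p m τ.coeff * redMono p τ.xexp) *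
    ((expUnit p m ^ dotInt (fun k => ((γ k).val : ℤ)) τ.zexp : _ˣ) : (IntegralRing p m)⟦X⟧)).sum

theorem cast_dotInt (v : Fin n → ℤ) :
    (dotInt (fun k => ((γ k).val : ℤ)) v : ZMod p) = (innerMod γ v).val := by
  rw [innerMod_val, dotInt]
  push_cast
  simp

theorem numSeries_congr (hden : ∀ i, ∀ τ ∈ I.num i, ¬ p ∣ τ.coeff.den) (i : Fin N) :
    X ^ p ∣ map toMod (I.integralNum γ i) - (I.toGTodd γ i).val.numSeries := by
  rw [integralNum, GTodd.numSeries, toGTodd_L, map_list_sum, List.map_map, List.map_map]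
  refine dvd_list_sum_sub_sum _ _ _ _ fun τ hτ => ?_
  have := (expUnit_zpow_congr (p := p) (m := m)
    (dotInt (fun k => ((γ k).val : ℤ)) τ.zexp)).mul_left
    (C (RatFun.const (τ.coeff : ZMod p) * RatFun.mono (ZMod p) τ.xexp))
  convert this using 1
  simp only [Function.comp, map_mul (map toMod), map_C]
  rw [map_mul toMod, toMod_redConst (hden i τ hτ), toMod_redMono, ← cast_dotInt, mul_sub]
  rfl

theorem prod_reducedFactor (i : Fin N) :
    ∏ j, reducedFactor p (I.M i j) (innerMod γ (I.β i j)).val =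
      (I.toGTodd γ i).val.denSeries := by
  rw [← toGTodd_prod I γ i (reducedFactor p), GTodd.denSeries]
  congr 1
  · exact congrArg List.prod (List.map_congr_left fun b _ => by rw [reducedFactor, if_pos rfl])
  · refine congrArg List.prod (List.map_congr_left fun g hg => congrArg List.prod
      (List.map_congr_left fun b _ => ?_))
    rw [reducedFactor, if_neg (I.toGTodd_grp_ne_zero γ i g hg).1]

/-- The sum of the constant terms found by the algorithm is the reduction of the limit. -/
theorem reducesMod_sum (hS : I.S.card < p) {V : RatFun (Fin m) ℚ} (hV : I.HasLimitAtOne V)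
    (hden : ∀ i, ∀ τ ∈ I.num i, ¬ p ∣ τ.coeff.den) (hγ : I.Valid p γ) :
    ReducesMod p V
      (∑ i, ((I.toGTodd γ i).val.ctGTodd.val.map SimpleFrac.value).sum) := by
  -- Powers of E need integer exponents; modulo p and s^p only their residues matter.
  set a : Fin n → ℤ := fun k => ((γ k).val : ℤ) with ha
  have hex : ∀ i j, ∃ u : (IntegralRing p m)⟦X⟧ˣ,
      1 - C (redMono p (I.M i j)) *
          ((expUnit p m ^ dotInt a (I.β i j) : _ˣ) : (IntegralRing p m)⟦X⟧) =
        X ^ (if I.M i j = 0 then 1 else 0) * (u : (IntegralRing p m)⟦X⟧) ∧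
      X ^ (p - 1) ∣ map toMod (u : (IntegralRing p m)⟦X⟧) -
        reducedFactor p (I.M i j) (dotInt a (I.β i j) : ZMod p) := fun i j =>
    exists_unit_factor _ _ fun h => by
      rw [cast_dotInt, innerMod_val]
      exact hγ (i, j) (by simp [S, h])
  choose u hu1 hu2 using hex
  set T : Fin N → (IntegralRing p m)⟦X⟧ := fun i =>
    I.integralNum γ i * (((∏ j, u i j)⁻¹ : _ˣ) : (IntegralRing p m)⟦X⟧) with hT
  -- R is s^d times the substituted sum: no term has more than d poles, so this clears them all and
  -- keeps the coefficients integral.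
  set R : (IntegralRing p m)⟦X⟧ := ∑ i, X ^ (d - I.poleOrder i) * T i with hR
  have hRat := coeff_eq_of_hasLimitAtOne I hV (Units.map (map toRat).toMonoidHom (expUnit p m))
    (by
      have := congrArg toRat (constantCoeff_integralExp (p := p) (m := m))
      rw [map_one, ← coeff_zero_eq_constantCoeff_apply] at this
      rw [← coeff_zero_eq_constantCoeff_apply, ← this]
      exact coeff_map _ _ _) a (fun i j => if I.M i j = 0 then 1 else 0)
    (fun i j => Units.map (map toRat).toMonoidHom (u i j)) I.poleOrder_le (fun i j => by
      have := congrArg (map (toRat (p := p) (m := m))) (hu1 i j)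
      rw [map_sub, map_mul, map_mul, map_one, map_C, toRat_redMono, map_pow, map_X] at this
      rw [← map_zpow]
      exact this) (map toRat R) (by
      rw [hR, map_sum]
      refine Finset.sum_congr rfl fun i _ => ?_
      rw [map_mul, map_pow, map_X, hT, map_mul, ← map_prod, ← map_inv, integralNum, map_list_sum,
        List.map_map]
      congr 3
      refine List.map_congr_left fun τ hτ => ?_
      simp only [Function.comp, map_mul (map toRat), map_C]
      rw [map_mul toRat, toRat_redConst (hden i τ hτ), toRat_redMono, ← map_zpow]
      rfl)
  have hlow : ∀ k < d, coeff k R = 0 := fun k hk => toRat_injective (by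
    rw [map_zero, ← coeff_map, hRat.1 k hk])
  -- The extreme case: with |S| ≤ p - 1 no other term has a pole. The most singular coefficient of R
  -- therefore comes from this term alone and must vanish by `hlow`. Up to a unit it is the
  -- numerator at s = 0.
  have hTlow : ∀ i, I.poleOrder i + 1 = p → constantCoeff (I.integralNum γ i) = 0 := by
    intro i hi
    have hp := (Fact.out : p.Prime).two_le
    have hother : ∀ i' ≠ i, I.poleOrder i' = 0 := by
      intro i' hne
      have h1 : I.poleOrder i + I.poleOrder i' ≤ I.S.card := by
        rw [← sum_poleOrder, ← Finset.sum_pair hne.symm]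
        exact Finset.sum_le_sum_of_subset (Finset.subset_univ _)
      omega
    have hd := I.poleOrder_le i
    have h1 := hlow (d - I.poleOrder i) (by omega)
    rw [hR, map_sum, Finset.sum_eq_single i] at h1
    · have h2 := coeff_X_pow_mul (T i) (d - I.poleOrder i) 0
      rw [zero_add] at h2
      rw [h2, coeff_zero_eq_constantCoeff_apply, hT, map_mul] at h1
      exact ((((∏ j, u i j)⁻¹ : _ˣ).isUnit.map
        (constantCoeff (R := IntegralRing p m))).mul_left_eq_zero).1 h1
    · intro i' _ hne
      rw [hother i' hne, Nat.sub_zero]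
      exact X_pow_dvd_iff.1 (dvd_mul_right _ _) _ (by omega)
    · exact fun h => absurd (Finset.mem_univ i) h
  have hmod : ∀ i, ((I.toGTodd γ i).val.ctGTodd.val.map SimpleFrac.value).sum =
      toMod (coeff (I.poleOrder i) (T i)) := by
    intro i
    have hlen : (I.toGTodd γ i).val.B0.length = I.poleOrder i := toGTodd_B0_length I γ i
    rw [GTodd.ctGTodd_sum_value _ (I.suitable γ hS hγ i)
      (fun g hg => (I.toGTodd_grp_ne_zero γ i g hg).1)
      (map toMod (I.integralNum γ i)) (map toMod (((∏ j, u i j) : _ˣ) : (IntegralRing p m)⟦X⟧))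
      (map toMod (((∏ j, u i j)⁻¹ : _ˣ) : (IntegralRing p m)⟦X⟧))
      (I.numSeries_congr γ hden i) ?_ ?_ ?_, hlen, ← map_mul, coeff_map]
    · rw [← prod_reducedFactor, Units.coe_prod, map_prod]
      refine dvd_finset_prod_sub_prod _ _ _ _ fun j _ => ?_
      rw [← cast_dotInt]
      exact hu2 i j
    · rw [← map_mul, Units.mul_inv, map_one]
    · intro h
      have := congrArg toMod (hTlow i (by omega))
      rw [← coeff_zero_eq_constantCoeff_apply, ← coeff_map, map_zero,
        coeff_zero_eq_constantCoeff_apply] at this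
      exact this
  -- A single element of the integral ring: its rational component is the limit, and its reduction
  -- is the sum of the computed constant terms.
  have hfinal := mem_integralRing (coeff d R).2
  have h1 : (coeff d R).1.1 = V := by
    rw [← hRat.2, coeff_map]; rfl
  have h2 : (coeff d R).1.2 =
      ∑ i, ((I.toGTodd γ i).val.ctGTodd.val.map SimpleFrac.value).sum := by
    change toMod (coeff d R) = _
    rw [hR, map_sum, map_sum]
    refine Finset.sum_congr rfl fun i _ => ?_
    rw [hmod]
    congr 1
    have h3 := coeff_X_pow_mul (T i) (d - I.poleOrder i) (I.poleOrder i)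
    rwa [Nat.add_sub_cancel' (I.poleOrder_le i)] at h3
  rwa [h1, h2] at hfinal

end ShortSum

end Correctness

/-! ### Random draws and the search for a valid vector. -/

section Draws

variable {m n N d p : ℕ} [Fact p.Prime]

namespace ShortSum

variable (I : ShortSum m n N d)

theorem checkValid_val (γ : Fin n → ZMod p) : (I.checkValid γ).val = true ↔ I.Valid p γ := by
  have key : ∀ (l : List (Fin N × Fin d)) (ok : Bool),
      (Timed.fold (fun ok (ij : Fin N × Fin d) => do
        let one ← op (decide (I.M ij.1 ij.2 = 0))
        if one then do
          let b ← innerMod γ (I.β ij.1 ij.2)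
          op (ok && decide (b ≠ 0))
        else pure ok) l ok).val = true ↔ ok = true ∧ ∀ ij ∈ l, I.M ij.1 ij.2 = 0 →
          ∑ k, γ k * (I.β ij.1 ij.2 k : ZMod p) ≠ 0 := by
    intro l
    induction l with
    | nil => simp [Timed.fold]
    | cons ij l ih =>
      intro ok
      simp only [Timed.fold, Timed.bind_val, Timed.op_val] at ih ⊢
      rw [ih]
      by_cases h : I.M ij.1 ij.2 = 0
      · simp [h, innerMod_val, and_assoc]
      · simp [h]
  rw [checkValid, key]
  simp [Valid, S]

/-- Per factor: 3n for the inner product, one comparison and one zero test; 3n + 2 ≤ 5n as n ≥ 1. -/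
theorem checkValid_time_le (hn : 1 ≤ n) (γ : Fin n → ZMod p) :
    (I.checkValid γ).time ≤ N * d * (5 * n) := by
  have hin : ∀ v : Fin n → ℤ, (innerMod γ v).time ≤ n * 3 := fun v => by
    have := Timed.fold_time_le' 3 (fun acc k => do
      let b ← op ((v k : ℤ) : ZMod p)
      let c ← op (γ k * b)
      op (acc + c)) (List.finRange n) 0 fun _ _ _ => by simp
    rwa [List.length_finRange] at this
  have := Timed.fold_time_le' (5 * n) (fun ok (ij : Fin N × Fin d) => do
    let one ← op (decide (I.M ij.1 ij.2 = 0))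
    if one then do
      let b ← innerMod γ (I.β ij.1 ij.2)
      op (ok && decide (b ≠ 0))
    else pure ok) (List.finRange N ×ˢ List.finRange d) true fun ij _ s => by
      have := hin (I.β ij.1 ij.2)
      by_cases h : I.M ij.1 ij.2 = 0
      · simp [h]; omega
      · simp [h]; omega
  rwa [List.length_product, List.length_finRange, List.length_finRange] at this

theorem findValid_val_some {l : List (Fin n → ZMod p)} {γ : Fin n → ZMod p}
    (h : (I.findValid l).val = some γ) : I.Valid p γ := by
  induction l with
  | nil => simp [findValid] at h
  | cons γ₀ l ih =>
    simp only [findValid, Timed.bind_val] at h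
    by_cases hv : (I.checkValid γ₀).val = true
    · rw [if_pos hv] at h
      simp only [Timed.pure_val, Option.some.injEq] at h
      exact h ▸ (I.checkValid_val γ₀).1 hv
    · rw [if_neg hv] at h
      exact ih h

theorem findValid_cons_val_none {l : List (Fin n → ZMod p)} {γ₀ : Fin n → ZMod p} :
    (I.findValid (γ₀ :: l)).val = none ↔ ¬ I.Valid p γ₀ ∧ (I.findValid l).val = none := by
  simp only [findValid, Timed.bind_val]
  rw [← checkValid_val]
  by_cases hv : (I.checkValid γ₀).val = true
  · simp [hv]
  · simp [hv]

-- The recursive shape is the one that `sum_ofFn_succ_le` averages. The constant 6 is 5 for the test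
-- plus 1 for drawing n random elements, with n ≤ N d n.
open Classical in
theorem findValid_cons_time_le (hn : 1 ≤ n) (hN : 1 ≤ N) (hd : 1 ≤ d) (l : List (Fin n → ZMod p))
    (γ₀ : Fin n → ZMod p) : (I.findValid (γ₀ :: l)).time ≤
      6 * (N * d * n) + if I.Valid p γ₀ then 0 else (I.findValid l).time := by
  have h1 := I.checkValid_time_le hn γ₀
  have h2 : n ≤ N * d * n := Nat.le_mul_of_pos_left n (Nat.mul_pos hN hd)
  have h3 : N * d * (5 * n) = 5 * (N * d * n) := by ring
  simp only [findValid, Timed.bind_time]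
  rw [← checkValid_val]
  by_cases hv : (I.checkValid γ₀).val = true
  · simp only [hv, if_true, Timed.pure_time]; omega
  · simp only [hv, if_false, Bool.false_eq_true]; omega

theorem findValid_time_le (hn : 1 ≤ n) (hN : 1 ≤ N) (hd : 1 ≤ d) (l : List (Fin n → ZMod p)) :
    (I.findValid l).time ≤ l.length * (6 * (N * d * n)) := by
  classical
  induction l with
  | nil => simp [findValid]
  | cons γ₀ l ih =>
    have := I.findValid_cons_time_le hn hN hd l γ₀
    rw [List.length_cons, add_mul, one_mul]
    split_ifs at this <;> omega

theorem process_val (l : List (Fin n → ZMod p)) : (I.process l).val =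
    (I.findValid l).val.map fun γ =>
      ((List.finRange N).map fun i => (I.toGTodd γ i).val.ctGTodd.val).flatten := by
  simp only [process, Timed.bind_val]
  rcases (I.findValid l).val with _ | γ
  · rfl
  · simp [Timed.mapL_val]

theorem process_time (l : List (Fin n → ZMod p)) : (I.process l).time =
    (I.findValid l).time + (I.findValid l).val.elim 0 fun γ =>
      (Timed.mapL (fun i => do
        let G ← I.toGTodd γ i
        G.ctGTodd) (List.finRange N)).time := by
  simp only [process, Timed.bind_time]
  rcases (I.findValid l).val with _ | γ
  · rfl
  · simp

theorem process_reducesMod (hS : I.S.card < p) {V : RatFun (Fin m) ℚ} (hV : I.HasLimitAtOne V)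
    (hden : ∀ i, ∀ τ ∈ I.num i, ¬ p ∣ τ.coeff.den) (l : List (Fin n → ZMod p))
    (out : List (SimpleFrac p m)) (h : (I.process l).val = some out) :
    ReducesMod p V (out.map SimpleFrac.value).sum := by
  rw [process_val, Option.map_eq_some_iff] at h
  obtain ⟨γ, hγ, rfl⟩ := h
  have := I.reducesMod_sum γ hS hV hden (I.findValid_val_some hγ)
  rw [List.map_flatten, List.sum_flatten, List.map_map, List.map_map]
  rw [Fin.sum_univ_def] at this
  exact this

/-! ### Counting -/

/-- A nontrivial linear equation over `ZMod p` holds for a fraction `1 / p` of all vectors. -/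
theorem card_hyperplane (v : Fin n → ZMod p) (hv : ∃ k, v k ≠ 0) :
    p * Nat.card {γ : Fin n → ZMod p // ∑ k, γ k * v k = 0} = p ^ n := by
  let f : (Fin n → ZMod p) →+ ZMod p :=
    { toFun := fun γ => ∑ k, γ k * v k
      map_zero' := by simp
      map_add' := fun γ γ' => by simp [add_mul, Finset.sum_add_distrib] }
  have hf : Function.Surjective f := by
    intro b
    obtain ⟨k, hk⟩ := hv
    -- The linear form is onto, so its kernel, the hyperplane, has index p.
    refine ⟨Pi.single k (b * (v k)⁻¹), ?_⟩
    change ∑ j, (Pi.single k (b * (v k)⁻¹) : Fin n → ZMod p) j * v j = b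
    rw [Finset.sum_eq_single k (fun j _ hj => by simp [hj]) (by simp), Pi.single_eq_same,
      mul_assoc, inv_mul_cancel₀ hk, mul_one]
  have h1 : Nat.card ((Fin n → ZMod p) ⧸ f.ker) = p := by
    rw [Nat.card_congr (QuotientAddGroup.quotientKerEquivOfSurjective f hf).toEquiv, Nat.card_zmod]
  have h2 := AddSubgroup.card_eq_card_quotient_mul_card_addSubgroup f.ker
  rw [h1, Nat.card_eq_fintype_card (α := Fin n → ZMod p), Fintype.card_fun, ZMod.card,
    Fintype.card_fin] at h2
  rw [h2]
  rfl

/-- Union bound over the hyperplanes orthogonal to the vectors of S. -/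
theorem mul_card_invalid_le (hβ : ∀ ij ∈ I.S, ∃ k, ¬ (p : ℤ) ∣ I.β ij.1 ij.2 k) :
    p * {γ : Fin n → ZMod p | ¬ I.Valid p γ}.ncard ≤ I.S.card * p ^ n := by
  have hsub : {γ : Fin n → ZMod p | ¬ I.Valid p γ} ⊆
      ⋃ ij ∈ I.S, {γ : Fin n → ZMod p | ∑ k, γ k * (I.β ij.1 ij.2 k : ZMod p) = 0} := by
    intro γ hγ
    simp only [Set.mem_ofPred_eq, Valid, not_forall, not_not] at hγ
    obtain ⟨ij, hij, h⟩ := hγ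
    exact Set.mem_biUnion hij h
  have h1 := (Set.ncard_le_ncard hsub (Set.toFinite _)).trans
    (Finset.set_ncard_biUnion_le I.S _)
  refine (Nat.mul_le_mul_left p h1).trans ?_
  rw [Finset.mul_sum]
  refine (Finset.sum_le_card_nsmul _ _ (p ^ n) fun ij hij => le_of_eq ?_).trans_eq (smul_eq_mul _ _)
  obtain ⟨k, hk⟩ := hβ ij hij
  exact card_hyperplane (fun k => (I.β ij.1 ij.2 k : ZMod p))
    ⟨k, by rwa [Ne, ZMod.intCast_zmod_eq_zero_iff_dvd]⟩

theorem ncard_invalid_le {c : ℝ} (hc : 1 < c) (hp : c * (I.S.card : ℝ) ≤ p)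
    (hβ : ∀ ij ∈ I.S, ∃ k, ¬ (p : ℤ) ∣ I.β ij.1 ij.2 k) :
    ({γ : Fin n → ZMod p | ¬ I.Valid p γ}.ncard : ℝ) ≤ 1 / c * (p : ℝ) ^ n := by
  have h0 : (0 : ℝ) < p := by exact_mod_cast (Fact.out : p.Prime).pos
  have h1 : (p : ℝ) * ({γ : Fin n → ZMod p | ¬ I.Valid p γ}.ncard : ℝ) ≤
      I.S.card * (p : ℝ) ^ n := by exact_mod_cast I.mul_card_invalid_le hβ
  have h2 : c * ((I.S.card : ℝ) * (p : ℝ) ^ n) ≤ p * (p : ℝ) ^ n := by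
    rw [← mul_assoc]; exact mul_le_mul_of_nonneg_right hp (by positivity)
  rw [one_div, inv_mul_eq_div, le_div_iff₀ (by linarith)]
  have h3 := mul_le_mul_of_nonneg_left h1 (by linarith : 0 ≤ c)
  refine le_of_mul_le_mul_left ?_ h0
  linarith

theorem ncard_valid_ge {c : ℝ} (hc : 1 < c) (hp : c * (I.S.card : ℝ) ≤ p)
    (hβ : ∀ ij ∈ I.S, ∃ k, ¬ (p : ℤ) ∣ I.β ij.1 ij.2 k) :
    (1 - 1 / c) * (p : ℝ) ^ n ≤ ({γ : Fin n → ZMod p | I.Valid p γ}.ncard : ℝ) := by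
  have h1 := I.ncard_invalid_le hc hp hβ
  have h2 := Set.ncard_add_ncard_compl {γ : Fin n → ZMod p | I.Valid p γ}
  rw [Nat.card_eq_fintype_card, Fintype.card_fun, ZMod.card, Fintype.card_fin] at h2
  have h3 : ({γ : Fin n → ZMod p | I.Valid p γ}.ncard : ℝ) +
      ({γ : Fin n → ZMod p | ¬ I.Valid p γ}.ncard : ℝ) = (p : ℝ) ^ n := by exact_mod_cast h2
  linarith

open Classical in
/-- Averages over `k + 1` draws, when a quantity is inherited after an invalid first draw. -/
theorem sum_ofFn_succ_le (g : List (Fin n → ZMod p) → ℝ) (C : ℝ)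
    (hg : ∀ γ₀ l, g (γ₀ :: l) ≤ C + if I.Valid p γ₀ then 0 else g l) (k : ℕ) :
    ∑ γs : Fin (k + 1) → Fin n → ZMod p, g (List.ofFn γs) ≤
      C * ((p : ℝ) ^ n) ^ (k + 1) + ({γ : Fin n → ZMod p | ¬ I.Valid p γ}.ncard : ℝ) *
        ∑ γs : Fin k → Fin n → ZMod p, g (List.ofFn γs) := by
  have hcard : ({γ : Fin n → ZMod p | ¬ I.Valid p γ}.ncard : ℝ) =
      ∑ γ₀ : Fin n → ZMod p, if I.Valid p γ₀ then (0 : ℝ) else 1 := by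
    rw [Set.ncard_eq_toFinset_card', Finset.card_eq_sum_ones, Nat.cast_sum, Set.toFinset_ofPred,
      Finset.sum_filter]
    refine Finset.sum_congr rfl fun γ₀ _ => ?_
    by_cases h : I.Valid p γ₀ <;> simp [h]
  -- Independence of the draws: the sum over k + 1 vectors splits into the first vector and the
  -- remaining k.
  rw [← (Fin.consEquiv fun _ => Fin n → ZMod p).sum_comp, Fintype.sum_prod_type, hcard,
    Finset.sum_mul]
  have h1 : ∀ γ₀ : Fin n → ZMod p, ∑ γs : Fin k → Fin n → ZMod p,
      g (List.ofFn (Fin.consEquiv (fun _ => Fin n → ZMod p) (γ₀, γs))) ≤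
      C * ((p : ℝ) ^ n) ^ k + (if I.Valid p γ₀ then (0 : ℝ) else 1) *
        ∑ γs : Fin k → Fin n → ZMod p, g (List.ofFn γs) := by
    intro γ₀
    have h2 : C * ((p : ℝ) ^ n) ^ k = ∑ γs : Fin k → Fin n → ZMod p, C := by
      rw [Finset.sum_const, Finset.card_univ, Fintype.card_fun, Fintype.card_fun, ZMod.card,
        Fintype.card_fin, Fintype.card_fin, nsmul_eq_mul]
      push_cast; ring
    rw [h2, Finset.mul_sum, ← Finset.sum_add_distrib]
    refine Finset.sum_le_sum fun γs _ => ?_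
    have h3 : List.ofFn (Fin.consEquiv (fun _ => Fin n → ZMod p) (γ₀, γs)) =
        γ₀ :: List.ofFn γs := List.ofFn_cons γ₀ γs
    rw [h3]
    refine (hg _ _).trans_eq ?_
    by_cases h : I.Valid p γ₀ <;> simp [h]
  refine (Finset.sum_le_sum fun γ₀ _ => h1 γ₀).trans_eq ?_
  rw [Finset.sum_add_distrib, Finset.sum_const, Finset.card_univ, Fintype.card_fun, ZMod.card,
    Fintype.card_fin, nsmul_eq_mul]
  push_cast; ring

/-- The averaging recursion for the indicator of failure, with C = 0: each further draw contributes
a factor of at most 1/c. -/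
theorem ncard_none_le {c : ℝ} (hc : 1 < c) (hp : c * (I.S.card : ℝ) ≤ p)
    (hβ : ∀ ij ∈ I.S, ∃ k, ¬ (p : ℤ) ∣ I.β ij.1 ij.2 k) (k : ℕ) :
    ({γs : Fin k → Fin n → ZMod p | (I.process (List.ofFn γs)).val = none}.ncard : ℝ) ≤
      (1 / c) ^ k * ((p : ℝ) ^ n) ^ k := by
  classical
  have h1 : ∀ k, ({γs : Fin k → Fin n → ZMod p |
      (I.process (List.ofFn γs)).val = none}.ncard : ℝ) =
      ∑ γs : Fin k → Fin n → ZMod p,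
        if (I.findValid (List.ofFn γs)).val = none then (1 : ℝ) else 0 := by
    intro k
    rw [Set.ncard_eq_toFinset_card', Finset.card_eq_sum_ones, Nat.cast_sum, Set.toFinset_ofPred,
      Finset.sum_filter]
    refine Finset.sum_congr rfl fun γ₀ _ => ?_
    simp [process_val]
  rw [h1]
  induction k with
  | zero => simp [findValid]
  | succ k ih =>
    have h2 := I.sum_ofFn_succ_le (p := p) (fun l =>
      if (I.findValid l).val = none then (1 : ℝ) else 0) 0 (fun γ₀ l => by
        by_cases h : I.Valid p γ₀ <;> simp [findValid_cons_val_none, h]) k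
    refine h2.trans ?_
    rw [zero_mul, zero_add]
    have h3 := I.ncard_invalid_le hc hp hβ
    have h4 : (0 : ℝ) < c := by linarith
    calc _ ≤ (1 / c * (p : ℝ) ^ n) * ((1 / c) ^ k * ((p : ℝ) ^ n) ^ k) :=
          mul_le_mul h3 ih
            (Finset.sum_nonneg fun _ _ => by split_ifs <;> norm_num) (by positivity)
      _ = _ := by ring

/-- The expected times satisfy a_(k+1) ≤ C + a_k / c, and c/(c - 1) * C is the fixed point of this
recursion. The bound is therefore independent of k. -/
theorem sum_findValid_time_le (hn : 1 ≤ n) (hN : 1 ≤ N) (hd : 1 ≤ d) {c : ℝ} (hc : 1 < c)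
    (hp : c * (I.S.card : ℝ) ≤ p) (hβ : ∀ ij ∈ I.S, ∃ k, ¬ (p : ℤ) ∣ I.β ij.1 ij.2 k) (k : ℕ) :
    ∑ γs : Fin k → Fin n → ZMod p, ((I.findValid (List.ofFn γs)).time : ℝ) ≤
      c / (c - 1) * (6 * (N * d * n)) * ((p : ℝ) ^ n) ^ k := by
  classical
  have hc0 : (0 : ℝ) < c := by linarith
  have hc1 : (0 : ℝ) < c - 1 := by linarith
  induction k with
  | zero => simp [findValid]; positivity
  | succ k ih =>
    have h2 := I.sum_ofFn_succ_le (p := p) (fun l => ((I.findValid l).time : ℝ))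
      (6 * (N * d * n)) (fun γ₀ l => by
        have := I.findValid_cons_time_le hn hN hd l γ₀
        split_ifs with h
        · rw [if_pos h] at this; exact_mod_cast this
        · rw [if_neg h] at this; exact_mod_cast this) k
    refine h2.trans ?_
    have h3 := I.ncard_invalid_le hc hp hβ
    calc _ ≤ (6 * (N * d * n) : ℝ) * ((p : ℝ) ^ n) ^ (k + 1) + (1 / c * (p : ℝ) ^ n) *
          (c / (c - 1) * (6 * (N * d * n)) * ((p : ℝ) ^ n) ^ k) := by
          gcongr
      _ = _ := by
          rw [pow_succ]
          field_simp
          ring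

end ShortSum
end Draws

/-! ### Running times of the series operations. -/

section Time

/-- Each degree j contributes a binomial coefficient, at most 2^(r+j), and the sum over j ≤ k is
geometric. Such a crude exponential bound is enough, since the target grows faster than any
exponential in the number of factors. -/
theorem MvPolynomial.card_support_le {r k : ℕ} {R : Type*} [CommSemiring R]
    (f : MvPolynomial (Fin r) R) (hf : f.totalDegree ≤ k) : f.support.card ≤ 2 ^ (r + k + 1) := by
  have hsub : f.support ⊆ (Finset.range (k + 1)).biUnion fun j =>
      Finset.finsuppAntidiag (Finset.univ : Finset (Fin r)) j := by
    intro e he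
    rw [Finset.mem_biUnion]
    refine ⟨e.sum fun _ n => n, ?_, ?_⟩
    · exact Finset.mem_range_succ_iff.2 ((MvPolynomial.le_totalDegree he).trans hf)
    · rw [Finset.mem_finsuppAntidiag]
      exact ⟨by rw [Finsupp.sum_fintype _ _ fun _ => rfl], Finset.subset_univ _⟩
  refine ((Finset.card_le_card hsub).trans Finset.card_biUnion_le).trans ?_
  have h1 : ∀ j ∈ Finset.range (k + 1),
      (Finset.finsuppAntidiag (Finset.univ : Finset (Fin r)) j).card ≤ 2 ^ r * 2 ^ j := by
    intro j _
    rw [Finset.card_finsuppAntidiag_nat_eq_choose, Finset.card_univ, Fintype.card_fin, ← pow_add]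
    exact (Nat.choose_le_two_pow _ _).trans (Nat.pow_le_pow_right (by norm_num) (Nat.sub_le _ _))
  refine (Finset.sum_le_sum h1).trans ?_
  rw [← Finset.mul_sum, Nat.geomSum_eq le_rfl, add_assoc, pow_add 2 r (k + 1)]
  exact Nat.mul_le_mul_left _ ((Nat.div_le_self _ _).trans (Nat.sub_le _ _))

variable {p : ℕ} [Fact p.Prime]

theorem invTable_time_le (d : ℕ) : (invTable (p := p) d).time ≤ d := by
  have := Timed.fold_time_le' 1 (fun T (k : ℕ) => do
    let v ← op ((k : ZMod p)⁻¹)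
    pure (Function.update T k v)) (List.range' 1 d) (fun _ => 0) fun _ _ _ => by simp
  rwa [List.length_range', mul_one] at this

theorem invFactTable_time (inv : ℕ → ZMod p) (d : ℕ) : (invFactTable inv d).time = d := by
  induction d with
  | zero => rfl
  | succ d ih => simp [invFactTable, ih]

theorem powerSums_time_le (B : List (ZMod p)) (d : ℕ) :
    (powerSums B d).time ≤ d * (2 * B.length) := by
  have h : (powerSumsAux B d).time ≤ d * (2 * B.length) := by
    induction d with
    | zero => simp [powerSumsAux]
    | succ d ih =>
      simp only [powerSumsAux, Timed.bind_time, Timed.pure_time]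
      have hl : (powerSumsAux B d).val.2.length = B.length := by
        rw [(powerSumsAux_val B d).1, List.length_map]
      have h1 := Timed.mapL_time_le 1 (fun bw : ZMod p × ZMod p => do
        let v ← op (bw.1 * bw.2)
        pure (bw.1, v)) (powerSumsAux B d).val.2 fun _ _ => by simp
      have h2 := Timed.fold_time_le' 1 (fun acc (bw : ZMod p × ZMod p) => op (acc + bw.2))
        (Timed.mapL (fun bw : ZMod p × ZMod p => do
          let v ← op (bw.1 * bw.2)
          pure (bw.1, v)) (powerSumsAux B d).val.2).val 0 fun _ _ _ => by simp
      rw [Timed.mapL_val, List.length_map] at h2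
      rw [hl] at h1 h2
      rw [Timed.mapL_val]
      have h3 : (d + 1) * (2 * B.length) = d * (2 * B.length) + 2 * B.length := by ring
      omega
  simpa [powerSums] using h

section Log

variable (inv : ℕ → ZMod p) (f : ℕ → Polynomial (ZMod p))

theorem natDegree_logStep (hf : ∀ k, (f k).natDegree ≤ k) (h : ℕ → Polynomial (ZMod p))
    (hh : ∀ k, (h k).natDegree ≤ k) (k i : ℕ) (hi : i < k) :
    (Polynomial.C ((i + 1 : ℕ) : ZMod p) * (h (i + 1) * f (k - i))).natDegree ≤ k + 1 := by
  have h1 := Polynomial.natDegree_C_mul_le ((i + 1 : ℕ) : ZMod p) (h (i + 1) * f (k - i))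
  have h2 := Polynomial.natDegree_mul_le (p := h (i + 1)) (q := f (k - i))
  have h3 := hh (i + 1)
  have h4 := hf (k - i)
  omega

theorem natDegree_logFold (hf : ∀ k, (f k).natDegree ≤ k) (h : ℕ → Polynomial (ZMod p))
    (hh : ∀ k, (h k).natDegree ≤ k) (k : ℕ) :
    (Timed.fold (fun acc i => do
      let u ← polyMul (h (i + 1)) (f (k - i))
      let v ← polyScale ((i + 1 : ℕ) : ZMod p) u
      polyAdd acc v) (List.range k) 0).val.natDegree ≤ k + 1 := by
  refine Timed.fold_invariant (fun g : Polynomial (ZMod p) => g.natDegree ≤ k + 1) _ _ _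
    (by simp) fun i hi g hg => ?_
  exact (Polynomial.natDegree_add_le _ _).trans
    (max_le hg (natDegree_logStep f hf h hh k i (List.mem_range.1 hi)))

theorem natDegree_logSeries (hf : ∀ k, (f k).natDegree ≤ k) (d k : ℕ) :
    ((logSeries inv f d).val k).natDegree ≤ k := by
  induction d generalizing k with
  | zero => simp [logSeries]
  | succ d ih =>
    simp only [logSeries, Timed.bind_val, Timed.pure_val]
    rcases eq_or_ne k (d + 1) with rfl | hk
    · rw [Function.update_self]
      refine (Polynomial.natDegree_sub_le _ _).trans (max_le (hf _) ?_)
      exact (Polynomial.natDegree_C_mul_le _ _).trans (natDegree_logFold f hf _ ih d)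
    · rw [Function.update_of_ne hk]; exact ih k

theorem card_support_le_of_natDegree {g : Polynomial (ZMod p)} {k D : ℕ} (hg : g.natDegree ≤ k)
    (hk : k < D) : g.support.card ≤ D := by
  have := Polynomial.card_supp_le_succ_natDegree g
  omega

/-- All coefficients have degree less than D in y, hence at most D monomials. One round makes at
most D products of cost O(D²). -/
theorem logSeries_time_le (hf : ∀ k, (f k).natDegree ≤ k) (d D : ℕ) (hd : d < D) :
    (logSeries inv f d).time ≤ d * (8 * D ^ 3) := by
  induction d with
  | zero => simp [logSeries]
  | succ d ih =>
    have hh := natDegree_logSeries inv f hf d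
    set h := (logSeries inv f d).val with h_def
    have h1 : (Timed.fold (fun acc i => do
        let u ← polyMul (h (i + 1)) (f (d - i))
        let v ← polyScale ((i + 1 : ℕ) : ZMod p) u
        polyAdd acc v) (List.range d) 0).time ≤ d * (2 * (D * D) + D + (D + D)) := by
      have := Timed.fold_time_le (fun g : Polynomial (ZMod p) => g.natDegree ≤ d + 1)
        (2 * (D * D) + D + (D + D)) (fun acc i => do
          let u ← polyMul (h (i + 1)) (f (d - i))
          let v ← polyScale ((i + 1 : ℕ) : ZMod p) u
          polyAdd acc v) (List.range d) 0 (by simp)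
        (fun i hi g hg => (Polynomial.natDegree_add_le _ _).trans
          (max_le hg (natDegree_logStep f hf h hh d i (List.mem_range.1 hi))))
        (fun i hi g hg => by
          have hi' := List.mem_range.1 hi
          have e1 : (h (i + 1)).support.card ≤ D :=
            card_support_le_of_natDegree (hh (i + 1)) (by omega)
          have e2 : (f (d - i)).support.card ≤ D :=
            card_support_le_of_natDegree (hf (d - i)) (by omega)
          have e3 : (h (i + 1) * f (d - i)).support.card ≤ D := by
            refine card_support_le_of_natDegree (k := d + 1) ?_ (by omega)
            have := Polynomial.natDegree_mul_le (p := h (i + 1)) (q := f (d - i))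
            have := hh (i + 1)
            have := hf (d - i)
            omega
          have e4 := card_support_le_of_natDegree (natDegree_logStep f hf h hh d i hi')
            (D := D) (by omega)
          have e5 : g.support.card ≤ D := card_support_le_of_natDegree hg (by omega)
          have e6 := Nat.mul_le_mul e1 e2
          simp only [Timed.bind_time, polyMul, polyScale, polyAdd]
          omega)
      rwa [List.length_range] at this
    have h2 := natDegree_logFold f hf h hh d
    set S := (Timed.fold (fun acc i => do
        let u ← polyMul (h (i + 1)) (f (d - i))
        let v ← polyScale ((i + 1 : ℕ) : ZMod p) u
        polyAdd acc v) (List.range d) 0) with hS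
    have e1 : S.val.support.card ≤ D := card_support_le_of_natDegree h2 (by omega)
    have e2 : (Polynomial.C (inv (d + 1)) * S.val).support.card ≤ D :=
      card_support_le_of_natDegree ((Polynomial.natDegree_C_mul_le _ _).trans h2) (by omega)
    have e3 : (f (d + 1)).support.card ≤ D := card_support_le_of_natDegree (hf _) (by omega)
    have ht : (logSeries inv f (d + 1)).time = (logSeries inv f d).time + (S.time +
        (S.val.support.card + ((f (d + 1)).support.card +
          (Polynomial.C (inv (d + 1)) * S.val).support.card))) := rfl
    rw [ht]
    have h3 := ih (by omega)
    have h4 : d * (2 * (D * D) + D + (D + D)) + 3 * D ≤ 8 * D ^ 3 := by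
      have : 1 ≤ D := by omega
      nlinarith [Nat.mul_le_mul (show d ≤ D by omega) (le_refl (2 * (D * D) + D + (D + D))),
        Nat.mul_le_mul this (le_refl (D * D)), Nat.mul_le_mul this (le_refl D),
        Nat.mul_le_mul this (le_refl (D * D * D))]
    rw [add_mul, one_mul]
    omega

end Log

section Exp

variable {r : ℕ} (inv : ℕ → ZMod p) (H : ℕ → MvPolynomial (Fin r) (ZMod p))

theorem totalDegree_C_mul_le (a : ZMod p) (f : MvPolynomial (Fin r) (ZMod p)) :
    (MvPolynomial.C a * f).totalDegree ≤ f.totalDegree := by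
  have := MvPolynomial.totalDegree_mul (MvPolynomial.C a) f
  rwa [MvPolynomial.totalDegree_C, zero_add] at this

/-- The degree in the y_i never exceeds the power of s, and every product in the recursion preserves
this. -/
theorem totalDegree_expSeries (d : ℕ) (hH : ∀ k ≤ d, (H k).totalDegree ≤ k) (k : ℕ) (hk : k ≤ d) :
    ((expSeries inv H d).val k).totalDegree ≤ k := by
  induction k using Nat.strong_induction_on with
  | _ k ih =>
    rcases k with _ | k
    · rw [expSeries_zero, MvPolynomial.totalDegree_one]
    · rw [expSeries_stable inv H hk, expSeries_succ]
      refine (totalDegree_C_mul_le _ _).trans ((MvPolynomial.totalDegree_finsetSum _ _).trans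
        (Finset.sup_le fun i hi => (totalDegree_C_mul_le _ _).trans ?_))
      have hi' := Finset.mem_range.1 hi
      have h1 := MvPolynomial.totalDegree_mul (H (i + 1)) ((expSeries inv H k).val (k - i))
      have h2 := hH (i + 1) (by omega)
      have h3 := ih (k - i) (by omega) (by omega)
      rw [expSeries_stable inv H (show k - i ≤ d by omega),
        ← expSeries_stable inv H (show k - i ≤ k by omega)] at h3
      omega

theorem expSeries_time_le (d W : ℕ) (hH : ∀ k ≤ d, (H k).totalDegree ≤ k)
    (hW : ∀ f : MvPolynomial (Fin r) (ZMod p), f.totalDegree ≤ d → f.support.card ≤ W) (k : ℕ)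
    (hk : k ≤ d) : (expSeries inv H k).time ≤ k * (d * (2 * (W * W) + 3 * W) + W) := by
  induction k with
  | zero => simp [expSeries]
  | succ k ih =>
    have hF := totalDegree_expSeries inv H d hH
    have hF' : ∀ j ≤ k, ((expSeries inv H k).val j).totalDegree ≤ j := fun j hj => by
      rw [expSeries_stable inv H hj, ← expSeries_stable inv H (show j ≤ d by omega)]
      exact hF j (by omega)
    set F := (expSeries inv H k).val with F_def
    have hmul : ∀ i < k + 1, (H (i + 1) * F (k - i)).totalDegree ≤ k + 1 := by
      intro i hi
      have h2 := MvPolynomial.totalDegree_mul (H (i + 1)) (F (k - i))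
      have h3 := hH (i + 1) (by omega)
      have h4 := hF' (k - i) (by omega)
      omega
    have hinv : ∀ i ∈ List.range (k + 1), ∀ g : MvPolynomial (Fin r) (ZMod p),
        g.totalDegree ≤ k + 1 → (g + MvPolynomial.C ((i + 1 : ℕ) : ZMod p) *
          (H (i + 1) * F (k - i))).totalDegree ≤ k + 1 := fun i hi g hg =>
      (MvPolynomial.totalDegree_add _ _).trans (max_le hg
        ((totalDegree_C_mul_le _ _).trans (hmul i (List.mem_range.1 hi))))
    have h1 := Timed.fold_time_le
        (fun g : MvPolynomial (Fin r) (ZMod p) => g.totalDegree ≤ k + 1)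
        (2 * (W * W) + 3 * W) (fun acc i => do
          let u ← mvMul (H (i + 1)) (F (k - i))
          let v ← mvScale ((i + 1 : ℕ) : ZMod p) u
          mvAdd acc v) (List.range (k + 1)) 0 (by simp) hinv
        (fun i hi g hg => by
          have hi' := List.mem_range.1 hi
          have e1 := hW _ ((hH (i + 1) (by omega)).trans (by omega))
          have e2 := hW _ ((hF' (k - i) (by omega)).trans (by omega))
          have e3 := hW _ ((hmul i hi').trans hk)
          have e4 := hW _ (((totalDegree_C_mul_le ((i + 1 : ℕ) : ZMod p) _).trans
            (hmul i hi')).trans hk)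
          have e5 := hW _ (hg.trans hk)
          have e6 := Nat.mul_le_mul e1 e2
          simp only [Timed.bind_time, mvMul, mvScale, mvAdd]
          omega)
    have h2 := Timed.fold_invariant
        (fun g : MvPolynomial (Fin r) (ZMod p) => g.totalDegree ≤ k + 1) (fun acc i => do
          let u ← mvMul (H (i + 1)) (F (k - i))
          let v ← mvScale ((i + 1 : ℕ) : ZMod p) u
          mvAdd acc v) (List.range (k + 1)) 0 (by simp) hinv
    set S := Timed.fold (fun acc i => do
          let u ← mvMul (H (i + 1)) (F (k - i))
          let v ← mvScale ((i + 1 : ℕ) : ZMod p) u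
          mvAdd acc v) (List.range (k + 1)) (0 : MvPolynomial (Fin r) (ZMod p)) with hS
    have e1 := hW _ (h2.trans hk)
    have ht : (expSeries inv H (k + 1)).time =
        (expSeries inv H k).time + (S.time + (S.val.support.card + 0)) := rfl
    rw [ht, add_mul, one_mul]
    rw [List.length_range] at h1
    have h3 := ih (by omega)
    have h4 := Nat.mul_le_mul_right (2 * (W * W) + 3 * W) hk
    omega

end Exp

variable {m : ℕ}

theorem collect_time_le (w : List (ExpTerm p m)) : (collect w).time ≤ w.length := by
  have := Timed.fold_time_le' 1 (fun (acc : (Fin m → ℤ) →₀ ZMod p) (τ : ExpTerm p m) =>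
    op (acc + Finsupp.single τ.xexp τ.coeff)) w 0 fun _ _ _ => by simp
  rwa [mul_one] at this

theorem expSumCoeffs_length (inv : ℕ → ZMod p) (L : List (ExpTerm p m)) (d : ℕ) :
    (expSumCoeffs inv L d).val.2.length = L.length := by
  induction d with
  | zero => rfl
  | succ d ih =>
    simp only [expSumCoeffs, Timed.bind_val, Timed.pure_val, Timed.mapL_val, List.length_map, ih]

theorem expSumCoeffs_time_le (inv : ℕ → ZMod p) (L : List (ExpTerm p m)) (d : ℕ) :
    (expSumCoeffs inv L d).time ≤ L.length + d * (3 * L.length) := by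
  induction d with
  | zero => simpa [expSumCoeffs] using collect_time_le L
  | succ d ih =>
    simp only [expSumCoeffs, Timed.bind_time, Timed.pure_time]
    have h1 := Timed.mapL_time_le 2 (fun τ : ExpTerm p m => do
      let c ← op (τ.coeff * τ.a)
      let c' ← op (c * inv (d + 1))
      pure { τ with coeff := c' }) (expSumCoeffs inv L d).val.2 fun _ _ => by simp
    have h2 := collect_time_le (Timed.mapL (fun τ : ExpTerm p m => do
      let c ← op (τ.coeff * τ.a)
      let c' ← op (c * inv (d + 1))
      pure { τ with coeff := c' }) (expSumCoeffs inv L d).val.2).val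
    rw [Timed.mapL_val, List.length_map] at h2
    rw [expSumCoeffs_length] at h1 h2
    rw [Timed.mapL_val, add_mul, one_mul]
    omega

theorem card_support_collect_le (w : List (ExpTerm p m)) :
    (collect w).val.support.card ≤ w.length := by
  classical
  rw [collect_val]
  induction w with
  | nil => simp
  | cons τ w ih =>
    rw [List.map_cons, List.sum_cons, List.length_cons, add_comm w.length]
    refine (Finset.card_le_card Finsupp.support_add).trans ((Finset.card_union_le _ _).trans
      (Nat.add_le_add ?_ ih))
    exact (Finset.card_le_card Finsupp.support_single_subset).trans (by simp)

/-- Passing to the next power of s changes coefficients only, never the monomials in x. -/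
theorem card_support_expSumCoeffs_le (inv : ℕ → ZMod p) (L : List (ExpTerm p m)) (d k : ℕ) :
    ((expSumCoeffs inv L d).val.1 k).support.card ≤ L.length := by
  induction d with
  | zero =>
    simp only [expSumCoeffs, Timed.bind_val, Timed.pure_val]
    rcases eq_or_ne k 0 with rfl | hk
    · rw [Function.update_self]; exact card_support_collect_le L
    · rw [Function.update_of_ne hk]; simp
  | succ d ih =>
    simp only [expSumCoeffs, Timed.bind_val, Timed.pure_val]
    rcases eq_or_ne k (d + 1) with rfl | hk
    · rw [Function.update_self]
      refine (card_support_collect_le _).trans_eq ?_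
      rw [Timed.mapL_val, List.length_map, expSumCoeffs_length]
    · rw [Function.update_of_ne hk]; exact ih

theorem firstNonzero_time_le (T : ℕ → ((Fin m → ℤ) →₀ ZMod p)) (U : ℕ)
    (hT : ∀ k, (T k).support.card ≤ U) (l : List ℕ) :
    (firstNonzero T l).time ≤ l.length * (1 + U) := by
  induction l with
  | nil => simp [firstNonzero]
  | cons k l ih =>
    simp only [firstNonzero, Timed.bind_time, List.length_cons]
    have := hT k
    rw [add_mul, one_mul]
    split_ifs <;> simp <;> omega

end Time

/-! ### Running time of Algorithm CTGTodd. -/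

section ToddTime

variable {p m : ℕ} [Fact p.Prime]

theorem totalDegree_aeval_X_le {r : ℕ} (i : Fin r) (u : Polynomial (ZMod p)) {k : ℕ}
    (hu : u.natDegree ≤ k) : (Polynomial.aeval (MvPolynomial.X i : MvPolynomial (Fin r) (ZMod p))
      u).totalDegree ≤ k := by
  rw [Polynomial.aeval_eq_sum_range]
  refine (MvPolynomial.totalDegree_finsetSum _ _).trans (Finset.sup_le fun j hj => ?_)
  refine (MvPolynomial.totalDegree_smul_le _ _).trans ?_
  rw [MvPolynomial.totalDegree_X_pow]
  have := Finset.mem_range.1 hj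
  omega

theorem toddLog_step_degree {r : ℕ} (q : ℕ → ZMod p) (hy : ℕ → Polynomial (ZMod p))
    (hhy : ∀ k, (hy k).natDegree ≤ k) (i : Fin r) (k : ℕ)
    (H : ℕ → MvPolynomial (Fin r) (ZMod p)) (hH : ∀ k, (H k).totalDegree ≤ k) (j : ℕ) :
    (Function.update H k (H k - Polynomial.aeval
      (MvPolynomial.X i : MvPolynomial (Fin r) (ZMod p)) (Polynomial.C (q k) * hy k))
        j).totalDegree ≤ j := by
  rcases eq_or_ne j k with rfl | hj
  · rw [Function.update_self]
    exact (MvPolynomial.totalDegree_sub _ _).trans (max_le (hH j)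
      (totalDegree_aeval_X_le i _ ((Polynomial.natDegree_C_mul_le _ _).trans (hhy j))))
  · rw [Function.update_of_ne hj]; exact hH j

/-- One group in the computation of `ln F`. -/
def toddLogGroup {r : ℕ} (q : ℕ → ZMod p) (hy : ℕ → Polynomial (ZMod p)) (d : ℕ) (i : Fin r)
    (H : ℕ → MvPolynomial (Fin r) (ZMod p)) : Timed (ℕ → MvPolynomial (Fin r) (ZMod p)) :=
  Timed.fold (fun (H' : ℕ → MvPolynomial (Fin r) (ZMod p)) k => do
    let u ← polyScale (q k) (hy k)
    let v ← mvSub (H' k) (Polynomial.aeval (MvPolynomial.X i) u)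
    pure (Function.update H' k v)) (List.range' 1 d) H

theorem toddLogGroup_degree {r : ℕ} (q : ℕ → ZMod p) (hy : ℕ → Polynomial (ZMod p))
    (hhy : ∀ k, (hy k).natDegree ≤ k) (d : ℕ) (i : Fin r)
    (H : ℕ → MvPolynomial (Fin r) (ZMod p)) (hH : ∀ k, (H k).totalDegree ≤ k) :
    ∀ k, ((toddLogGroup q hy d i H).val k).totalDegree ≤ k :=
  Timed.fold_invariant (fun H : ℕ → MvPolynomial (Fin r) (ZMod p) => ∀ k, (H k).totalDegree ≤ k)
    _ _ _ hH fun k _ H' hH' => toddLog_step_degree q hy hhy i k H' hH'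

theorem toddLogGroup_time_le {r : ℕ} (q : ℕ → ZMod p) (hy : ℕ → Polynomial (ZMod p))
    (hhy : ∀ k, (hy k).natDegree ≤ k) (d D W : ℕ) (hd : d < D)
    (hW : ∀ f : MvPolynomial (Fin r) (ZMod p), f.totalDegree ≤ d → f.support.card ≤ W) (i : Fin r)
    (H : ℕ → MvPolynomial (Fin r) (ZMod p)) (hH : ∀ k, (H k).totalDegree ≤ k) :
    (toddLogGroup q hy d i H).time ≤ d * (D + 2 * W) := by
  have := Timed.fold_time_le
    (fun H : ℕ → MvPolynomial (Fin r) (ZMod p) => ∀ k, (H k).totalDegree ≤ k) (D + 2 * W)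
    (fun (H' : ℕ → MvPolynomial (Fin r) (ZMod p)) k => do
      let u ← polyScale (q k) (hy k)
      let v ← mvSub (H' k) (Polynomial.aeval (MvPolynomial.X i) u)
      pure (Function.update H' k v)) (List.range' 1 d) H hH
    (fun k _ H' hH' => toddLog_step_degree q hy hhy i k H' hH') (fun k hk H' hH' => by
      have hk' := (mem_range'_one.1 hk).2
      have e1 : (hy k).support.card ≤ D := card_support_le_of_natDegree (hhy k) (by omega)
      have e2 := hW _ ((hH' k).trans hk')
      have e3 := hW _ (totalDegree_aeval_X_le i (Polynomial.C (q k) * hy k)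
        (((Polynomial.natDegree_C_mul_le _ _).trans (hhy k)).trans hk'))
      simp only [Timed.bind_time, Timed.pure_time, polyScale, mvSub]
      omega)
  rwa [List.length_range'] at this

namespace GTodd

/-- W bounds the number of monomials of any polynomial that occurs, and all other parameters are at
most W. The exponential recursion, with its O(d²) products of cost O(W²), and the crude bounds for
the logarithms give order W^4. -/
theorem toddSeries_degree_time (G : GTodd p m) (d D W : ℕ) (hd : d < D) (hDW : D ≤ W)
    (hB0 : G.B0.length ≤ D) (hB : ∀ g ∈ G.grp, g.2.length ≤ D) (hr : G.grp.length ≤ D)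
    (hW : ∀ f : MvPolynomial (Fin G.grp.length) (ZMod p),
      f.totalDegree ≤ d → f.support.card ≤ W) :
    (∀ k ≤ d, ((G.toddSeries d).val k).totalDegree ≤ k) ∧
      (G.toddSeries d).time ≤ 40 * W ^ 4 := by
  set inv := (invTable (p := p) (d + 1)).val with inv_def
  set c := (invFactTable inv (d + 1)).val with c_def
  have hf1 : ∀ k, ((fun k => Polynomial.C (c (k + 1))) k).natDegree ≤ k := fun k => by simp
  have hf2 : ∀ k, ((fun k => if k = 0 then (1 : Polynomial (ZMod p)) else
      Polynomial.monomial 1 (-(c k))) k).natDegree ≤ k := fun k => by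
    rcases k with _ | k
    · simp
    · simp only [Nat.succ_ne_zero, if_false]
      exact (Polynomial.natDegree_monomial_le _).trans (by omega)
  set L1 := logSeries inv (fun k => Polynomial.C (c (k + 1))) d with L1_def
  set L2 := logSeries inv (fun k => if k = 0 then 1 else Polynomial.monomial 1 (-(c k))) d
    with L2_def
  have hhy : ∀ k, (L2.val k).natDegree ≤ k := natDegree_logSeries inv _ hf2 d
  set Q0 := powerSums G.B0 d with Q0_def
  set H0 := Timed.fold (fun (H : ℕ → MvPolynomial (Fin G.grp.length) (ZMod p)) k => do
    let u ← op (Q0.val k * (L1.val k).coeff 0)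
    let v ← op (-u)
    pure (Function.update H k (MvPolynomial.C v))) (List.range' 1 d) (fun _ => 0) with H0_def
  set H1 := Timed.fold (fun H (i : Fin G.grp.length) => do
    let q ← powerSums (G.grp.get i).2 d
    toddLogGroup q L2.val d i H) (List.finRange G.grp.length) H0.val with H1_def
  have hH0 : ∀ k, (H0.val k).totalDegree ≤ k :=
    Timed.fold_invariant (fun H : ℕ → MvPolynomial (Fin G.grp.length) (ZMod p) =>
      ∀ k, (H k).totalDegree ≤ k) _ _ _ (fun k => by simp) fun k _ H' hH' j => by
        simp only [Timed.bind_val, Timed.pure_val, Timed.op_val]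
        rcases eq_or_ne j k with rfl | hj
        · rw [Function.update_self, MvPolynomial.totalDegree_C]; exact Nat.zero_le _
        · rw [Function.update_of_ne hj]; exact hH' j
  have hH1 : ∀ k, (H1.val k).totalDegree ≤ k :=
    Timed.fold_invariant (fun H : ℕ → MvPolynomial (Fin G.grp.length) (ZMod p) =>
      ∀ k, (H k).totalDegree ≤ k) _ _ _ hH0 fun i _ H' hH' =>
        toddLogGroup_degree _ _ hhy d i H' hH'
  have hval : (G.toddSeries d).val = (expSeries inv H1.val d).val := rfl
  have htime : (G.toddSeries d).time = (invTable (p := p) (d + 1)).time +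
      ((invFactTable inv (d + 1)).time + (L1.time + (L2.time + (Q0.time + (H0.time + (H1.time +
        (expSeries inv H1.val d).time)))))) := rfl
  refine ⟨fun k hk => by
    rw [hval]; exact totalDegree_expSeries inv _ d (fun k _ => hH1 k) k hk, ?_⟩
  have t1 := invTable_time_le (p := p) (d + 1)
  have t2 := invFactTable_time inv (d + 1)
  have t3 : L1.time ≤ _ := logSeries_time_le inv _ hf1 d D hd
  have t4 : L2.time ≤ _ := logSeries_time_le inv _ hf2 d D hd
  have t5 : Q0.time ≤ _ := powerSums_time_le G.B0 d
  have t6 : H0.time ≤ d * 2 := by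
    have := Timed.fold_time_le' 2 (fun (H : ℕ → MvPolynomial (Fin G.grp.length) (ZMod p)) k => do
      let u ← op (Q0.val k * (L1.val k).coeff 0)
      let v ← op (-u)
      pure (Function.update H k (MvPolynomial.C v))) (List.range' 1 d) (fun _ => 0)
      fun _ _ _ => by simp
    rwa [List.length_range'] at this
  have t7 : H1.time ≤ G.grp.length * (d * (2 * D) + d * (D + 2 * W)) := by
    have := Timed.fold_time_le (fun H : ℕ → MvPolynomial (Fin G.grp.length) (ZMod p) =>
      ∀ k, (H k).totalDegree ≤ k) (d * (2 * D) + d * (D + 2 * W))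
      (fun H (i : Fin G.grp.length) => do
        let q ← powerSums (G.grp.get i).2 d
        toddLogGroup q L2.val d i H) (List.finRange G.grp.length) H0.val hH0
      (fun i _ H' hH' => toddLogGroup_degree _ _ hhy d i H' hH') (fun i _ H' hH' => by
        rw [Timed.bind_time]
        refine Nat.add_le_add ((powerSums_time_le _ _).trans ?_)
          (toddLogGroup_time_le _ _ hhy d D W hd hW i H' hH')
        exact Nat.mul_le_mul_left _ (Nat.mul_le_mul_left _ (hB _ (List.get_mem _ _))))
    rwa [List.length_finRange] at this
  have t8 := expSeries_time_le inv H1.val d W (fun k _ => hH1 k) hW d le_rfl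
  rw [htime]
  have hdW : d ≤ W := by omega
  have hW1 : 1 ≤ W := by omega
  have s1 : d + 1 ≤ W ^ 4 := (show d + 1 ≤ W by omega).trans (Nat.le_self_pow (by norm_num) W)
  have s3 : d * (8 * D ^ 3) ≤ 8 * W ^ 4 := by
    calc d * (8 * D ^ 3) ≤ W * (8 * W ^ 3) := by gcongr
      _ = 8 * W ^ 4 := by ring
  have w2 : W ^ 2 ≤ W ^ 4 := Nat.pow_le_pow_right hW1 (by norm_num)
  have w3 : W ^ 3 ≤ W ^ 4 := Nat.pow_le_pow_right hW1 (by norm_num)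
  have s5 : d * (2 * G.B0.length) ≤ 2 * W ^ 4 := by
    calc d * (2 * G.B0.length) ≤ W * (2 * W) := by gcongr; omega
      _ = 2 * W ^ 2 := by ring
      _ ≤ _ := by omega
  have s6 : d * 2 ≤ 2 * W ^ 4 := by omega
  have s7 : G.grp.length * (d * (2 * D) + d * (D + 2 * W)) ≤ 5 * W ^ 4 := by
    calc G.grp.length * (d * (2 * D) + d * (D + 2 * W)) ≤ W * (W * (2 * W) + W * (W + 2 * W)) := by
          gcongr; omega
      _ = 5 * W ^ 3 := by ring
      _ ≤ _ := by omega
  have s8 : d * (d * (2 * (W * W) + 3 * W) + W) ≤ 6 * W ^ 4 := by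
    calc d * (d * (2 * (W * W) + 3 * W) + W) ≤ W * (W * (2 * (W * W) + 3 * W) + W) := by gcongr
      _ = 2 * W ^ 4 + 3 * W ^ 3 + W ^ 2 := by ring
      _ ≤ _ := by omega
  omega

theorem ctGTodd_time_le (G : GTodd p m) (U D : ℕ) (hU : 1 ≤ U) (hL : G.L.length ≤ U)
    (hB : ∀ g ∈ G.grp, g.2.length ≤ D) (hD : G.B0.length + G.grp.length + 1 ≤ D) :
    G.ctGTodd.time ≤ 60 * U * (2 ^ D) ^ 4 := by
  -- By hypothesis r + |B_0| + 1 ≤ D, so `MvPolynomial.card_support_le` bounds all supports in r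
  -- variables up to degree |B_0| by W.
  set W := 2 ^ D with hWdef
  have hDW : D ≤ W := Nat.lt_two_pow_self.le
  set I1 := invTable (p := p) G.B0.length with I1_def
  set ℓ := expSumCoeffs I1.val G.L G.B0.length with ℓ_def
  set o := firstNonzero ℓ.1.1 (List.range (G.B0.length + 1)) with o_def
  have hsupp : ∀ k, (ℓ.1.1 k).support.card ≤ U := fun k =>
    (card_support_expSumCoeffs_le _ _ _ _).trans hL
  have t1 : I1.time ≤ _ := invTable_time_le (p := p) G.B0.length
  have t2 : ℓ.time ≤ _ := expSumCoeffs_time_le I1.val G.L G.B0.length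
  have t3 : o.time ≤ _ := firstNonzero_time_le ℓ.1.1 U hsupp (List.range (G.B0.length + 1))
  rw [List.length_range] at t3
  have w4 : W ≤ W ^ 4 := Nat.le_self_pow (by norm_num) W
  have hW1 : 1 ≤ W := by omega
  have w2 : W * W ≤ W ^ 4 := by
    rw [← pow_two]; exact Nat.pow_le_pow_right hW1 (by norm_num)
  have w3 : W * W * W ≤ W ^ 4 := by
    rw [← pow_three']; exact Nat.pow_le_pow_right hW1 (by norm_num)
  have hUW : W ^ 4 ≤ U * W ^ 4 := Nat.le_mul_of_pos_left _ hU
  have s1 : I1.time ≤ U * W ^ 4 := by omega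
  have s2 : ℓ.time ≤ 4 * (U * W ^ 4) := by
    calc ℓ.time ≤ U + W * (3 * U) := t2.trans (by gcongr; omega)
      _ = U * 1 + 3 * (U * W) := by ring
      _ ≤ U * W ^ 4 + 3 * (U * W ^ 4) := by gcongr; omega
      _ = _ := by ring
  have s3 : o.time ≤ 2 * (U * W ^ 4) := by
    calc o.time ≤ W * (1 + U) := t3.trans (by gcongr; omega)
      _ ≤ W ^ 4 * (U + U) := by gcongr
      _ = _ := by ring
  rcases ho : o.val with _ | d₀
  · have : G.ctGTodd.time = I1.time + (ℓ.time + (o.time + 0)) := by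
      rw [ctGTodd]
      simp only [Timed.bind_time, ← I1_def, ← ℓ_def, ← o_def, ho, Timed.pure_time]
    rw [this, mul_assoc]
    omega
  · set d := G.B0.length - d₀ with d_def
    have hW : ∀ f : MvPolynomial (Fin G.grp.length) (ZMod p),
        f.totalDegree ≤ d → f.support.card ≤ W := fun f hf =>
      (MvPolynomial.card_support_le f hf).trans (Nat.pow_le_pow_right (by norm_num) (by omega))
    obtain ⟨hF, t4⟩ := G.toddSeries_degree_time d D W (by omega) hDW (by omega) hB (by omega) hW
    set F := G.toddSeries d with F_def
    set Bf := Timed.fold (fun acc b => op (acc * (-b))) G.B0 (1 : ZMod p) with Bf_def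
    have t5 : Bf.time ≤ G.B0.length * 1 := Timed.fold_time_le' 1 _ _ _ fun _ _ _ => by simp
    let inner := fun (k : ℕ) (out : List (SimpleFrac p m)) (e : Fin G.grp.length →₀ ℕ) => do
        let a ← op (Bf.val⁻¹ * (F.val (d - k)).coeff e)
        let num ← (⟨a • ℓ.1.1 (d₀ + k), (ℓ.1.1 (d₀ + k)).support.card⟩ :
          Timed ((Fin m → ℤ) →₀ ZMod p))
        let mon ← (⟨∑ i, (e i : ℤ) • (G.grp.get i).1, G.grp.length⟩ : Timed (Fin m → ℤ))
        pure (({ num := num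
                 mon := mon
                 den := (List.finRange G.grp.length).map fun i =>
                  ((G.grp.get i).1, e i + (G.grp.get i).2.length) } : SimpleFrac p m) :: out)
    have ht : G.ctGTodd.time = I1.time + (ℓ.time + (o.time + (F.time + (Bf.time + (1 +
        (Timed.fold (fun out k => Timed.fold (inner k) (F.val (d - k)).support.toList out)
          (List.range (d + 1)) []).time))))) := by
      rw [ctGTodd]
      simp only [Timed.bind_time, ← I1_def, ← ℓ_def, ← o_def, ho]
      rfl
    have t6 : (Timed.fold (fun out k => Timed.fold (inner k) (F.val (d - k)).support.toList out)
          (List.range (d + 1)) []).time ≤ (d + 1) * (W * (1 + (U + D))) := by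
      have := Timed.fold_time_le' (W * (1 + (U + D)))
        (fun out k => Timed.fold (inner k) (F.val (d - k)).support.toList out)
        (List.range (d + 1)) [] fun k hk out => by
          refine (Timed.fold_time_le' (1 + (U + D)) (inner k) _ out fun e _ out' => ?_).trans ?_
          · have := hsupp (d₀ + k)
            simp only [inner, Timed.bind_time, Timed.op_time, Timed.pure_time]
            omega
          · rw [Finset.length_toList]
            exact Nat.mul_le_mul_right _ (hW _ ((hF _ (Nat.sub_le d k)).trans (Nat.sub_le d k)))
      rwa [List.length_range] at this
    have s6 : (d + 1) * (W * (1 + (U + D))) ≤ 3 * (U * W ^ 4) := by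
      calc (d + 1) * (W * (1 + (U + D))) ≤ W * (W * (U * W + (U * W + U * W))) := by
            have h1 : 1 ≤ U * W := Nat.mul_pos hU hW1
            have h2 : U ≤ U * W := Nat.le_mul_of_pos_right U hW1
            have h3 : D ≤ U * W := hDW.trans (Nat.le_mul_of_pos_left W hU)
            have h4 : d + 1 ≤ W := by omega
            gcongr
        _ = 3 * (U * (W * W * W)) := by ring
        _ ≤ _ := by gcongr
    rw [ht, mul_assoc]
    omega

end GTodd

end ToddTime

/-! ### Total running time of the process. -/

section TotalTime

variable {m n N d p : ℕ}

theorem insertGroup_time_le (t : Fin m → ℤ) (b : ZMod p)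
    (l : List ((Fin m → ℤ) × List (ZMod p))) : (insertGroup t b l).time ≤ l.length := by
  induction l with
  | nil => simp [insertGroup]
  | cons g l ih =>
    simp only [insertGroup, Timed.bind_time, Timed.op_val, Timed.op_time, List.length_cons]
    by_cases h : g.1 = t
    · simp [h]
    · simp [h]; omega

theorem insertGroup_length_le (t : Fin m → ℤ) (b : ZMod p)
    (l : List ((Fin m → ℤ) × List (ZMod p))) :
    (insertGroup t b l).val.length ≤ l.length + 1 := by
  induction l with
  | nil => simp [insertGroup]
  | cons g l ih =>
    simp only [insertGroup, Timed.bind_val, Timed.op_val, List.length_cons]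
    by_cases h : g.1 = t
    · simp [h]
    · simp [h]; omega

variable [Fact p.Prime]

theorem innerMod_time_le (γ : Fin n → ZMod p) (v : Fin n → ℤ) :
    (innerMod γ v).time ≤ n * 3 := by
  have := Timed.fold_time_le' 3 (fun acc k => do
    let b ← op ((v k : ℤ) : ZMod p)
    let c ← op (γ k * b)
    op (acc + c)) (List.finRange n) 0 fun _ _ _ => by simp
  rwa [List.length_finRange] at this

namespace ShortSum

variable (I : ShortSum m n N d) (γ : Fin n → ZMod p) (i : Fin N)

theorem groupStep_time_le (G : GTodd p m) (j : Fin d) :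
    (I.groupStep γ i G j).time ≤ n * 3 + 1 + G.grp.length := by
  have h1 := innerMod_time_le γ (I.β i j)
  have h2 := insertGroup_time_le (I.M i j) (innerMod γ (I.β i j)).val G.grp
  simp only [groupStep, Timed.bind_time, Timed.op_val, Timed.op_time]
  by_cases h : I.M i j = 0
  · simp [h]; omega
  · simp [h]; omega

theorem groupStep_length_le (G : GTodd p m) (j : Fin d) :
    (I.groupStep γ i G j).val.grp.length ≤ G.grp.length + 1 := by
  by_cases h : I.M i j = 0
  · rw [groupStep_val_of_eq _ _ _ _ _ h]; exact Nat.le_succ _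
  · rw [groupStep_val_of_ne _ _ _ _ _ h]; exact insertGroup_length_le _ _ _

/-- A step adds at most one group, so every insertion scans at most the initial groups plus one for
each step. -/
theorem fold_groupStep_time_le (l : List (Fin d)) (G : GTodd p m) :
    (Timed.fold (I.groupStep γ i) l G).time ≤
      l.length * (n * 3 + 1 + G.grp.length + l.length) := by
  induction l generalizing G with
  | nil => simp [Timed.fold]
  | cons j l ih =>
    have h1 := ih (I.groupStep γ i G j).val
    have h2 := I.groupStep_time_le γ i G j
    have h3 := I.groupStep_length_le γ i G j
    simp only [Timed.fold, Timed.bind_time, List.length_cons]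
    have h4 := Nat.mul_le_mul_left l.length (show n * 3 + 1 +
      (I.groupStep γ i G j).val.grp.length + l.length ≤ n * 3 + 1 + G.grp.length +
        (l.length + 1) by omega)
    rw [add_mul, one_mul]
    omega

theorem toGTodd_time_le {U : ℕ} (hU : (I.num i).length ≤ U) :
    (I.toGTodd γ i).time ≤ U * (3 + n * 3) + d * (n * 3 + 1 + d) := by
  have h1 := Timed.mapL_time_le (3 + n * 3) (fun τ : LaurentTerm m n => do
    let c ← (⟨(τ.coeff : ZMod p), 3⟩ : Timed (ZMod p))
    let a ← innerMod γ τ.zexp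
    pure (⟨c, τ.xexp, a⟩ : ExpTerm p m)) (I.num i) fun τ _ => by
      have := innerMod_time_le γ τ.zexp
      simp only [Timed.bind_time, Timed.pure_time]
      omega
  have h2 := I.fold_groupStep_time_le γ i (List.finRange d)
    ⟨(Timed.mapL (fun τ : LaurentTerm m n => do
      let c ← (⟨(τ.coeff : ZMod p), 3⟩ : Timed (ZMod p))
      let a ← innerMod γ τ.zexp
      pure (⟨c, τ.xexp, a⟩ : ExpTerm p m)) (I.num i)).val, [], []⟩
  rw [List.length_finRange] at h2
  have h3 := Nat.mul_le_mul_right (3 + n * 3) hU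
  rw [toGTodd, Timed.bind_time]
  exact Nat.add_le_add (h1.trans h3) h2

/-- With D = d + 1, 60 U (2^D)^4 = 960 U 16^d. One further U 16^d covers the d² comparisons made
while grouping. -/
theorem term_time_le {U : ℕ} (hU1 : 1 ≤ U) (hn : 1 ≤ n) (hU : (I.num i).length ≤ U) :
    (do
      let G ← I.toGTodd γ i
      G.ctGTodd : Timed (List (SimpleFrac p m))).time ≤
      6 * ((d + U) * n) + 961 * (U * 16 ^ d) := by
  have h1 := I.toGTodd_time_le γ i hU
  have hlen := I.toGTodd_length γ i
  have hgrp := I.toGTodd_grp_length_le γ i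
  have h2 := (I.toGTodd γ i).val.ctGTodd_time_le U (d + 1) hU1
    (by rw [toGTodd_L, List.length_map]; exact hU)
    (fun g hg => by
      have := List.single_le_sum (l := (I.toGTodd γ i).val.grp.map fun g => g.2.length)
        (fun _ _ => Nat.zero_le _) _ (List.mem_map_of_mem hg)
      omega) (by omega)
  rw [Timed.bind_time]
  have h3 : 60 * U * (2 ^ (d + 1)) ^ 4 = 960 * (U * 16 ^ d) := by
    rw [← pow_mul, mul_comm (d + 1), pow_mul, pow_succ]; norm_num; ring
  have h4 : d * d ≤ U * 16 ^ d := by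
    calc d * d ≤ 2 ^ d * 2 ^ d := Nat.mul_le_mul Nat.lt_two_pow_self.le Nat.lt_two_pow_self.le
      _ = 4 ^ d := by rw [← mul_pow]; norm_num
      _ ≤ 16 ^ d := Nat.pow_le_pow_left (by norm_num) d
      _ ≤ _ := Nat.le_mul_of_pos_left _ hU1
  have h5 : U ≤ U * n := Nat.le_mul_of_pos_right _ hn
  have h6 : d ≤ d * n := Nat.le_mul_of_pos_right _ hn
  have h7 : U * (3 + n * 3) + d * (n * 3 + 1 + d) =
      3 * U + 3 * (U * n) + (3 * (d * n) + d + d * d) := by ring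
  have h8 : 6 * ((d + U) * n) = 6 * (d * n) + 6 * (U * n) := by ring
  omega

end ShortSum

theorem sixteen_pow_le (d : ℕ) (hd : 1 ≤ d) : (16 : ℝ) ^ d ≤ 16 ^ 16 * (d : ℝ) ^ d := by
  have h1 : (1 : ℝ) ≤ d := by exact_mod_cast hd
  rcases Nat.lt_or_ge d 16 with h | h
  · calc (16 : ℝ) ^ d ≤ 16 ^ 16 := pow_le_pow_right₀ (by norm_num) h.le
      _ ≤ _ := le_mul_of_one_le_right (by positivity) (one_le_pow₀ h1)
  · calc (16 : ℝ) ^ d ≤ (d : ℝ) ^ d := pow_le_pow_left₀ (by norm_num) (by exact_mod_cast h) d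
      _ ≤ _ := le_mul_of_one_le_left (by positivity) (one_le_pow₀ (by norm_num))

/-- For d ≥ 2 one has d log d ≥ 2 log 2 > 1, so d^d ≤ d^(d+1) log d. For d = 1 the logarithm is 0
and U is bounded by (d + U) n. -/
theorem mul_sixteen_pow_le (d n U : ℕ) (hd : 1 ≤ d) (hn : 1 ≤ n) :
    (U : ℝ) * 16 ^ d ≤
      16 ^ 16 * (U * ((d : ℝ) ^ (d + 1) * Real.log d) + (d + U) * n) := by
  have hn1 : (1 : ℝ) ≤ n := by exact_mod_cast hn
  rcases hd.eq_or_lt with rfl | hd2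
  · have h1 : (U : ℝ) ≤ (1 + U) * n := by
      nlinarith [(Nat.cast_nonneg U : (0 : ℝ) ≤ U)]
    simp only [Nat.cast_one, Real.log_one, mul_zero, zero_add, pow_one]
    nlinarith [(Nat.cast_nonneg U : (0 : ℝ) ≤ U)]
  · have hd2' : (2 : ℝ) ≤ d := by exact_mod_cast hd2
    have h2 : 1 ≤ (d : ℝ) * Real.log d := by
      have h3 := Real.log_le_log (by norm_num) hd2'
      have h4 := Real.log_two_gt_d9
      nlinarith
    have h5 : (d : ℝ) ^ d ≤ (d : ℝ) ^ (d + 1) * Real.log d := by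
      rw [pow_succ, mul_assoc]
      exact le_mul_of_one_le_right (by positivity) h2
    have h6 := sixteen_pow_le d hd
    calc (U : ℝ) * 16 ^ d ≤ U * (16 ^ 16 * ((d : ℝ) ^ (d + 1) * Real.log d)) :=
          mul_le_mul_of_nonneg_left (h6.trans (mul_le_mul_of_nonneg_left h5 (by positivity)))
            (by positivity)
      _ = 16 ^ 16 * (U * ((d : ℝ) ^ (d + 1) * Real.log d)) := by ring
      _ ≤ _ := mul_le_mul_of_nonneg_left (le_add_of_nonneg_right (by positivity)) (by positivity)

namespace ShortSum

variable (I : ShortSum m n N d)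

theorem terms_time_le {U : ℕ} (hU1 : 1 ≤ U) (hn : 1 ≤ n) (hd : 1 ≤ d)
    (hU : ∀ i, (I.num i).length ≤ U) (γ : Fin n → ZMod p) :
    ((Timed.mapL (fun i => do
      let G ← I.toGTodd γ i
      G.ctGTodd) (List.finRange N)).time : ℝ) ≤ (6 + 961 * 16 ^ 16) *
      (N * (U * ((d : ℝ) ^ (d + 1) * Real.log d) + (d + U) * n)) := by
  have h1 := Timed.mapL_time_le (6 * ((d + U) * n) + 961 * (U * 16 ^ d)) (fun i => do
      let G ← I.toGTodd γ i
      G.ctGTodd) (List.finRange N) fun i _ => I.term_time_le γ i hU1 hn (hU i)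
  rw [List.length_finRange] at h1
  have h2 := mul_sixteen_pow_le d n U hd hn
  have h3 : (0 : ℝ) ≤ U * ((d : ℝ) ^ (d + 1) * Real.log d) := by
    have := Real.log_nonneg (by exact_mod_cast hd : (1 : ℝ) ≤ d)
    positivity
  refine (Nat.cast_le (α := ℝ).2 h1).trans ?_
  push_cast
  have h4 : 6 * (((d : ℝ) + U) * n) + 961 * (U * 16 ^ d) ≤ (6 + 961 * 16 ^ 16) *
      (U * ((d : ℝ) ^ (d + 1) * Real.log d) + (d + U) * n) := by
    set X : ℝ := U * ((d : ℝ) ^ (d + 1) * Real.log d)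
    set Y : ℝ := ((d : ℝ) + U) * n
    calc 6 * Y + 961 * (U * 16 ^ d) ≤ 6 * (X + Y) + 961 * (16 ^ 16 * (X + Y)) :=
          add_le_add (mul_le_mul_of_nonneg_left (le_add_of_nonneg_left h3) (by norm_num))
            (mul_le_mul_of_nonneg_left h2 (by norm_num))
      _ = _ := by ring
  calc _ ≤ (N : ℝ) * ((6 + 961 * 16 ^ 16) *
        (U * ((d : ℝ) ^ (d + 1) * Real.log d) + (d + U) * n)) :=
        mul_le_mul_of_nonneg_left h4 (by positivity)
    _ = _ := by ring

/-- The case distinction matters for k = 0, where the claimed bound on the time is 0. -/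
theorem process_time_le {U : ℕ} (hU1 : 1 ≤ U) (hn : 1 ≤ n) (hd : 1 ≤ d)
    (hU : ∀ i, (I.num i).length ≤ U) (l : List (Fin n → ZMod p)) :
    ((I.process l).time : ℝ) ≤ (I.findValid l).time + (if l = [] then 0 else
      (6 + 961 * 16 ^ 16) * (N * (U * ((d : ℝ) ^ (d + 1) * Real.log d) + (d + U) * n))) := by
  have hT : (0 : ℝ) ≤ (6 + 961 * 16 ^ 16) *
      (N * (U * ((d : ℝ) ^ (d + 1) * Real.log d) + (d + U) * n)) := by
    have := Real.log_nonneg (by exact_mod_cast hd : (1 : ℝ) ≤ d)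
    positivity
  rw [process_time, Nat.cast_add]
  refine add_le_add le_rfl ?_
  rcases h : (I.findValid l).val with _ | γ
  · simp only [Option.elim, Nat.cast_zero]
    split_ifs
    · exact le_rfl
    · exact hT
  · rw [if_neg (by rintro rfl; simp [findValid] at h)]
    exact I.terms_time_le hU1 hn hd hU γ

end ShortSum

end TotalTime

end

theorem mainTheorem10 (c : ℝ) (hc : 1 < c) :
    ∃ K : ℝ, 0 < K ∧
      ∀ (m n N d U : ℕ) (_ : 1 ≤ m) (_ : 1 ≤ n) (_ : 1 ≤ N) (_ : 1 ≤ d) (_ : 1 ≤ U)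
        (I : ShortSum m n N d) (_ : ∀ i, (I.num i).length ≤ U)
        (V : RatFun (Fin m) ℚ) (_ : I.HasLimitAtOne V)
        (p : ℕ) [Fact p.Prime] (_ : c * (I.S.card : ℝ) ≤ p)
        (_ : ∀ ij ∈ I.S, ∃ k, ¬ (p : ℤ) ∣ I.β ij.1 ij.2 k)
        (_ : ∀ i, ∀ τ ∈ I.num i, ¬ p ∣ τ.coeff.den),
        -- `p` is suitable for all terms whenever `γ` is valid, and a positive fraction of all `γ` is valid
        (∀ γ : Fin n → ZMod p, I.Valid p γ → ∀ i, (I.toGTodd γ i).val.Suitable) ∧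
        (1 - 1 / c) * (p : ℝ) ^ n ≤
          ({γ : Fin n → ZMod p | I.Valid p γ}.ncard : ℝ) ∧
        -- the process with at most `k` independent uniform random choices of `γ`
        ∀ k : ℕ,
          (∀ γs : Fin k → Fin n → ZMod p,
            (∀ out, (I.process (List.ofFn γs)).val = some out →
              ReducesMod p V (out.map SimpleFrac.value).sum) ∧
            ((I.process (List.ofFn γs)).time : ℝ) ≤
              K * k * (N * (U * ((d : ℝ) ^ (d + 1) * Real.log d) + (d + U) * n))) ∧
          ({γs : Fin k → Fin n → ZMod p | (I.process (List.ofFn γs)).val = none}.ncard : ℝ) ≤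
            (1 / c) ^ k * Fintype.card (Fin k → Fin n → ZMod p) ∧
          ∑ γs : Fin k → Fin n → ZMod p, ((I.process (List.ofFn γs)).time : ℝ) ≤
            K * (N * (U * ((d : ℝ) ^ (d + 1) * Real.log d) + (d + U) * n)) *
              Fintype.card (Fin k → Fin n → ZMod p) := by
  have hc1 : 0 < c - 1 := by linarith
  have hc0 : 0 < c := by linarith
  -- The summands pay for the expected search, for the search in the worst case per draw, and for
  -- the constant term computations.
  refine ⟨6 * (c / (c - 1)) + 6 + (6 + 961 * 16 ^ 16), by positivity, ?_⟩
  intro m n N d U _ hn hN hd hU1 I hU V hV p _ hp hβ hden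
  have hp0 : (0 : ℝ) < p := by exact_mod_cast (Fact.out : p.Prime).pos
  -- Strictness comes from c > 1 when S is nonempty and from p > 0 when S is empty.
  have hS : I.S.card < p := by
    have h1 : (I.S.card : ℝ) < p := by
      rcases Nat.eq_zero_or_pos I.S.card with h | h
      · rw [h, Nat.cast_zero]; exact hp0
      · have h2 : (1 : ℝ) ≤ I.S.card := by exact_mod_cast h
        nlinarith
    exact_mod_cast h1
  set T : ℝ := N * (U * ((d : ℝ) ^ (d + 1) * Real.log d) + (d + U) * n) with hT
  set K₁ : ℝ := 6 + 961 * 16 ^ 16 with hK₁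
  have hK₁0 : 0 < K₁ := by positivity
  have hlog := Real.log_nonneg (by exact_mod_cast hd : (1 : ℝ) ≤ d)
  have hT0 : 0 ≤ T := by positivity
  have hNT : (N : ℝ) * d * n ≤ T := by
    have h1 : (0 : ℝ) ≤ N * (U * ((d : ℝ) ^ (d + 1) * Real.log d) + U * n) := by positivity
    have h2 : T = N * d * n + N * (U * ((d : ℝ) ^ (d + 1) * Real.log d) + U * n) := by
      rw [hT]; ring
    linarith
  have hcard : ∀ k : ℕ, (Fintype.card (Fin k → Fin n → ZMod p) : ℝ) = ((p : ℝ) ^ n) ^ k := by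
    intro k
    rw [Fintype.card_fun, Fintype.card_fun, ZMod.card, Fintype.card_fin, Fintype.card_fin]
    push_cast
    rfl
  refine ⟨fun γ hγ i => I.suitable γ hS hγ i, I.ncard_valid_ge hc hp hβ, fun k => ⟨fun γs =>
    ⟨fun out hout => I.process_reducesMod hS hV hden _ out hout, ?_⟩, ?_, ?_⟩⟩
  · refine (I.process_time_le hU1 hn hd hU _).trans ?_
    have h1 := I.findValid_time_le hn hN hd (List.ofFn γs)
    rw [List.length_ofFn] at h1
    have h2 : ((I.findValid (List.ofFn γs)).time : ℝ) ≤ k * (6 * (N * d * n)) := by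
      exact_mod_cast h1
    rcases Nat.eq_zero_or_pos k with rfl | hk
    · rw [if_pos (by simp)]
      simp only [Nat.cast_zero, zero_mul, mul_zero, add_zero] at h2 ⊢
      exact h2
    · have h3 : (1 : ℝ) ≤ k := by exact_mod_cast hk
      have h4 : (k : ℝ) * (6 * (N * d * n)) ≤ 6 * (k * T) := by nlinarith
      have h5 : K₁ * T ≤ K₁ * (k * T) :=
        mul_le_mul_of_nonneg_left (le_mul_of_one_le_left hT0 h3) hK₁0.le
      have h6 : (if List.ofFn γs = [] then 0 else K₁ * T) ≤ K₁ * T := by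
        split_ifs
        · positivity
        · exact le_rfl
      have h7 : (0 : ℝ) ≤ 6 * (c / (c - 1)) * (k * T) := by positivity
      calc _ ≤ (k : ℝ) * (6 * (N * d * n)) + K₁ * T := add_le_add h2 h6
        _ ≤ 6 * (c / (c - 1)) * (k * T) + 6 * (k * T) + K₁ * (k * T) := by linarith
        _ = _ := by ring
  · rw [hcard]
    exact I.ncard_none_le hc hp hβ k
  · have h1 := I.sum_findValid_time_le hn hN hd hc hp hβ k
    have h2 : ∑ γs : Fin k → Fin n → ZMod p, ((I.process (List.ofFn γs)).time : ℝ) ≤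
        ∑ γs : Fin k → Fin n → ZMod p, (((I.findValid (List.ofFn γs)).time : ℝ) + K₁ * T) := by
      refine Finset.sum_le_sum fun γs _ => (I.process_time_le hU1 hn hd hU _).trans
        (add_le_add le_rfl ?_)
      split_ifs
      · positivity
      · exact le_rfl
    rw [Finset.sum_add_distrib, Finset.sum_const, Finset.card_univ, nsmul_eq_mul, hcard] at h2
    rw [hcard]
    have h3 : c / (c - 1) * (6 * (N * d * n)) * ((p : ℝ) ^ n) ^ k ≤
        6 * (c / (c - 1)) * T * ((p : ℝ) ^ n) ^ k := by
      refine mul_le_mul_of_nonneg_right ?_ (by positivity)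
      have h4 : (0 : ℝ) ≤ c / (c - 1) := by positivity
      nlinarith
    have h5 : (0 : ℝ) ≤ 6 * T * ((p : ℝ) ^ n) ^ k := by positivity
    calc _ ≤ 6 * (c / (c - 1)) * T * ((p : ℝ) ^ n) ^ k + ((p : ℝ) ^ n) ^ k * (K₁ * T) :=
          h2.trans (add_le_add (h1.trans h3) le_rfl)
      _ ≤ 6 * (c / (c - 1)) * T * ((p : ℝ) ^ n) ^ k + 6 * T * ((p : ℝ) ^ n) ^ k +
          ((p : ℝ) ^ n) ^ k * (K₁ * T) := by linarith
      _ = _ := by ring
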